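/- Let $\mathbb N^\times$ be the multiplicative monoid of integers $k\ge 1$, viewed as a category with one object, and let $\widehat{\mathbb N^\times}$ be the topos of presheaves of sets on it, i.e. of sets with an action of $\mathbb N^\times$. A point $\mathfrak p$ of this topos is given by a flat (filtering) functor $\mathbb N^\times\to\mathfrak{Sets}$, i.e. by a non-empty set $X$ with an action $F$ of $\mathbb N^\times$ such that any $x,x'\in X$ are of the form $x=F(k)z$, $x'=F(k')z$ for some $z \in X$ and $k,k'\in\mathbb N^\times$, and such that $F(k)x=F(k')x$ implies $k=k'$; isomorphisms of points are equivariant bijections. The stalk of an object $Y$ at $\mathfrak p$ is the filtered colimit $(Y\times X)/\sim$, where $\sim$ is the equivalence relation generated by $(y,F(k)x)\sim(k\cdot y,x)$. Let $\mathcal K$ be the $C^*$-algebra of compact operators on $\ell^2(\mathbb Z)$, with canonical basis $(\delta_n)_{n\in\mathbb Z}$, on which $k\in\mathbb N^\times$ acts by $\mathrm{Fr}_k(x)=\sum_{0\le j<k}u(k,j)\,x\,u(k,j)^*$, where $u(k,j)$ is the isometry of $\ell^2(\mathbb Z)$ with $u(k,j)\delta_n=\delta_{kn+j}$. An involutive complex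 algebra $A$ is called a pre-$C^*$-algebra if $$\|x\|:=\sup\{|\lambda|^{1/2} : \lambda\in\mathbb C,\ x^*x-\lambda\ \text{is not invertible in}\ A\oplus\mathbb C\}$$ (where $A\oplus\mathbb C$ is $A$ with a unit adjoined) defines a norm on $A$ whose completion is a $C^*$-algebra. A $C^*$-algebra is called matroid if it is an inductive limit of full matrix algebras $M_n(\mathbb C)$, $n\ge 1$, i.e. if it has a directed family of $*$-subalgebras, each isomorphic to some $M_n(\mathbb C)$ (and not required to share a unit), whose union is dense. A matroid $C^*$-algebra is called infinite if it has no non-zero bounded trace, i.e. no non-zero bounded positive linear functional $\tau$ with $\tau(ab)=\tau(ba)$ for all $a,b$. Then: (i) With the usual sum, scalar multiples, product and adjoint of compact operators, $\mathcal K$ is an involutive algebra in the topos $\widehat{\mathbb N^\times}$. (ii) For every point $\mathfrak p$ of $\widehat{\mathbb N^\times}$, the stalk of $\mathcal K$ at $\mathfrak p$, with the induced structure of involutive algebra, is a pre-$C^*$-algebra, and its completion $\mathcal K_{\mathfrak p}$ is an infinite separable matroid $C^*$-algebra. (iii) For every infinite separable matroid $C^*$-algebra $A$ there is a point $\mathfrak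 p$ of $\widehat{\mathbb N^\times}$, unique up to isomorphism, such that $\mathcal K_{\mathfrak p}$ is isomorphic to $A$. -/

import Mathlib

universe w v u

section InternalAlgebra

open CategoryTheory MonoidalCategory CartesianMonoidalCategory

/-! ### Involutive algebras in a category with finite products -/

/-- An involutive (associative, not necessarily unital) complex algebra internal to a category
with finite products. The scalars act through one endomorphism `smul c` for every `c : ℂ`; in a
topos this is the same as an action of the constant object `ℂ`, which is a sum of copies of the
terminal object. The identities are stated on generalized elements `T ⟶ X`. -/
structure InvolutiveAlgebraObj {𝓔 : Type u} [Category.{v} 𝓔] [CartesianMonoidalCategory 𝓔]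
    (X : 𝓔) where
  zero : 𝟙_ 𝓔 ⟶ X
  add : X ⊗ X ⟶ X
  neg : X ⟶ X
  smul : ℂ → (X ⟶ X)
  mul : X ⊗ X ⟶ X
  star : X ⟶ X
  add_assoc : ∀ {T : 𝓔} (f g h : T ⟶ X),
    lift (lift f g ≫ add) h ≫ add = lift f (lift g h ≫ add) ≫ add
  add_comm : ∀ {T : 𝓔} (f g : T ⟶ X), lift f g ≫ add = lift g f ≫ add
  zero_add : ∀ {T : 𝓔} (f : T ⟶ X), lift (toUnit T ≫ zero) f ≫ add = f
  neg_add_cancel : ∀ {T : 𝓔} (f : T ⟶ X), lift (f ≫ neg) f ≫ add = toUnit T ≫ zero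
  one_smul : smul 1 = 𝟙 X
  mul_smul : ∀ c d : ℂ, smul (c * d) = smul d ≫ smul c
  smul_add : ∀ (c : ℂ) {T : 𝓔} (f g : T ⟶ X),
    lift f g ≫ add ≫ smul c = lift (f ≫ smul c) (g ≫ smul c) ≫ add
  add_smul : ∀ (c d : ℂ) {T : 𝓔} (f : T ⟶ X),
    f ≫ smul (c + d) = lift (f ≫ smul c) (f ≫ smul d) ≫ add
  mul_assoc : ∀ {T : 𝓔} (f g h : T ⟶ X),
    lift (lift f g ≫ mul) h ≫ mul = lift f (lift g h ≫ mul) ≫ mul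
  left_distrib : ∀ {T : 𝓔} (f g h : T ⟶ X),
    lift f (lift g h ≫ add) ≫ mul = lift (lift f g ≫ mul) (lift f h ≫ mul) ≫ add
  right_distrib : ∀ {T : 𝓔} (f g h : T ⟶ X),
    lift (lift f g ≫ add) h ≫ mul = lift (lift f h ≫ mul) (lift g h ≫ mul) ≫ add
  smul_mul : ∀ (c : ℂ) {T : 𝓔} (f g : T ⟶ X),
    lift (f ≫ smul c) g ≫ mul = lift f g ≫ mul ≫ smul c
  mul_smul_comm : ∀ (c : ℂ) {T : 𝓔} (f g : T ⟶ X),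
    lift f (g ≫ smul c) ≫ mul = lift f g ≫ mul ≫ smul c
  star_star : star ≫ star = 𝟙 X
  star_add : ∀ {T : 𝓔} (f g : T ⟶ X),
    lift f g ≫ add ≫ star = lift (f ≫ star) (g ≫ star) ≫ add
  star_mul : ∀ {T : 𝓔} (f g : T ⟶ X),
    lift f g ≫ mul ≫ star = lift (g ≫ star) (f ≫ star) ≫ mul
  star_smul : ∀ c : ℂ, smul c ≫ star = star ≫ smul (starRingEnd ℂ c)

namespace InvolutiveAlgebraObj

variable {𝓔 : Type u} [Category.{v} 𝓔] [CartesianMonoidalCategory 𝓔] {X : 𝓔}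

/-- The set `F(X)`, where `X` is an internal involutive algebra and `F` is a set-valued functor
which preserves finite products. It carries the involutive algebra structure below. -/
@[nolint unusedArguments]
def Fiber (_S : InvolutiveAlgebraObj X) (F : 𝓔 ⥤ Type w) [F.Monoidal] : Type w := F.obj X

/-- The binary operation on `F(X)` induced by a morphism `X ⊗ X ⟶ X`, through the
identification of `F(X ⊗ X)` with `F(X) × F(X)`. -/
def binop (F : 𝓔 ⥤ Type w) [F.Monoidal] (m : X ⊗ X ⟶ X) (s t : F.obj X) : F.obj X :=
  F.map m (Functor.LaxMonoidal.μ F X X (s, t))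

variable (F : 𝓔 ⥤ Type w) [F.Monoidal]

lemma binop_map (m : X ⊗ X ⟶ X) {T : 𝓔} (f g : T ⟶ X) (e : F.obj T) :
    binop F m (F.map f e) (F.map g e) = F.map (lift f g ≫ m) e := by
  have h := Functor.Monoidal.lift_μ F f g
  have h2 := congrArg (fun k => k e) h
  simp only [Functor.map_comp]
  rw [← h]
  rfl

lemma exists_rep₂ (s t : F.obj X) :
    ∃ (T : 𝓔) (f g : T ⟶ X) (e : F.obj T), F.map f e = s ∧ F.map g e = t := by
  refine ⟨X ⊗ X, fst X X, snd X X, Functor.LaxMonoidal.μ F X X (s, t), ?_, ?_⟩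
  · exact congrArg (fun k => k (s, t)) (Functor.Monoidal.μ_fst F X X)
  · exact congrArg (fun k => k (s, t)) (Functor.Monoidal.μ_snd F X X)

lemma exists_rep₃ (r s t : F.obj X) :
    ∃ (T : 𝓔) (f g h : T ⟶ X) (e : F.obj T),
      F.map f e = r ∧ F.map g e = s ∧ F.map h e = t := by
  obtain ⟨T, f, g, e, rfl, rfl⟩ := exists_rep₂ F r s
  refine ⟨T ⊗ X, fst T X ≫ f, fst T X ≫ g, snd T X, Functor.LaxMonoidal.μ F T X (e, t), ?_, ?_, ?_⟩
  · have := congrArg (fun k => k (e, t)) (Functor.Monoidal.μ_fst F T X)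
    simp only [Functor.map_comp]
    exact congrArg (F.map f) this
  · have := congrArg (fun k => k (e, t)) (Functor.Monoidal.μ_fst F T X)
    simp only [Functor.map_comp]
    exact congrArg (F.map g) this
  · exact congrArg (fun k => k (e, t)) (Functor.Monoidal.μ_snd F T X)


variable (S : InvolutiveAlgebraObj X)

instance : Zero (S.Fiber F) := ⟨F.map S.zero (Functor.LaxMonoidal.ε F PUnit.unit)⟩
instance : Add (S.Fiber F) := ⟨binop F S.add⟩
instance : Neg (S.Fiber F) := ⟨F.map S.neg⟩
instance : Mul (S.Fiber F) := ⟨binop F S.mul⟩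
instance : SMul ℂ (S.Fiber F) := ⟨fun c => F.map (S.smul c)⟩
instance : Star (S.Fiber F) := ⟨F.map S.star⟩

/-- The element of `F(X)` which is the image of `e ∈ F(T)` by a generalized element `T ⟶ X`. -/
def el {T : 𝓔} (f : T ⟶ X) (e : F.obj T) : S.Fiber F := F.map f e

lemma fiber_rep₂ (s t : S.Fiber F) :
    ∃ (T : 𝓔) (f g : T ⟶ X) (e : F.obj T), S.el F f e = s ∧ S.el F g e = t :=
  exists_rep₂ F s t

lemma fiber_rep₃ (r s t : S.Fiber F) :
    ∃ (T : 𝓔) (f g h : T ⟶ X) (e : F.obj T),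
      S.el F f e = r ∧ S.el F g e = s ∧ S.el F h e = t :=
  exists_rep₃ F r s t

lemma fiber_zero {T : 𝓔} (e : F.obj T) :
    (0 : S.Fiber F) = S.el F (toUnit T ≫ S.zero) e := by
  have h : F.map (toUnit T) e = Functor.LaxMonoidal.ε F PUnit.unit := by
    have h1 : Function.Injective (Functor.OplaxMonoidal.η F) :=
      (mono_iff_injective _).1 inferInstance
    exact h1 (Subsingleton.elim (α := PUnit) _ _)
  change F.map S.zero _ = _
  unfold el
  rw [← h, Functor.map_comp]
  rfl

lemma fiber_add {T : 𝓔} (f g : T ⟶ X) (e : F.obj T) :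
    S.el F f e + S.el F g e = S.el F (lift f g ≫ S.add) e := binop_map F S.add f g e

lemma fiber_mul {T : 𝓔} (f g : T ⟶ X) (e : F.obj T) :
    S.el F f e * S.el F g e = S.el F (lift f g ≫ S.mul) e := binop_map F S.mul f g e

lemma fiber_neg {T : 𝓔} (f : T ⟶ X) (e : F.obj T) :
    -S.el F f e = S.el F (f ≫ S.neg) e := by
  unfold el; rw [Functor.map_comp]; rfl

lemma fiber_smul (c : ℂ) {T : 𝓔} (f : T ⟶ X) (e : F.obj T) :
    c • S.el F f e = S.el F (f ≫ S.smul c) e := by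
  unfold el; rw [Functor.map_comp]; rfl

lemma fiber_star {T : 𝓔} (f : T ⟶ X) (e : F.obj T) :
    Star.star (S.el F f e) = S.el F (f ≫ S.star) e := by
  unfold el; rw [Functor.map_comp]; rfl

protected lemma fiber_add_comm (s t : S.Fiber F) : s + t = t + s := by
  obtain ⟨T, f, g, e, rfl, rfl⟩ := S.fiber_rep₂ F s t
  rw [fiber_add, fiber_add, S.add_comm]

protected lemma fiber_zero_add (s : S.Fiber F) : 0 + s = s := by
  obtain ⟨T, f, g, e, rfl, -⟩ := S.fiber_rep₂ F s s
  rw [fiber_zero F S e, fiber_add, S.zero_add]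

protected lemma fiber_neg_add_cancel (s : S.Fiber F) : -s + s = 0 := by
  obtain ⟨T, f, g, e, rfl, -⟩ := S.fiber_rep₂ F s s
  rw [fiber_zero F S e, fiber_neg, fiber_add, S.neg_add_cancel]

protected lemma fiber_left_distrib (r s t : S.Fiber F) : r * (s + t) = r * s + r * t := by
  obtain ⟨T, f, g, h, e, rfl, rfl, rfl⟩ := S.fiber_rep₃ F r s t
  simp only [fiber_add, fiber_mul, S.left_distrib]

protected lemma fiber_right_distrib (r s t : S.Fiber F) : (r + s) * t = r * t + s * t := by
  obtain ⟨T, f, g, h, e, rfl, rfl, rfl⟩ := S.fiber_rep₃ F r s t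
  simp only [fiber_add, fiber_mul, S.right_distrib]

instance : AddCommGroup (S.Fiber F) where
  add_assoc r s t := by
    obtain ⟨T, f, g, h, e, rfl, rfl, rfl⟩ := S.fiber_rep₃ F r s t
    simp only [fiber_add, S.add_assoc]
  zero_add := S.fiber_zero_add F
  add_zero s := by rw [S.fiber_add_comm F, S.fiber_zero_add F]
  neg_add_cancel := S.fiber_neg_add_cancel F
  add_comm := S.fiber_add_comm F
  nsmul := nsmulRec
  zsmul := zsmulRec

instance : NonUnitalRing (S.Fiber F) where
  left_distrib := S.fiber_left_distrib F
  right_distrib := S.fiber_right_distrib F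
  zero_mul s := by
    have h := S.fiber_right_distrib F 0 0 s
    rwa [_root_.add_zero, left_eq_add] at h
  mul_zero s := by
    have h := S.fiber_left_distrib F s 0 0
    rwa [_root_.add_zero, left_eq_add] at h
  mul_assoc r s t := by
    obtain ⟨T, f, g, h, e, rfl, rfl, rfl⟩ := S.fiber_rep₃ F r s t
    simp only [fiber_mul, S.mul_assoc]

protected lemma fiber_smul_add (c : ℂ) (s t : S.Fiber F) : c • (s + t) = c • s + c • t := by
  obtain ⟨T, f, g, e, rfl, rfl⟩ := S.fiber_rep₂ F s t
  simp only [fiber_add, fiber_smul, Category.assoc, S.smul_add]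

protected lemma fiber_add_smul (c d : ℂ) (s : S.Fiber F) : (c + d) • s = c • s + d • s := by
  obtain ⟨T, f, g, e, rfl, -⟩ := S.fiber_rep₂ F s s
  simp only [fiber_add, fiber_smul, S.add_smul]

instance : Module ℂ (S.Fiber F) where
  one_smul s := by
    change F.map (S.smul 1) s = s
    rw [S.one_smul, F.map_id]; rfl
  mul_smul c d s := by
    change F.map (S.smul (c * d)) s = F.map (S.smul c) (F.map (S.smul d) s)
    rw [S.mul_smul, F.map_comp]; rfl
  smul_zero c := by
    have h := S.fiber_smul_add F c 0 0
    rwa [_root_.add_zero, left_eq_add] at h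
  smul_add := S.fiber_smul_add F
  add_smul := S.fiber_add_smul F
  zero_smul s := by
    have h := S.fiber_add_smul F 0 0 s
    rwa [_root_.add_zero, left_eq_add] at h

instance : IsScalarTower ℂ (S.Fiber F) (S.Fiber F) where
  smul_assoc c s t := by
    obtain ⟨T, f, g, e, rfl, rfl⟩ := S.fiber_rep₂ F s t
    simp only [smul_eq_mul, fiber_mul, fiber_smul, Category.assoc, S.smul_mul]

instance : SMulCommClass ℂ (S.Fiber F) (S.Fiber F) where
  smul_comm c s t := by
    obtain ⟨T, f, g, e, rfl, rfl⟩ := S.fiber_rep₂ F s t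
    simp only [smul_eq_mul, fiber_mul, fiber_smul, Category.assoc, S.mul_smul_comm]

instance : StarRing (S.Fiber F) where
  star_involutive s := by
    change F.map S.star (F.map S.star s) = s
    have h := congrArg (fun k => F.map k s) S.star_star
    rw [F.map_comp, F.map_id] at h
    exact h
  star_mul s t := by
    obtain ⟨T, f, g, e, rfl, rfl⟩ := S.fiber_rep₂ F s t
    simp only [fiber_mul, fiber_star, Category.assoc, S.star_mul]
  star_add s t := by
    obtain ⟨T, f, g, e, rfl, rfl⟩ := S.fiber_rep₂ F s t
    simp only [fiber_add, fiber_star, Category.assoc, S.star_add]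

instance : StarModule ℂ (S.Fiber F) where
  star_smul c s := by
    change F.map S.star (F.map (S.smul c) s) = F.map (S.smul (starRingEnd ℂ c)) (F.map S.star s)
    have h := congrArg (fun k => F.map k s) (S.star_smul c)
    rw [F.map_comp, F.map_comp] at h
    exact h

end InvolutiveAlgebraObj

end InternalAlgebra

section Topos

open CategoryTheory

/-- The points of the topos of presheaves of sets on the one-object category with endomorphism
monoid `ℕ^×`, the multiplicative monoid of positive integers. Presheaves are the sheaves for the
trivial topology `⊥`, and a point is given by its fiber functor, a flat (filtering) functor from
the one-object category to sets. -/
abbrev NTimesPoint : Type 1 :=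
  GrothendieckTopology.Point.{0} (⊥ : GrothendieckTopology (SingleObj ℕ+))

/-- The stalk at a point of the topos (the value of the inverse image functor of the point) of an
internal involutive algebra; it is an involutive complex algebra. -/
noncomputable abbrev InvolutiveAlgebraObj.Stalk {P : (SingleObj ℕ+)ᵒᵖ ⥤ Type}
    (S : InvolutiveAlgebraObj P) (p : NTimesPoint) : Type :=
  S.Fiber p.presheafFiber

end Topos

/-! ### The compact operators on `ℓ²(ℤ)` and the endomorphisms `Fr_k` -/

/-- The Hilbert space `ℓ²(ℤ)`. -/
abbrev EllTwoZ : Type := lp (fun _ : ℤ => ℂ) 2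

/-- The canonical orthonormal basis `δ_n` of `ℓ²(ℤ)`. -/
noncomputable def basisVec (n : ℤ) : EllTwoZ := lp.single 2 n 1

lemma orthonormal_basisVec : Orthonormal ℂ basisVec := by
  rw [orthonormal_iff_ite]
  intro i j
  simp only [basisVec]
  rw [lp.inner_single_left]
  by_cases h : i = j
  · subst h; simp
  · simp [lp.single_apply, h]

lemma orthonormal_shift (k : ℕ+) (j : ℕ) :
    Orthonormal ℂ fun n : ℤ => basisVec ((k : ℤ) * n + j) :=
  orthonormal_basisVec.comp _ fun a b h => by
    have hk : (k : ℤ) ≠ 0 := by exact_mod_cast k.ne_zero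
    simpa [hk] using h

/-- The isometry `u(k,j)` of `ℓ²(ℤ)` with `u(k,j) δ_n = δ_{kn+j}`. -/
noncomputable def isom (k : ℕ+) (j : ℕ) : EllTwoZ →ₗᵢ[ℂ] EllTwoZ :=
  (orthonormal_shift k j).orthogonalFamily.linearIsometry

lemma isom_basisVec (k : ℕ+) (j : ℕ) (n : ℤ) :
    isom k j (basisVec n) = basisVec ((k : ℤ) * n + j) := by
  simp only [isom]
  rw [basisVec, OrthogonalFamily.linearIsometry_apply_single]
  simp

/-- `u(k,j)` as a bounded operator. -/
noncomputable def isomCLM (k : ℕ+) (j : ℕ) : EllTwoZ →L[ℂ] EllTwoZ :=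
  (isom k j).toContinuousLinearMap

/-- The operator `Fr_k(x) = ∑_{0 ≤ j < k} u(k,j) x u(k,j)^*`. -/
noncomputable def frobK (k : ℕ+) (x : EllTwoZ →L[ℂ] EllTwoZ) : EllTwoZ →L[ℂ] EllTwoZ :=
  ∑ j ∈ Finset.range k,
    (isomCLM k j).comp (x.comp (ContinuousLinearMap.adjoint (isomCLM k j)))

/-- The set `𝒦` of compact operators on `ℓ²(ℤ)`, a linear subspace of the bounded operators. -/
noncomputable abbrev CompactOps : Submodule ℂ (EllTwoZ →L[ℂ] EllTwoZ) :=
  compactOperator (RingHom.id ℂ) EllTwoZ EllTwoZ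

lemma frobK_mem (k : ℕ+) (x : CompactOps) : frobK k x ∈ CompactOps :=
  Submodule.sum_mem _ fun j _ => (x.2.comp_clm _).clm_comp (isomCLM k j)

lemma ellTwoZ_ext {f g : EllTwoZ →L[ℂ] EllTwoZ} (h : ∀ n, f (basisVec n) = g (basisVec n)) :
    f = g := by
  ext1 v
  have hv := lp.hasSum_single (E := fun _ : ℤ => ℂ) (p := 2) (by norm_num) v
  have e : ∀ n, lp.single (E := fun _ : ℤ => ℂ) 2 n (v n) = v n • basisVec n := by
    intro n
    rw [basisVec, ← lp.single_smul]
    simp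
  have h1 := hv.mapL f
  have h2 := hv.mapL g
  simp only [e, map_smul, h] at h1 h2
  exact h1.unique h2

lemma isomCLM_one : isomCLM 1 0 = ContinuousLinearMap.id ℂ EllTwoZ :=
  ellTwoZ_ext fun n => by simp [isomCLM, isom_basisVec]

lemma isomCLM_comp (k l : ℕ+) (i j : ℕ) :
    (isomCLM k i).comp (isomCLM l j) = isomCLM (k * l) (i + k * j) :=
  ellTwoZ_ext fun n => by
    simp only [isomCLM, ContinuousLinearMap.comp_apply, LinearIsometry.coe_toContinuousLinearMap,
      isom_basisVec]
    congr 1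
    push_cast
    ring

lemma frobK_one (x : EllTwoZ →L[ℂ] EllTwoZ) : frobK 1 x = x := by
  rw [frobK, PNat.one_coe, Finset.sum_range_one, isomCLM_one, ContinuousLinearMap.adjoint_id]
  rfl

lemma sum_range_mul_split {M : Type*} [AddCommMonoid M] (k l : ℕ) (g : ℕ → M) :
    ∑ n ∈ Finset.range (k * l), g n =
      ∑ i ∈ Finset.range k, ∑ j ∈ Finset.range l, g (i + k * j) := by
  rw [mul_comm, Finset.sum_range, ← finProdFinEquiv.sum_comp, Fintype.sum_prod_type,
    Finset.sum_comm, Finset.sum_range]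
  refine Finset.sum_congr rfl fun i _ => ?_
  rw [Finset.sum_range]
  rfl

lemma conj_comp_aux {H : Type*} [NormedAddCommGroup H] [InnerProductSpace ℂ H] [CompleteSpace H]
    (a b x : H →L[ℂ] H) :
    (a.comp b).comp (x.comp (ContinuousLinearMap.adjoint (a.comp b))) =
      a.comp ((b.comp (x.comp (ContinuousLinearMap.adjoint b))).comp
        (ContinuousLinearMap.adjoint a)) := by
  rw [ContinuousLinearMap.adjoint_comp]
  rfl

lemma frobK_mul_aux (k l : ℕ+) (i j : ℕ) (x : EllTwoZ →L[ℂ] EllTwoZ) :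
    (isomCLM (k * l) (i + k * j)).comp
        (x.comp (ContinuousLinearMap.adjoint (isomCLM (k * l) (i + k * j)))) =
      (isomCLM k i).comp (((isomCLM l j).comp (x.comp
        (ContinuousLinearMap.adjoint (isomCLM l j)))).comp
          (ContinuousLinearMap.adjoint (isomCLM k i))) := by
  rw [← isomCLM_comp]
  exact conj_comp_aux _ _ _

lemma sum_comp_aux (s : Finset ℕ) (a b : EllTwoZ →L[ℂ] EllTwoZ)
    (f : ℕ → EllTwoZ →L[ℂ] EllTwoZ) :
    a.comp ((∑ j ∈ s, f j).comp b) = ∑ j ∈ s, a.comp ((f j).comp b) := by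
  rw [ContinuousLinearMap.finsetSum_comp, ContinuousLinearMap.comp_finsetSum]

lemma frobK_mul (k l : ℕ+) (x : EllTwoZ →L[ℂ] EllTwoZ) :
    frobK (k * l) x = frobK k (frobK l x) := by
  unfold frobK
  rw [PNat.mul_coe, sum_range_mul_split]
  refine Finset.sum_congr rfl fun i _ => ?_
  rw [sum_comp_aux]
  exact Finset.sum_congr rfl fun j _ => frobK_mul_aux k l i j x

lemma frobK_mul' (k l : ℕ+) (x : EllTwoZ →L[ℂ] EllTwoZ) :
    frobK (l * k) x = frobK k (frobK l x) := by
  rw [mul_comm, frobK_mul]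

section Presheaf

open CategoryTheory

/-- `𝒦` as an object of the topos: the set of compact operators on `ℓ²(ℤ)`, on which
`k ∈ ℕ^×` acts by `Fr_k`. -/
noncomputable def compactPresheaf : (SingleObj ℕ+)ᵒᵖ ⥤ Type where
  obj _ := CompactOps
  map k := TypeCat.ofHom fun x => ⟨frobK k.unop x, frobK_mem _ x⟩
  map_id _ := by
    exact congrArg TypeCat.ofHom (funext fun x => Subtype.ext (frobK_one x))
  map_comp k l := by
    exact congrArg TypeCat.ofHom (funext fun x => Subtype.ext (frobK_mul' l.unop k.unop x))

end Presheaf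

section OperatorAlgebra

open CategoryTheory

/-- The operator underlying a section of the object `𝒦` of the topos. -/
noncomputable def opOf {c : (SingleObj ℕ+)ᵒᵖ} (x : compactPresheaf.obj c) :
    EllTwoZ →L[ℂ] EllTwoZ :=
  Subtype.val (p := fun T => T ∈ CompactOps) x

/-- The operations of an internal involutive algebra structure on the object `𝒦` of the topos are
the usual ones on compact operators: sum, scalar multiple, composition and adjoint. (The zero and
the negatives are then the usual ones too.) -/
structure IsOperatorAlgebraObj (S : InvolutiveAlgebraObj compactPresheaf) : Prop where
  add : ∀ {c} (x y : compactPresheaf.obj c), opOf (S.add.app c (x, y)) = opOf x + opOf y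
  smul : ∀ {c} (z : ℂ) (x : compactPresheaf.obj c), opOf ((S.smul z).app c x) = z • opOf x
  mul : ∀ {c} (x y : compactPresheaf.obj c),
    opOf (S.mul.app c (x, y)) = (opOf x).comp (opOf y)
  star : ∀ {c} (x : compactPresheaf.obj c),
    opOf (S.star.app c x) = ContinuousLinearMap.adjoint (opOf x)

end OperatorAlgebra

/-! ### Pre-C*-algebras, matroid C*-algebras -/

section PreCStar

variable {A : Type v} [NonUnitalRing A] [StarRing A] [Module ℂ A] [IsScalarTower ℂ A A]
  [SMulCommClass ℂ A A]

/-- `φ` exhibits the C*-algebra `B` as the completion of the involutive algebra `A` for the norm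
`‖x‖ = sup {|z|^{1/2} | z ∈ ℂ, x^* x - z is not invertible in A ⊕ ℂ}`, where `A ⊕ ℂ` is obtained
by adjoining a unit to `A`. (That this formula defines a norm on `A` follows from the existence
of such a `φ`.) -/
structure IsCStarCompletion {B : Type w} [NonUnitalCStarAlgebra B] (φ : A →⋆ₙₐ[ℂ] B) : Prop where
  injective : Function.Injective φ
  denseRange : DenseRange φ
  isLUB_norm : ∀ x : A,
    IsLUB ((fun z : ℂ => √‖z‖) '' spectrum ℂ ((star x * x : A) : Unitization ℂ A)) ‖φ x‖

variable (A)

/-- The involutive algebra `A` is a pre-C*-algebra: the formula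
`‖x‖ = sup {|z|^{1/2} | z ∈ ℂ, x^* x - z is not invertible in A ⊕ ℂ}` defines a norm on `A`, and
the completion of `A` for this norm is a C*-algebra. -/
def IsPreCStarAlgebra : Prop :=
  ∃ (B : Type v) (_ : NonUnitalCStarAlgebra B) (φ : A →⋆ₙₐ[ℂ] B), IsCStarCompletion φ

/-- The C*-algebra `B` is isomorphic to the completion of the pre-C*-algebra `A`. -/
def IsCompletedBy (B : Type w) [NonUnitalCStarAlgebra B] : Prop :=
  ∃ φ : A →⋆ₙₐ[ℂ] B, IsCStarCompletion φ

end PreCStar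

section Matroid

variable (A : Type v) [NonUnitalCStarAlgebra A]

/-- A matroid C*-algebra: an inductive limit of full matrix algebras `M_n(ℂ)`, `n ≥ 1`, where no
compatibility with units is required; in other words, a C*-algebra with a directed family of
*-subalgebras, each isomorphic to some `M_n(ℂ)`, whose union is dense. -/
def IsMatroid : Prop :=
  ∃ 𝓜 : Set (NonUnitalStarSubalgebra ℂ A), DirectedOn (· ≤ ·) 𝓜 ∧
    (∀ M ∈ 𝓜, ∃ n : ℕ, 0 < n ∧ Nonempty (M ≃⋆ₐ[ℂ] Matrix (Fin n) (Fin n) ℂ)) ∧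
    Dense {a : A | ∃ M ∈ 𝓜, a ∈ M}

open scoped ComplexOrder in
/-- Every non-zero trace of `A` is unbounded: `A` has no non-zero bounded trace, i.e. no non-zero
bounded positive linear functional `τ` with `τ(ab) = τ(ba)`. (A matroid C*-algebra has a non-zero
lower semicontinuous, densely defined trace, unique up to scaling; the algebra is called infinite
when this trace is unbounded, finite when it is bounded.) -/
def HasNoBoundedTrace : Prop :=
  ∀ τ : A →L[ℂ] ℂ, (∀ a, 0 ≤ τ (star a * a)) → (∀ a b, τ (a * b) = τ (b * a)) → τ = 0

/-- Infinite separable matroid C*-algebras. -/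
structure IsInfiniteSeparableMatroid : Prop where
  matroid : IsMatroid A
  separable : TopologicalSpace.SeparableSpace A
  infinite : HasNoBoundedTrace A

end Matroid

/-! ### Matrix units and compact operators on `ℓ²(ℤ)` -/

/-! Division with remainder identifies `ℤ` with `ℤ × {0, …, k-1}`, and under this identification
`Fr_k` is the amplification `T ↦ T ⊗ 1_k`. It is an injective, hence isometric, *-endomorphism of
the compact operators. A point is a flat action of `ℕ^×` on a set `X`, and the stalk is the directed
union of copies of `𝒦`, one for each `x ∈ X`, where the copy at `k • x` sits in the copy at `x`
through `Fr_k` (`germ_smul`, `germ_injective`). The norms of the copies agree, which gives a C*-norm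
on the stalk. It is the spectral one because spectra shrink along `𝒦 → stalk → completion` while
both ends have the same norm (`exists_isCStarCompletion`). From there on only the structure
`FrobSystem` matters: compatible embeddings of `𝒦`, indexed by `X`, with dense union.

The completion is matroid because finite corners of `𝒦` are full matrix algebras, and separable
because `X` is countable. It is infinite because a trace takes the same value on infinitely many
orthogonal minimal projections of a copy of `𝒦`, whose finite sums have norm at most one.

Uniqueness. The action is read off the algebra: `x` corresponds to the equivalence class of the rank
one projection of the copy at `x`. Every non-zero projection belongs to such a class
(`exists_idemEquiv`), different `x` give different classes because ranks can be compared in a common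
copy (`eq_of_idemEquiv`), and `k • x` is the sum of `k` copies (`idemEquiv_smul`). Hence
`FrobSystem.exists_equiv`.

Existence. Fix a non-zero projection `e` in one of the matrix algebras of `A`. If the size of the
matrix algebras were bounded relative to the rank of `e`, the traces normalized at `e` would give a
bounded trace, so the ratio is unbounded (`exists_rank_mul_le`). This leaves room to choose
inductively a sequence of matrix algebras with dense union, indexed by finite sets of integers, such
that each inclusion is literally `dilate k` and the index sets outgrow every interval, even measured
in units of the rank `K n` of `e` (`exists_matrixStage_seq`). Let `X` be the positive fractions with
denominators `K n`. Placing the `n`-th algebra in the copy of `𝒦` at `1 / K n` is compatible with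
the inclusions and isometric, and has dense image thanks to the growth of the index sets. The
correspondence therefore extends to an isomorphism of the completions. -/

section CompactAlgebra

open Filter Topology

/-- The matrix unit `|δ_p⟩⟨δ_q|` as a bounded operator on `ℓ²(ℤ)`. -/
noncomputable def opUnit (p q : ℤ) : EllTwoZ →L[ℂ] EllTwoZ :=
  InnerProductSpace.rankOne ℂ (basisVec p) (basisVec q)

lemma inner_basisVec (p q : ℤ) : inner ℂ (basisVec p) (basisVec q) = if p = q then (1 : ℂ) else 0 :=
  (orthonormal_iff_ite.1 orthonormal_basisVec) p q

lemma opUnit_apply (p q : ℤ) (v : EllTwoZ) : opUnit p q v = inner ℂ (basisVec q) v • basisVec p :=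
  rfl

lemma opUnit_mul (p q r s : ℤ) : opUnit p q * opUnit r s = if q = r then opUnit p s else 0 := by
  ext1 v
  simp only [mul_apply_eq_comp, opUnit_apply, inner_smul_right, inner_basisVec]
  split_ifs <;> simp [opUnit_apply]

lemma star_opUnit (p q : ℤ) : star (opUnit p q) = opUnit q p := by
  rw [ContinuousLinearMap.star_eq_adjoint, opUnit, InnerProductSpace.adjoint_rankOne, opUnit]

lemma isCompactOperator_opUnit (p q : ℤ) : IsCompactOperator (opUnit p q) := by
  have h : IsCompactOperator (ContinuousLinearMap.toSpanSingleton ℂ (basisVec p)) :=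
    isCompactOperator_of_locallyCompactSpace_rng _
  exact h.comp_clm (innerSL ℂ (basisVec q))

/-- The orthogonal projection of `ℓ²(ℤ)` onto the span of the `δ_p`, `p ∈ F`. -/
noncomputable def opProj (F : Finset ℤ) : EllTwoZ →L[ℂ] EllTwoZ := ∑ p ∈ F, opUnit p p

lemma isCompactOperator_opProj (F : Finset ℤ) : IsCompactOperator (opProj F) :=
  Submodule.sum_mem CompactOps fun p _ => isCompactOperator_opUnit p p

lemma star_opProj (F : Finset ℤ) : star (opProj F) = opProj F := by
  simp [opProj, star_sum, star_opUnit]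

lemma opProj_mul_self (F : Finset ℤ) : opProj F * opProj F = opProj F := by
  simp only [opProj, Finset.sum_mul_sum, opUnit_mul]
  exact Finset.sum_congr rfl fun p hp => by simp [hp]

lemma norm_opProj_le (F : Finset ℤ) : ‖opProj F‖ ≤ 1 := by
  have h := CStarRing.norm_star_mul_self (x := opProj F)
  rw [star_opProj, opProj_mul_self] at h
  by_contra hc
  push Not at hc
  nlinarith

lemma tendsto_opProj (v : EllTwoZ) : Tendsto (fun F => opProj F v) atTop (𝓝 v) := by
  have hv := lp.hasSum_single (E := fun _ : ℤ => ℂ) (p := 2) (by norm_num) v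
  refine hv.congr fun F => ?_
  simp only [opProj, sum_apply, opUnit_apply]
  refine Finset.sum_congr rfl fun p _ => ?_
  rw [basisVec, ← lp.single_smul, lp.inner_single_left]
  simp

/-- Strong convergence of contractions is uniform on a totally bounded set, here the image of the
unit ball under the compact operator. -/
lemma tendsto_opProj_mul {T : EllTwoZ →L[ℂ] EllTwoZ} (hT : IsCompactOperator T) :
    Tendsto (fun F => opProj F * T) atTop (𝓝 T) := by
  have hc := IsCompactOperator.isCompact_closure_image_closedBall
    (f := (T : EllTwoZ →ₗ[ℂ] EllTwoZ)) hT 1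
  rw [Metric.tendsto_atTop]
  intro ε hε
  obtain ⟨t, htf, ht⟩ := Metric.totallyBounded_iff.1 hc.totallyBounded (ε / 4) (by positivity)
  have hev : ∀ᶠ F in atTop, ∀ y ∈ t, dist (opProj F y) y < ε / 4 :=
    (htf.eventually_all).2 fun y _ =>
      (tendsto_opProj y).eventually (Metric.ball_mem_nhds _ (by positivity))
  obtain ⟨F₀, hF₀⟩ := eventually_atTop.1 hev
  refine ⟨F₀, fun F hF => ?_⟩
  rw [dist_eq_norm]
  refine lt_of_le_of_lt (ContinuousLinearMap.opNorm_le_of_unit_norm (C := 3 * (ε / 4))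
    (by positivity) ?_) (by linarith)
  intro v hv
  have hm := ht (subset_closure ⟨v, by simp [hv], rfl⟩)
  simp only [Set.mem_iUnion, Metric.mem_ball] at hm
  obtain ⟨y, hy, hd⟩ := hm
  have h1 := hF₀ F hF y hy
  rw [dist_eq_norm] at hd h1
  have e : (opProj F * T - T) v = opProj F (T v - y) + (opProj F y - y) - (T v - y) := by
    simp only [sub_apply, mul_apply_eq_comp, map_sub]
    abel
  have h2 : ‖opProj F (T v - y)‖ ≤ 1 * ‖T v - y‖ :=
    (opProj F).le_of_opNorm_le (norm_opProj_le F) _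
  rw [e]
  have := norm_sub_le (opProj F (T v - y) + (opProj F y - y)) (T v - y)
  have := norm_add_le (opProj F (T v - y)) (opProj F y - y)
  have hd' : ‖T v - y‖ < ε / 4 := hd
  linarith

lemma tendsto_mul_opProj {T : EllTwoZ →L[ℂ] EllTwoZ} (hT : IsCompactOperator T) :
    Tendsto (fun F => star T * opProj F) atTop (𝓝 (star T)) := by
  have h := (continuous_star.tendsto _).comp (tendsto_opProj_mul hT)
  refine h.congr fun F => ?_
  simp [star_mul, star_opProj]

/-- The adjoint is a norm limit of operators factoring through finite rank projections, by
`tendsto_mul_opProj`. -/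
lemma isCompactOperator_star {T : EllTwoZ →L[ℂ] EllTwoZ} (hT : IsCompactOperator T) :
    IsCompactOperator (star T : EllTwoZ →L[ℂ] EllTwoZ) :=
  isCompactOperator_of_tendsto (tendsto_mul_opProj hT)
    (Eventually.of_forall fun F => (isCompactOperator_opProj F).clm_comp (star T))

/-- The C*-algebra of compact operators on `ℓ²(ℤ)`. -/
noncomputable def KAlg : NonUnitalStarSubalgebra ℂ (EllTwoZ →L[ℂ] EllTwoZ) where
  carrier := {T | IsCompactOperator T}
  add_mem' {a b} ha hb := IsCompactOperator.add (f := a) (g := b) ha hb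
  zero_mem' := isCompactOperator_zero
  mul_mem' {a b} ha _ := IsCompactOperator.comp_clm (f := a) ha b
  smul_mem' c T hT := IsCompactOperator.smul (f := T) hT c
  star_mem' hT := isCompactOperator_star hT

instance : IsClosed (KAlg : Set (EllTwoZ →L[ℂ] EllTwoZ)) := isClosed_setOfPred_isCompactOperator

/-! Shortcuts for instance search. -/

noncomputable instance : NonUnitalCStarAlgebra KAlg := inferInstance
noncomputable instance : NonUnitalRing KAlg := inferInstance
noncomputable instance : NonUnitalNonAssocSemiring KAlg := inferInstance
noncomputable instance : AddCommGroup KAlg := inferInstance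
noncomputable instance : AddCommMonoid KAlg := inferInstance
noncomputable instance : AddZeroClass KAlg := inferInstance
noncomputable instance : Add KAlg := inferInstance
noncomputable instance : Mul KAlg := inferInstance
noncomputable instance : Zero KAlg := inferInstance
noncomputable instance : Star KAlg := inferInstance
noncomputable instance : Module ℂ KAlg := inferInstance
noncomputable instance : DistribMulAction ℂ KAlg := inferInstance
noncomputable instance : SMul ℂ KAlg := inferInstance

/-- The matrix unit `|δ_p⟩⟨δ_q|` as a compact operator. -/
noncomputable def matUnit (p q : ℤ) : KAlg := ⟨opUnit p q, isCompactOperator_opUnit p q⟩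

lemma matUnit_mul (p q r s : ℤ) :
    matUnit p q * matUnit r s = if q = r then matUnit p s else 0 := by
  apply Subtype.ext
  refine (opUnit_mul p q r s).trans ?_
  split_ifs <;> rfl

lemma star_matUnit (p q : ℤ) : star (matUnit p q) = matUnit q p := Subtype.ext (star_opUnit p q)

lemma matUnit_ne_zero (p q : ℤ) : matUnit p q ≠ 0 := by
  intro h
  have h1 : opUnit p q (basisVec q) = 0 := by
    have : opUnit p q = 0 := congrArg Subtype.val h
    rw [this]; rfl
  rw [opUnit_apply, inner_basisVec] at h1
  have := orthonormal_basisVec.ne_zero p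
  simp_all

lemma isomCLM_mul_opUnit (k : ℕ+) (j : ℕ) (p q : ℤ) :
    isomCLM k j * opUnit p q * star (isomCLM k j) = opUnit (k * p + j) (k * q + j) := by
  rw [opUnit, opUnit, ContinuousLinearMap.mul_def, ContinuousLinearMap.mul_def,
    InnerProductSpace.comp_rankOne, InnerProductSpace.rankOne_comp,
    ContinuousLinearMap.star_eq_adjoint, ContinuousLinearMap.adjoint_adjoint]
  simp [isomCLM, isom_basisVec]

lemma ellTwoZ_ext_inner {v w : EllTwoZ}
    (h : ∀ n, inner ℂ (basisVec n) v = inner ℂ (basisVec n) w) : v = w := by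
  ext n
  have := h n
  simpa [basisVec, lp.inner_single_left] using this

/-- The ranges of the `u(k,j)`, `0 ≤ j < k`, are spanned by the basis vectors in distinct residue
classes mod `k`. Hence the cross terms vanish and `Fr_k` is multiplicative. -/
lemma star_isomCLM_mul (k : ℕ+) {i j : ℕ} (hi : i < k) (hj : j < k) :
    star (isomCLM k i) * isomCLM k j = if i = j then 1 else 0 := by
  refine ellTwoZ_ext fun n => ellTwoZ_ext_inner fun m => ?_
  rw [mul_apply_eq_comp, ContinuousLinearMap.star_eq_adjoint,
    ContinuousLinearMap.adjoint_inner_right]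
  simp only [isomCLM, LinearIsometry.coe_toContinuousLinearMap, isom_basisVec, inner_basisVec]
  have hiff : ((k : ℤ) * m + i = k * n + j) ↔ (i = j ∧ m = n) := by
    constructor
    · intro h
      have h1 := congrArg (· % (k : ℤ)) h
      simp only [Int.mul_add_emod_self_left] at h1
      rw [Int.emod_eq_of_lt (by positivity) (by exact_mod_cast hi),
        Int.emod_eq_of_lt (by positivity) (by exact_mod_cast hj)] at h1
      have h2 : i = j := by exact_mod_cast h1
      subst h2
      have hk : (k : ℤ) ≠ 0 := by exact_mod_cast k.ne_zero
      exact ⟨rfl, by simpa [hk] using h⟩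
    · rintro ⟨rfl, rfl⟩; rfl
  by_cases hij : i = j <;> simp [hiff, hij, inner_basisVec]

lemma frobK_eq (k : ℕ+) (x : EllTwoZ →L[ℂ] EllTwoZ) :
    frobK k x = ∑ j ∈ Finset.range k, isomCLM k j * x * star (isomCLM k j) :=
  Finset.sum_congr rfl fun _ _ => rfl

lemma frobK_opUnit (k : ℕ+) (p q : ℤ) :
    frobK k (opUnit p q) = ∑ j ∈ Finset.range k, opUnit (k * p + j) (k * q + j) := by
  rw [frobK_eq]
  exact Finset.sum_congr rfl fun j _ => isomCLM_mul_opUnit k j p q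

lemma frobK_map_mul (k : ℕ+) (x y : EllTwoZ →L[ℂ] EllTwoZ) :
    frobK k (x * y) = frobK k x * frobK k y := by
  simp only [frobK_eq, Finset.sum_mul_sum]
  refine Finset.sum_congr rfl fun i hi => ?_
  rw [Finset.sum_eq_single_of_mem i hi]
  · have h := star_isomCLM_mul k (Finset.mem_range.1 hi) (Finset.mem_range.1 hi)
    rw [if_pos rfl] at h
    calc _ = isomCLM k i * x * 1 * y * star (isomCLM k i) := by noncomm_ring
      _ = _ := by rw [← h]; noncomm_ring
  · intro j hj hji
    have h := star_isomCLM_mul k (Finset.mem_range.1 hi) (Finset.mem_range.1 hj)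
    rw [if_neg (Ne.symm hji)] at h
    calc _ = isomCLM k i * x * (star (isomCLM k i) * isomCLM k j) * y * star (isomCLM k j) := by
          noncomm_ring
      _ = 0 := by rw [h]; simp

lemma frobK_map_star (k : ℕ+) (x : EllTwoZ →L[ℂ] EllTwoZ) :
    frobK k (star x) = star (frobK k x) := by
  simp [frobK_eq, star_sum, star_mul, mul_assoc]

lemma frobK_injective (k : ℕ+) : Function.Injective (frobK k) := by
  -- Compression by the single isometry `u(k,0)` is a left inverse of `Fr_k`.
  have key : ∀ x, star (isomCLM k 0) * frobK k x * isomCLM k 0 = x := by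
    intro x
    rw [frobK_eq, Finset.mul_sum, Finset.sum_mul, Finset.sum_eq_single_of_mem 0 (by simp)]
    · have h := star_isomCLM_mul k k.pos k.pos
      rw [if_pos rfl] at h
      calc _ = (star (isomCLM k 0) * isomCLM k 0) * x * (star (isomCLM k 0) * isomCLM k 0) := by
            noncomm_ring
        _ = x := by rw [h]; simp
    · intro j hj hj0
      have h := star_isomCLM_mul k k.pos (Finset.mem_range.1 hj)
      rw [if_neg (Ne.symm hj0)] at h
      calc _ = (star (isomCLM k 0) * isomCLM k j) * x * (star (isomCLM k j) * isomCLM k 0) := by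
            noncomm_ring
        _ = 0 := by rw [h]; simp
  intro x y h
  rw [← key x, h, key y]

/-- The endomorphism `Fr_k` of the C*-algebra of compact operators. -/
noncomputable def frob (k : ℕ+) : KAlg →⋆ₙₐ[ℂ] KAlg where
  toFun x := ⟨frobK k x, frobK_mem k x⟩
  map_smul' c x := Subtype.ext (by
    simp [frobK_eq, Finset.smul_sum])
  map_zero' := Subtype.ext (by simp [frobK_eq])
  map_add' x y := Subtype.ext (by
    simp [frobK_eq, mul_add, add_mul, Finset.sum_add_distrib])
  map_mul' x y := Subtype.ext (frobK_map_mul k x y)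
  map_star' x := Subtype.ext (frobK_map_star k x)

lemma coe_frob (k : ℕ+) (x : KAlg) : (frob k x : EllTwoZ →L[ℂ] EllTwoZ) = frobK k x := rfl

lemma frob_injective (k : ℕ+) : Function.Injective (frob k) := fun _ _ h =>
  Subtype.ext (frobK_injective k (congrArg Subtype.val h))

lemma frob_one (x : KAlg) : frob 1 x = x := Subtype.ext (frobK_one x)

lemma frob_matUnit (k : ℕ+) (p q : ℤ) :
    frob k (matUnit p q) = ∑ j ∈ Finset.range k, matUnit (k * p + j) (k * q + j) := by
  apply Subtype.ext
  rw [coe_frob, AddSubmonoidClass.coe_finsetSum]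
  exact frobK_opUnit k p q

end CompactAlgebra

/-! ### Finite corners of the compact operators, and `Fr_k` as amplification -/

section MatrixCorners

open Filter Topology

/-- The matrix `T`, indexed by a finite set of integers, extended by zero. -/
def extendZero {F : Finset ℤ} (T : Matrix F F ℂ) (p q : ℤ) : ℂ :=
  if h : p ∈ F ∧ q ∈ F then T ⟨p, h.1⟩ ⟨q, h.2⟩ else 0

lemma extendZero_coe {F : Finset ℤ} (T : Matrix F F ℂ) (p q : F) : extendZero T p q = T p q := by
  simp [extendZero]

/-- The linear map which sends a matrix indexed by a finite set of integers to the corresponding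
compact operator. -/
noncomputable def cornerLin (F : Finset ℤ) : Matrix F F ℂ →ₗ[ℂ] KAlg where
  toFun T := ∑ p : F, ∑ q : F, T p q • matUnit p q
  map_add' S T := by simp [add_smul, Finset.sum_add_distrib]
  map_smul' c T := by simp [mul_smul, Finset.smul_sum]

lemma cornerLin_apply (F : Finset ℤ) (T : Matrix F F ℂ) :
    cornerLin F T = ∑ p : F, ∑ q : F, T p q • matUnit p q := rfl

lemma cornerLin_mul (F : Finset ℤ) (S T : Matrix F F ℂ) :
    cornerLin F (S * T) = cornerLin F S * cornerLin F T := by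
  simp only [cornerLin_apply, Finset.sum_mul]
  refine Finset.sum_congr rfl fun p _ => ?_
  simp only [Finset.mul_sum, Matrix.mul_apply, Finset.sum_smul]
  rw [Finset.sum_comm]
  refine Finset.sum_congr rfl fun r _ => Eq.symm ?_
  rw [Finset.sum_eq_single r]
  · simp [smul_mul_smul_comm, matUnit_mul]
  · intro s _ hs
    have : (r : ℤ) ≠ s := fun h => hs (Subtype.ext h.symm)
    simp [smul_mul_smul_comm, matUnit_mul, this]
  · simp

lemma cornerLin_star (F : Finset ℤ) (T : Matrix F F ℂ) :
    cornerLin F (star T) = star (cornerLin F T) := by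
  simp only [cornerLin_apply, star_sum, star_smul, star_matUnit,
    Matrix.star_apply]
  exact Finset.sum_comm

/-- Matrices indexed by a finite set of integers, as compact operators on `ℓ²(ℤ)`. -/
noncomputable def corner (F : Finset ℤ) : Matrix F F ℂ →⋆ₙₐ[ℂ] KAlg where
  toFun := cornerLin F
  map_smul' c T := map_smul _ c T
  map_zero' := map_zero _
  map_add' := map_add _
  map_mul' := cornerLin_mul F
  map_star' := cornerLin_star F

lemma corner_apply (F : Finset ℤ) (T : Matrix F F ℂ) :
    corner F T = ∑ p : F, ∑ q : F, T p q • matUnit p q := rfl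

lemma corner_eq_sum (F : Finset ℤ) (T : Matrix F F ℂ) :
    corner F T = ∑ p ∈ F, ∑ q ∈ F, extendZero T p q • matUnit p q := by
  rw [corner_apply, ← Finset.sum_coe_sort F]
  refine Finset.sum_congr rfl fun p _ => ?_
  rw [← Finset.sum_coe_sort F]
  exact Finset.sum_congr rfl fun q _ => by rw [extendZero_coe]

lemma corner_injective (F : Finset ℤ) : Function.Injective (corner F) := by
  rw [injective_iff_map_eq_zero]
  intro T hT
  ext p q
  -- The matrix coefficients are recovered by cutting down with diagonal matrix units.
  have h : matUnit p p * corner F T * matUnit q q = T p q • matUnit p q := by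
    rw [corner_apply, Finset.mul_sum, Finset.sum_mul, Finset.sum_eq_single p]
    · rw [Finset.mul_sum, Finset.sum_mul, Finset.sum_eq_single q]
      · simp [mul_smul_comm, smul_mul_assoc, matUnit_mul]
      · intro s _ hs
        have : (s : ℤ) ≠ q := fun h => hs (Subtype.ext h)
        simp [mul_smul_comm, smul_mul_assoc, matUnit_mul, this]
      · simp
    · intro s _ hs
      have : (p : ℤ) ≠ s := fun h => hs (Subtype.ext h.symm)
      simp [Finset.mul_sum, mul_smul_comm, matUnit_mul, this]
    · simp
  rw [hT] at h
  simpa [matUnit_ne_zero] using h.symm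

/-- The amplification of a matrix by `k`, on a finite set of integers. -/
def dilate (k : ℕ+) {F : Finset ℤ} (J : Finset ℤ) (T : Matrix F F ℂ) : Matrix J J ℂ :=
  fun p q => if (p : ℤ) % k = q % k then extendZero T (p / k) (q / k) else 0

/-- An index `p` stands for the pair `(p / k, p % k)`, and `Fr_k` acts as `T ⊗ 1_k` on such pairs.
`J` only has to contain the pairs over `F`; it may be larger, and the matrix is zero on the
remaining indices. This freedom is what later allows non-unital inclusions of matrix algebras. -/
lemma frob_corner (k : ℕ+) {F J : Finset ℤ} (hJ : ∀ p : ℤ, p / k ∈ F → p ∈ J)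
    (T : Matrix F F ℂ) : frob k (corner F T) = corner J (dilate k J T) := by
  have hk : (0 : ℤ) < k := by exact_mod_cast k.pos
  have hdiv : ∀ (p : ℤ) (j : ℕ), j < k → (k * p + j : ℤ) / k = p ∧ (k * p + j : ℤ) % k = j := by
    intro p j hj
    have hj' : (j : ℤ) < k := by exact_mod_cast hj
    constructor
    · rw [Int.mul_add_ediv_left _ _ hk.ne', Int.ediv_eq_zero_of_lt (by positivity) hj', add_zero]
    · rw [Int.mul_add_emod_self_left, Int.emod_eq_of_lt (by positivity) hj']
  have e1 : frob k (corner F T) = ∑ x ∈ (F ×ˢ F) ×ˢ Finset.range k,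
      extendZero T x.1.1 x.1.2 • matUnit (k * x.1.1 + x.2) (k * x.1.2 + x.2) := by
    rw [corner_eq_sum, Finset.sum_product, Finset.sum_product]
    simp only [map_sum, map_smul, frob_matUnit, Finset.smul_sum]
  have e2 : corner J (dilate k J T) = ∑ x ∈ (J ×ˢ J).filter
      (fun x : ℤ × ℤ => x.1 % (k : ℤ) = x.2 % k ∧ x.1 / (k : ℤ) ∈ F ∧ x.2 / (k : ℤ) ∈ F),
      extendZero T (x.1 / k) (x.2 / k) • matUnit x.1 x.2 := by
    rw [corner_eq_sum, ← Finset.sum_product', Finset.sum_filter]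
    refine Finset.sum_congr rfl fun x hx => ?_
    rw [Finset.mem_product] at hx
    rw [extendZero, dif_pos hx, dilate]
    by_cases h1 : x.1 % (k : ℤ) = x.2 % k
    · by_cases h2 : x.1 / (k : ℤ) ∈ F ∧ x.2 / (k : ℤ) ∈ F
      · simp [h1, h2]
      · simp [h1, h2, extendZero]
    · simp [h1]
  rw [e1, e2]
  refine Finset.sum_bij' (fun x _ => (k * x.1.1 + x.2, k * x.1.2 + x.2))
    (fun x _ => ((x.1 / (k : ℤ), x.2 / (k : ℤ)), (x.1 % (k : ℤ)).toNat)) ?_ ?_ ?_ ?_ ?_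
  · rintro ⟨⟨p, q⟩, j⟩ hx
    simp only [Finset.mem_product, Finset.mem_range] at hx
    simp only [Finset.mem_filter, Finset.mem_product]
    obtain ⟨a1, a2⟩ := hdiv p j hx.2
    obtain ⟨b1, b2⟩ := hdiv q j hx.2
    rw [a1, a2, b1, b2]
    exact ⟨⟨hJ _ (by rw [a1]; exact hx.1.1), hJ _ (by rw [b1]; exact hx.1.2)⟩, rfl, hx.1⟩
  · rintro ⟨p, q⟩ hx
    simp only [Finset.mem_filter, Finset.mem_product] at hx
    simp only [Finset.mem_product, Finset.mem_range]
    refine ⟨hx.2.2, ?_⟩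
    have := Int.emod_lt_of_pos p hk
    have := Int.emod_nonneg p hk.ne'
    omega
  · rintro ⟨⟨p, q⟩, j⟩ hx
    simp only [Finset.mem_product, Finset.mem_range] at hx
    obtain ⟨a1, a2⟩ := hdiv p j hx.2
    obtain ⟨b1, b2⟩ := hdiv q j hx.2
    simp [a1, a2, b1]
  · rintro ⟨p, q⟩ hx
    simp only [Finset.mem_filter, Finset.mem_product] at hx
    have h0 := Int.emod_nonneg p hk.ne'
    simp only [Int.toNat_of_nonneg h0, Int.mul_ediv_add_emod, Prod.mk.injEq, true_and]
    rw [hx.2.1, Int.mul_ediv_add_emod]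
  · rintro ⟨⟨p, q⟩, j⟩ hx
    simp only [Finset.mem_product, Finset.mem_range] at hx
    obtain ⟨a1, a2⟩ := hdiv p j hx.2
    obtain ⟨b1, b2⟩ := hdiv q j hx.2
    simp [a1, b1]

lemma opProj_mul_mul_opProj_mem (F : Finset ℤ) (x : KAlg) :
    ∃ T, (corner F T : EllTwoZ →L[ℂ] EllTwoZ) = opProj F * x * opProj F := by
  refine ⟨Matrix.of fun p q => inner ℂ (basisVec p) (x.1 (basisVec q)), ?_⟩
  have h : ∀ p q, opUnit p p * x.1 * opUnit q q =
      inner ℂ (basisVec p) (x.1 (basisVec q)) • opUnit p q := by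
    intro p q
    ext1 v
    simp only [mul_apply_eq_comp, opUnit_apply, map_smul, smul_apply, smul_smul,
      mul_comm]
  rw [corner_apply, opProj, Finset.sum_mul, Finset.sum_mul, AddSubmonoidClass.coe_finsetSum,
    ← Finset.sum_coe_sort F]
  refine Finset.sum_congr rfl fun p _ => ?_
  rw [AddSubmonoidClass.coe_finsetSum, Finset.mul_sum, ← Finset.sum_coe_sort F]
  exact Finset.sum_congr rfl fun q _ => (h p q).symm

lemma tendsto_opProj_mul_mul_opProj (x : KAlg) :
    Tendsto (fun F => opProj F * x * opProj F) atTop (𝓝 (x : EllTwoZ →L[ℂ] EllTwoZ)) := by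
  have h1 := tendsto_opProj_mul x.2
  have h2 := tendsto_mul_opProj (star x).2
  rw [show star ((star x : KAlg) : EllTwoZ →L[ℂ] EllTwoZ) = x from star_star _] at h2
  rw [tendsto_iff_norm_sub_tendsto_zero] at h1 h2 ⊢
  refine squeeze_zero (fun _ => norm_nonneg _) (fun F => ?_) (by simpa using h2.add h1)
  have e : opProj F * x * opProj F - x.1 = opProj F * (x.1 * opProj F - x.1) +
      (opProj F * x.1 - x.1) := by noncomm_ring
  rw [e]
  refine (norm_add_le _ _).trans (add_le_add_left ((norm_mul_le _ _).trans ?_) _)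
  exact mul_le_of_le_one_left (norm_nonneg _) (norm_opProj_le F)

/-- Compact operators are limits of matrices indexed by arbitrarily large finite sets. -/
lemma exists_corner_near (x : KAlg) {ε : ℝ} (hε : 0 < ε) (F₀ : Finset ℤ) :
    ∃ F, F₀ ⊆ F ∧ ∃ T, ‖corner F T - x‖ < ε := by
  have h := (Metric.tendsto_atTop.1 (tendsto_opProj_mul_mul_opProj x)) ε hε
  obtain ⟨F₁, hF₁⟩ := h
  obtain ⟨T, hT⟩ := opProj_mul_mul_opProj_mem (F₀ ∪ F₁) x
  refine ⟨F₀ ∪ F₁, Finset.subset_union_left, T, ?_⟩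
  have := hF₁ (F₀ ∪ F₁) Finset.subset_union_right
  rw [dist_eq_norm, ← hT] at this
  exact this

end MatrixCorners

/-! ### Flat actions, and the inductive limits of compact operators along them -/

section FrobSystems

open Filter Topology

/-- A set with an action of `ℕ^×` which is flat (filtering). -/
structure IsFlatAction (X : Type*) [MulAction ℕ+ X] : Prop where
  nonempty : Nonempty X
  exists_common : ∀ x y : X, ∃ (z : X) (k l : ℕ+), k • z = x ∧ l • z = y
  free : ∀ (x : X) (k l : ℕ+), k • x = l • x → k = l

lemma IsFlatAction.smul_injective {X : Type*} [MulAction ℕ+ X] (hX : IsFlatAction X) (k : ℕ+)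
    {x y : X} (h : k • x = k • y) : x = y := by
  obtain ⟨z, a, b, rfl, rfl⟩ := hX.exists_common x y
  rw [smul_smul, smul_smul] at h
  rw [mul_left_cancel (hX.free z _ _ h)]

lemma IsFlatAction.countable {X : Type*} [MulAction ℕ+ X] (hX : IsFlatAction X) : Countable X := by
  obtain ⟨x₀⟩ := hX.nonempty
  rw [← Set.countable_univ_iff]
  -- Relative to a base point, an element `x` is determined by a pair `(k, l)` with `k • z = x₀` and
  -- `l • z = x`, by injectivity of the action.
  have h : (Set.univ : Set X) = ⋃ k : ℕ+, ⋃ l : ℕ+, {x | ∃ z : X, k • z = x₀ ∧ l • z = x} := by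
    refine (Set.eq_univ_of_forall fun x => ?_).symm
    obtain ⟨z, k, l, h1, h2⟩ := hX.exists_common x₀ x
    exact Set.mem_iUnion.2 ⟨k, Set.mem_iUnion.2 ⟨l, z, h1, h2⟩⟩
  rw [h]
  refine Set.countable_iUnion fun k => Set.countable_iUnion fun l => Set.Subsingleton.countable ?_
  rintro x ⟨z, hz, rfl⟩ y ⟨z', hz', rfl⟩
  rw [hX.smul_injective k (hz.trans hz'.symm)]

/-- A system of embeddings of the compact operators in a C*-algebra `B`, compatible with the
endomorphisms `Fr_k`, and which exhibits `B` as an inductive limit. -/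
structure FrobSystem (X : Type*) [MulAction ℕ+ X] (B : Type*) [NonUnitalCStarAlgebra B] where
  hom : X → KAlg →⋆ₙₐ[ℂ] B
  injective : ∀ x, Function.Injective (hom x)
  hom_smul : ∀ (k : ℕ+) (x : X) (T : KAlg), hom (k • x) T = hom x (frob k T)
  dense : Dense {b | ∃ x T, hom x T = b}

variable {X : Type*} [MulAction ℕ+ X] {B : Type*} [NonUnitalCStarAlgebra B]

lemma exists_subset_Ico (F : Finset ℤ) : ∃ n : ℕ, 0 < n ∧ F ⊆ Finset.Ico (-n : ℤ) n := by
  refine ⟨(∑ p ∈ F, p.natAbs) + 1, by omega, fun p hp => ?_⟩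
  have h := Finset.single_le_sum (f := fun p : ℤ => p.natAbs) (fun _ _ => Nat.zero_le _) hp
  rw [Finset.mem_Ico]
  omega

/-- The half-open interval `[-n, n)` pulls back exactly to `[-kn, kn)` under floor division by `k`,
so these intervals are stable under amplification up to scaling. -/
lemma mem_Ico_of_ediv_mem (k : ℕ+) {n N : ℕ} (hN : k * n ≤ N) (p : ℤ)
    (hp : p / (k : ℤ) ∈ Finset.Ico (-n : ℤ) n) : p ∈ Finset.Ico (-N : ℤ) N := by
  have hk : (0 : ℤ) < k := by exact_mod_cast k.pos
  rw [Finset.mem_Ico] at hp ⊢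
  have h1 := (Int.le_ediv_iff_mul_le hk).1 hp.1
  have h2 := (Int.ediv_lt_iff_lt_mul hk).1 hp.2
  have h3 : (k : ℤ) * n ≤ N := by exact_mod_cast hN
  constructor <;> nlinarith

/-- This is `frob_corner` for `k = 1`, where `dilate` is extension by zero. -/
lemma corner_mem_of_subset {F J : Finset ℤ} (h : F ⊆ J) (T : Matrix F F ℂ) :
    ∃ S, corner J S = corner F T :=
  ⟨_, by rw [← frob_corner 1 (J := J) (fun p hp => h (by simpa using hp)) T, frob_one]⟩

namespace FrobSystem

lemma norm_hom (Φ : FrobSystem X B) (x : X) (T : KAlg) : ‖Φ.hom x T‖ = ‖T‖ :=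
  NonUnitalStarAlgHom.norm_map (Φ.hom x) (Φ.injective x) T

/-- The embedding of a full matrix algebra which is given by a system. -/
noncomputable def block (Φ : FrobSystem X B) (x : X) (F : Finset ℤ) : Matrix F F ℂ →⋆ₙₐ[ℂ] B :=
  (Φ.hom x).comp (corner F)

lemma block_apply (Φ : FrobSystem X B) (x : X) (F : Finset ℤ) (T : Matrix F F ℂ) :
    Φ.block x F T = Φ.hom x (corner F T) := rfl

lemma block_injective (Φ : FrobSystem X B) (x : X) (F : Finset ℤ) :
    Function.Injective (Φ.block x F) :=
  (Φ.injective x).comp (corner_injective F)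

lemma block_smul (Φ : FrobSystem X B) (k : ℕ+) (x : X) {F J : Finset ℤ}
    (hJ : ∀ p : ℤ, p / k ∈ F → p ∈ J)
    (T : Matrix F F ℂ) : Φ.block (k • x) F T = Φ.block x J (dilate k J T) := by
  rw [block_apply, Φ.hom_smul, frob_corner k hJ, block_apply]

lemma exists_block_near (Φ : FrobSystem X B) (b : B) {ε : ℝ} (hε : 0 < ε) :
    ∃ x, ∃ n : ℕ, 0 < n ∧ ∃ T, ‖Φ.block x (Finset.Ico (-n : ℤ) n) T - b‖ < ε := by
  obtain ⟨_, ⟨x, T, rfl⟩, h⟩ := Metric.mem_closure_iff.1 (Φ.dense b) (ε / 2) (by positivity)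
  obtain ⟨F, -, S, hS⟩ := exists_corner_near T (ε := ε / 2) (by positivity) ∅
  obtain ⟨n, hn, hF⟩ := exists_subset_Ico F
  obtain ⟨S', hS'⟩ := corner_mem_of_subset hF S
  refine ⟨x, n, hn, S', ?_⟩
  rw [block_apply, hS']
  rw [dist_eq_norm] at h
  have e : Φ.hom x (corner F S) - b = Φ.hom x (corner F S - T) - (b - Φ.hom x T) := by
    rw [map_sub]; abel
  rw [e]
  refine (norm_sub_le _ _).trans_lt ?_
  rw [Φ.norm_hom]
  linarith

/-- Two corners over `k • z` and `l • z` both lie in a larger corner over `z`, which gives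
directedness. -/
lemma isMatroid (Φ : FrobSystem X B) (hX : IsFlatAction X) : IsMatroid B := by
  refine ⟨{M | ∃ (x : X) (n : ℕ), 0 < n ∧
    M = NonUnitalStarAlgHom.range (Φ.block x (Finset.Ico (-n : ℤ) n))}, ?_, ?_, ?_⟩
  · rintro _ ⟨x, m, hm, rfl⟩ _ ⟨y, n, hn, rfl⟩
    obtain ⟨z, k, l, rfl, rfl⟩ := hX.exists_common x y
    refine ⟨_, ⟨z, k * m + l * n, by positivity, rfl⟩, ?_, ?_⟩
    · rintro _ ⟨T, rfl⟩
      exact ⟨_, (Φ.block_smul k z (mem_Ico_of_ediv_mem k (by omega)) T).symm⟩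
    · rintro _ ⟨T, rfl⟩
      exact ⟨_, (Φ.block_smul l z (mem_Ico_of_ediv_mem l (by omega)) T).symm⟩
  · rintro _ ⟨x, n, hn, rfl⟩
    refine ⟨(Finset.Ico (-n : ℤ) n).card, ?_, ⟨?_⟩⟩
    · rw [Finset.card_pos]
      exact ⟨0, by simp [hn]⟩
    · refine (StarAlgEquiv.ofInjective' (R := ℂ) _ (Φ.block_injective x _)).symm.trans ?_
      exact StarAlgEquiv.ofAlgEquiv (Matrix.reindexAlgEquiv ℂ ℂ (Finset.equivFin _)) (fun _ => rfl)
  · intro b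
    rw [Metric.mem_closure_iff]
    intro ε hε
    obtain ⟨x, n, hn, T, hT⟩ := Φ.exists_block_near b hε
    refine ⟨_, ⟨_, ⟨x, n, hn, rfl⟩, T, rfl⟩, ?_⟩
    rw [dist_comm, dist_eq_norm]
    exact hT

lemma separableSpace (Φ : FrobSystem X B) (hX : IsFlatAction X) :
    TopologicalSpace.SeparableSpace B := by
  have := hX.countable
  rw [← TopologicalSpace.isSeparable_univ_iff]
  have hsep (n : ℕ) : TopologicalSpace.SeparableSpace
      (Matrix (Finset.Ico (-n : ℤ) n) (Finset.Ico (-n : ℤ) n) ℂ) :=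
    inferInstanceAs (TopologicalSpace.SeparableSpace
      (Finset.Ico (-n : ℤ) n → Finset.Ico (-n : ℤ) n → ℂ))
  have h : TopologicalSpace.IsSeparable
      (⋃ x : X, ⋃ n : ℕ, Set.range (Φ.block x (Finset.Ico (-n : ℤ) n))) := by
    refine TopologicalSpace.IsSeparable.iUnion fun x =>
      TopologicalSpace.IsSeparable.iUnion fun n => TopologicalSpace.isSeparable_range ?_
    exact LinearMap.continuous_of_finiteDimensional
      (Φ.block x (Finset.Ico (-n : ℤ) n) :
        Matrix (Finset.Ico (-n : ℤ) n) (Finset.Ico (-n : ℤ) n) ℂ →ₗ[ℂ] B)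
  refine h.closure.mono fun b _ => ?_
  rw [Metric.mem_closure_iff]
  intro ε hε
  obtain ⟨x, n, hn, T, hT⟩ := Φ.exists_block_near b hε
  refine ⟨_, Set.mem_iUnion.2 ⟨x, Set.mem_iUnion.2 ⟨n, T, rfl⟩⟩, ?_⟩
  rw [dist_comm, dist_eq_norm]
  exact hT

/-- In each copy of `𝒦` a trace is constant on the diagonal matrix units, while the sum of `n` of
them is a projection of norm at most one. A bounded trace must thus vanish on them, and then on a
dense set. -/
lemma hasNoBoundedTrace (Φ : FrobSystem X B) : HasNoBoundedTrace B := by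
  intro τ _ hτ
  have hdiag : ∀ x p q, τ (Φ.hom x (matUnit p p)) = τ (Φ.hom x (matUnit q q)) := by
    intro x p q
    have h := hτ (Φ.hom x (matUnit p q)) (Φ.hom x (matUnit q p))
    simpa [← map_mul, matUnit_mul] using h
  have hoff : ∀ x p q, p ≠ q → τ (Φ.hom x (matUnit p q)) = 0 := by
    intro x p q hpq
    have h := hτ (Φ.hom x (matUnit p p)) (Φ.hom x (matUnit p q))
    simpa [← map_mul, matUnit_mul, hpq.symm] using h
  have hzero : ∀ x, τ (Φ.hom x (matUnit 0 0)) = 0 := by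
    intro x
    by_contra hne
    have hpos : 0 < ‖τ (Φ.hom x (matUnit 0 0))‖ := norm_pos_iff.2 hne
    obtain ⟨n, hn⟩ := exists_nat_gt (‖τ‖ / ‖τ (Φ.hom x (matUnit 0 0))‖)
    rw [div_lt_iff₀ hpos] at hn
    have hsum : τ (Φ.hom x (∑ p ∈ Finset.Ico (0 : ℤ) n, matUnit p p)) =
        n * τ (Φ.hom x (matUnit 0 0)) := by
      rw [map_sum, map_sum, Finset.sum_congr rfl fun p _ => hdiag x p 0]
      simp
    have hnorm : ‖∑ p ∈ Finset.Ico (0 : ℤ) n, matUnit p p‖ ≤ 1 := by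
      have : ((∑ p ∈ Finset.Ico (0 : ℤ) n, matUnit p p : KAlg) : EllTwoZ →L[ℂ] EllTwoZ) =
          opProj (Finset.Ico (0 : ℤ) n) := by
        rw [AddSubmonoidClass.coe_finsetSum]; rfl
      change ‖((∑ p ∈ Finset.Ico (0 : ℤ) n, matUnit p p : KAlg) : EllTwoZ →L[ℂ] EllTwoZ)‖ ≤ 1
      rw [this]
      exact norm_opProj_le _
    have h := τ.le_opNorm (Φ.hom x (∑ p ∈ Finset.Ico (0 : ℤ) n, matUnit p p))
    rw [hsum, norm_mul, Φ.norm_hom, Complex.norm_natCast] at h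
    have := mul_le_mul_of_nonneg_left hnorm (norm_nonneg τ)
    linarith
  have hblock : ∀ x F T, τ (Φ.block x F T) = 0 := by
    intro x F T
    rw [block_apply, corner_apply]
    simp only [map_sum, map_smul]
    refine Finset.sum_eq_zero fun p _ => Finset.sum_eq_zero fun q _ => ?_
    by_cases hpq : p = q
    · subst hpq
      rw [hdiag x p 0, hzero, smul_zero]
    · rw [hoff x p q fun h => hpq (Subtype.ext h), smul_zero]
  ext b
  rw [zero_apply]
  by_contra hne
  have hpos : 0 < ‖τ b‖ := norm_pos_iff.2 hne
  obtain ⟨x, n, hn, T, hT⟩ := Φ.exists_block_near b (ε := ‖τ b‖ / (‖τ‖ + 1)) (by positivity)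
  have h := τ.le_opNorm (Φ.block x _ T - b)
  rw [map_sub, hblock, zero_sub, norm_neg] at h
  rw [lt_div_iff₀ (by positivity)] at hT
  nlinarith [norm_nonneg (Φ.block x _ T - b)]

/-- The inductive limit of the compact operators along a flat action is an infinite separable
matroid C*-algebra. -/
theorem isInfiniteSeparableMatroid (Φ : FrobSystem X B) (hX : IsFlatAction X) :
    IsInfiniteSeparableMatroid B :=
  ⟨Φ.isMatroid hX, Φ.separableSpace hX, Φ.hasNoBoundedTrace⟩

end FrobSystem

end FrobSystems

/-! ### Equivalence of nearby idempotents in a C*-algebra -/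

section IdempotentEquivalence

/-- Algebraic equivalence of idempotents. -/
def IdemEquiv {R : Type*} [Mul R] (e f : R) : Prop :=
  ∃ a b : R, a * b = e ∧ b * a = f ∧ e * a = a ∧ a * f = a ∧ f * b = b ∧ b * e = b

lemma IdemEquiv.symm {R : Type*} [Mul R] {e f : R} (h : IdemEquiv e f) : IdemEquiv f e := by
  obtain ⟨a, b, h1, h2, h3, h4, h5, h6⟩ := h
  exact ⟨b, a, h2, h1, h5, h6, h3, h4⟩

lemma IdemEquiv.trans {R : Type*} [Semigroup R] {e f g : R} (h : IdemEquiv e f)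
    (h' : IdemEquiv f g) : IdemEquiv e g := by
  obtain ⟨a, b, h1, h2, h3, h4, h5, h6⟩ := h
  obtain ⟨c, d, k1, k2, k3, k4, k5, k6⟩ := h'
  refine ⟨a * c, d * b, ?_, ?_, ?_, ?_, ?_, ?_⟩
  · rw [mul_assoc, ← mul_assoc c, k1, h5, h1]
  · rw [mul_assoc, ← mul_assoc b, h2, k3, k2]
  · rw [← mul_assoc, h3]
  · rw [mul_assoc, k4]
  · rw [← mul_assoc, k5]
  · rw [mul_assoc, h6]

lemma IdemEquiv.map {R S F : Type*} [Mul R] [Mul S] [FunLike F R S] [MulHomClass F R S] (φ : F)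
    {e f : R} (h : IdemEquiv e f) : IdemEquiv (φ e) (φ f) := by
  obtain ⟨a, b, h1, h2, h3, h4, h5, h6⟩ := h
  refine ⟨φ a, φ b, ?_, ?_, ?_, ?_, ?_, ?_⟩ <;> rw [← map_mul] <;> congr 1

lemma norm_two_mul_sub_one_le {C : Type*} [CStarAlgebra C] {f : C} (hf : f * f = f)
    (hs : star f = f) : ‖2 * f - 1‖ ≤ 1 := by
  have h := CStarRing.norm_star_mul_self (x := 2 * f - 1)
  have e : star (2 * f - 1) * (2 * f - 1) = 1 := by
    have : star (2 * f - 1) = 2 * f - 1 := by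
      rw [star_sub, star_mul, hs, star_one, star_ofNat, (Commute.ofNat_right f 2).eq]
    rw [this]
    calc _ = 4 * (f * f) - 4 * f + 1 := by noncomm_ring
      _ = 1 := by rw [hf]; noncomm_ring
  rw [e] at h
  have h1 : ‖(1 : C)‖ ≤ 1 := by
    have := CStarRing.norm_star_mul_self (x := (1 : C))
    rw [star_one, mul_one] at this
    by_contra hc
    push Not at hc
    nlinarith
  by_contra hc
  push Not at hc
  nlinarith

lemma idemEquiv_of_norm_sub_lt_one_unital {C : Type*} [CStarAlgebra C] {e f : C}
    (he : e * e = e) (hf : f * f = f) (hs : star f = f) (h : ‖e - f‖ < 1) : IdemEquiv e f := by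
  -- This element intertwines `e` and `f`: both `f * z` and `z * e` equal `f * e`. It is invertible
  -- because its distance to `1` is at most `‖2 * f - 1‖ * ‖e - f‖ < 1`.
  set z : C := f * e + (1 - f) * (1 - e) with hz
  have h1 : 1 - z = -((2 * f - 1) * (e - f)) := by
    calc 1 - z = f + e - 2 * (f * e) := by rw [hz]; noncomm_ring
      _ = f + e - 2 * (f * e) + 2 * (f * f) - 2 * f := by rw [hf]; noncomm_ring
      _ = _ := by noncomm_ring
  have h2 : ‖1 - z‖ < 1 := by
    rw [h1, norm_neg]
    refine (norm_mul_le _ _).trans_lt ?_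
    have := norm_two_mul_sub_one_le hf hs
    nlinarith [norm_nonneg (e - f)]
  have hu : IsUnit z := by
    have := isUnit_one_sub_of_norm_lt_one h2
    rwa [sub_sub_cancel] at this
  obtain ⟨u, hu⟩ := hu
  have hfz : f * u = f * e := by
    calc f * u = f * f * e + (f - f * f) * (1 - e) := by rw [hu, hz]; noncomm_ring
      _ = f * e := by rw [hf]; simp
  have hze : u * e = f * e := by
    calc u * e = f * (e * e) + (1 - f) * (e - e * e) := by rw [hu, hz]; noncomm_ring
      _ = f * e := by rw [he]; simp
  have hi : (↑u⁻¹ : C) * f = e * ↑u⁻¹ := by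
    calc (↑u⁻¹ : C) * f = ↑u⁻¹ * (f * u) * ↑u⁻¹ := by simp [mul_assoc]
      _ = ↑u⁻¹ * (u * e) * ↑u⁻¹ := by rw [hfz, hze]
      _ = _ := by simp
  refine ⟨e * ↑u⁻¹ * f, f * u * e, ?_, ?_, ?_, ?_, ?_, ?_⟩
  · calc e * ↑u⁻¹ * f * (f * u * e) = e * ↑u⁻¹ * (f * f * u * e) := by simp only [mul_assoc]
      _ = e * ↑u⁻¹ * (f * e * e) := by rw [hf, hfz]
      _ = e * ↑u⁻¹ * (u * e * e) := by rw [hze]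
      _ = e := by simp [mul_assoc, he]
  · calc f * u * e * (e * ↑u⁻¹ * f) = f * u * ((e * e) * ↑u⁻¹) * f := by simp only [mul_assoc]
      _ = f * u * (↑u⁻¹ * f) * f := by rw [he, hi]
      _ = f := by simp [mul_assoc, hf]
  · rw [← mul_assoc, ← mul_assoc, he]
  · rw [mul_assoc, hf]
  · rw [← mul_assoc, ← mul_assoc, hf]
  · rw [mul_assoc, he]

lemma idemEquiv_of_norm_sub_lt_one {A : Type*} [NonUnitalCStarAlgebra A] {e f : A}
    (he : e * e = e) (hf : f * f = f) (hs : star f = f) (h : ‖e - f‖ < 1) : IdemEquiv e f := by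
  have h' : IdemEquiv (e : Unitization ℂ A) (f : Unitization ℂ A) := by
    refine idemEquiv_of_norm_sub_lt_one_unital ?_ ?_ ?_ ?_
    · rw [← Unitization.inr_mul, he]
    · rw [← Unitization.inr_mul, hf]
    · rw [← Unitization.inr_star, hs]
    · rw [← Unitization.inr_sub, Unitization.norm_inr]
      exact h
  obtain ⟨a, b, h1, h2, h3, h4, h5, h6⟩ := h'
  -- The algebra is an ideal in its unitization, so `a = e * a` and `b = f * b` have no scalar part.
  have ha : a = (a.snd : Unitization ℂ A) :=
    Unitization.ext (by rw [← h3]; simp) (by simp)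
  have hb : b = (b.snd : Unitization ℂ A) :=
    Unitization.ext (by rw [← h5]; simp) (by simp)
  rw [ha, hb] at h1 h2
  rw [ha] at h3 h4
  rw [hb] at h5 h6
  simp only [← Unitization.inr_mul] at h1 h2 h3 h4 h5 h6
  have hinj := Unitization.inr_injective (R := ℂ) (A := A)
  exact ⟨a.snd, b.snd, hinj h1, hinj h2, hinj h3, hinj h4, hinj h5, hinj h6⟩

lemma norm_le_one_of_projection {A : Type*} [NonUnitalCStarAlgebra A] {e : A}
    (he : e * e = e) (hs : star e = e) : ‖e‖ ≤ 1 :=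
  IsStarProjection.norm_le e ⟨he, hs⟩

lemma one_le_norm_of_projection {A : Type*} [NonUnitalCStarAlgebra A] {e : A}
    (he : e * e = e) (h0 : e ≠ 0) : 1 ≤ ‖e‖ := by
  have h := norm_mul_le e e
  rw [he] at h
  have := norm_pos_iff.2 h0
  by_contra hc
  push Not at hc
  nlinarith

/-- An almost idempotent self-adjoint element is close to a projection. -/
lemma exists_projection_near {A : Type*} [NonUnitalCStarAlgebra A] {a : A} (ha : star a = a)
    (h : ‖a * a - a‖ ≤ 1 / 8) :
    ∃ f : A, f * f = f ∧ star f = f ∧ ‖f - a‖ ≤ 1 / 4 := by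
  have hsa : IsSelfAdjoint a := ha
  -- The bound `|t * t - t| ≤ 1 / 8` keeps the spectrum within `1 / 4` of `0` or `1`. The ramp `χ`
  -- runs from `0` at `3 / 8` to `1` at `5 / 8`, inside the gap. It vanishes at `0`, as the
  -- non-unital functional calculus requires.
  set χ : ℝ → ℝ := fun t => max 0 (min 1 (4 * t - 3 / 2)) with hχ
  have hχc : Continuous χ := by fun_prop
  have hχ0 : χ 0 = 0 := by simp [hχ]; norm_num
  have hd : cfcₙ (fun t : ℝ => t * t - t) a = a * a - a := by
    rw [cfcₙ_sub .., cfcₙ_mul .., cfcₙ_id' ℝ a]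
  have hspec : ∀ t ∈ quasispectrum ℝ a, |t * t - t| ≤ 1 / 8 := by
    intro t ht
    have := norm_apply_le_norm_cfcₙ (fun t : ℝ => t * t - t) a ht
    rw [hd] at this
    exact this.trans h
  have hval : ∀ t ∈ quasispectrum ℝ a, (χ t = 0 ∧ |t| ≤ 1 / 4) ∨ (χ t = 1 ∧ |1 - t| ≤ 1 / 4) := by
    intro t ht
    have h1 := abs_le.1 (hspec t ht)
    rcases le_or_gt t (1 / 2) with h2 | h2
    · left
      have h3 : t ≤ 1 / 4 := by nlinarith
      have h4 : -(1 / 4) ≤ t := by nlinarith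
      refine ⟨?_, abs_le.2 ⟨h4, h3⟩⟩
      rw [hχ]
      exact max_eq_left ((min_le_right _ _).trans (by linarith))
    · right
      have h3 : 3 / 4 ≤ t := by nlinarith
      have h4 : t ≤ 5 / 4 := by nlinarith
      refine ⟨?_, abs_le.2 ⟨by linarith, by linarith⟩⟩
      rw [hχ]
      simp only
      rw [min_eq_left (by linarith), max_eq_right (by norm_num)]
  refine ⟨cfcₙ χ a, ?_, ?_, ?_⟩
  · rw [← cfcₙ_mul χ χ a]
    refine cfcₙ_congr fun t ht => ?_
    rcases hval t ht with h1 | h1 <;> simp [h1.1]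
  · exact (cfcₙ_predicate χ a : IsSelfAdjoint _)
  · have e : cfcₙ χ a - a = cfcₙ (fun t => χ t - t) a := by
      rw [cfcₙ_sub .., cfcₙ_id' ℝ a]
    rw [e]
    refine norm_cfcₙ_le fun t ht => ?_
    rw [Real.norm_eq_abs]
    rcases hval t ht with h1 | h1
    · simpa [h1.1] using h1.2
    · simpa [h1.1] using h1.2

end IdempotentEquivalence

/-! ### Finite rank projections among the compact operators -/

section FiniteRank

open Filter Topology

/-- The vector of `ℓ²(ℤ)` with given coordinates at `0, …, n - 1` and zero elsewhere. -/
noncomputable def finIncl (n : ℕ) : (Fin n → ℂ) →L[ℂ] EllTwoZ :=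
  ∑ j : Fin n, (ContinuousLinearMap.proj j).smulRight (basisVec j)

/-- The coordinates at `0, …, n - 1` of a vector of `ℓ²(ℤ)`. -/
noncomputable def finCoord (n : ℕ) : EllTwoZ →L[ℂ] (Fin n → ℂ) :=
  ContinuousLinearMap.pi fun j => innerSL ℂ (basisVec j)

lemma finIncl_apply (n : ℕ) (c : Fin n → ℂ) : finIncl n c = ∑ j : Fin n, c j • basisVec j := by
  simp [finIncl, sum_apply]

lemma finCoord_finIncl (n : ℕ) (c : Fin n → ℂ) : finCoord n (finIncl n c) = c := by
  ext i
  change inner ℂ (basisVec i) (finIncl n c) = c i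
  rw [finIncl_apply, inner_sum, Finset.sum_eq_single i]
  · simp [inner_smul_right, orthonormal_basisVec.1]
  · intro j _ hj
    have : (i : ℤ) ≠ j := fun h => hj (Fin.ext (by exact_mod_cast h.symm))
    simp [inner_smul_right, inner_basisVec, Fin.val_inj, hj.symm]
  · simp

lemma frob_matUnit_zero_apply (n : ℕ+) (v : EllTwoZ) :
    (frob n (matUnit 0 0) : EllTwoZ →L[ℂ] EllTwoZ) v = finIncl n (finCoord n v) := by
  rw [finIncl_apply, frob_matUnit, AddSubmonoidClass.coe_finsetSum, sum_apply, Finset.sum_range]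
  refine Finset.sum_congr rfl fun j _ => ?_
  simp only [mul_zero, zero_add]
  rfl

/-- A non-zero compact idempotent is equivalent to the projection on the first vectors of the
basis. -/
lemma exists_idemEquiv_frob {f : KAlg} (hf : f * f = f) (h0 : f ≠ 0) :
    ∃ n : ℕ+, IdemEquiv f (frob n (matUnit 0 0)) := by
  let g : EllTwoZ →L[ℂ] EllTwoZ := f.1
  have hgg : ∀ v, g (g v) = g v := fun v =>
    congrArg (fun T : KAlg => (T : EllTwoZ →L[ℂ] EllTwoZ) v) hf
  let V : Submodule ℂ EllTwoZ := ((1 - g : EllTwoZ →L[ℂ] EllTwoZ) : EllTwoZ →ₗ[ℂ] EllTwoZ).ker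
  have hV : ∀ v, v ∈ V ↔ g v = v := by
    intro v
    change v - g v = 0 ↔ _
    rw [sub_eq_zero, eq_comm]
  have hgV : ∀ v, g v ∈ V := fun v => (hV _).2 (hgg v)
  have hVc : IsClosed (V : Set EllTwoZ) := (1 - g).isClosed_ker
  -- On its range `V` the idempotent is the identity, which is therefore compact, so that `V` has
  -- finite dimension.
  have hid := IsCompactOperator.restrict (f := (g : EllTwoZ →ₗ[ℂ] EllTwoZ)) f.2
    (V := V) (fun v _ => hgV v) hVc
  have hid' : IsCompactOperator (id : V → V) := by
    convert! hid using 1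
    exact funext fun v => Subtype.ext ((hV _).1 v.2).symm
  have : FiniteDimensional ℂ V := FiniteDimensional.of_isCompactOperator_id (𝕜 := ℂ) hid'
  have hpos : 0 < Module.finrank ℂ V := by
    rw [Module.finrank_pos_iff]
    by_contra hn
    rw [not_nontrivial_iff_subsingleton] at hn
    apply h0
    apply Subtype.ext
    ext1 v
    exact congrArg Subtype.val (Subsingleton.elim (⟨g v, hgV v⟩ : V) 0)
  obtain ⟨n, hn⟩ : ∃ n : ℕ+, (n : ℕ) = Module.finrank ℂ V := ⟨⟨_, hpos⟩, rfl⟩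
  let L : V ≃L[ℂ] (Fin n → ℂ) := ContinuousLinearEquiv.ofFinrankEq (by simp [hn])
  let a : EllTwoZ →L[ℂ] EllTwoZ := V.subtypeL ∘L (L.symm : (Fin n → ℂ) →L[ℂ] V) ∘L finCoord n
  let b : EllTwoZ →L[ℂ] EllTwoZ :=
    finIncl n ∘L (L : V →L[ℂ] (Fin n → ℂ)) ∘L g.codRestrict V hgV
  have ha : ∀ v, a v = L.symm (finCoord n v) := fun _ => rfl
  have hb : ∀ v, b v = finIncl n (L ⟨g v, hgV v⟩) := fun _ => rfl
  have hga : g * a = a := by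
    ext1 v
    exact (hV _).1 (L.symm (finCoord n v)).2
  have hpb : (frob n (matUnit 0 0) : EllTwoZ →L[ℂ] EllTwoZ) * b = b := by
    ext1 v
    rw [mul_apply_eq_comp, frob_matUnit_zero_apply, hb, finCoord_finIncl]
  have hac : IsCompactOperator a := by
    rw [← hga]
    exact f.2.comp_clm a
  have hbc : IsCompactOperator b := by
    rw [← hpb]
    exact (frob n (matUnit 0 0)).2.comp_clm b
  refine ⟨n, ⟨a, hac⟩, ⟨b, hbc⟩, ?_, ?_, ?_, ?_, ?_, ?_⟩ <;> apply Subtype.ext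
  · ext1 v
    change a (b v) = g v
    rw [ha, hb, finCoord_finIncl, L.symm_apply_apply]
  · ext1 v
    rw [frob_matUnit_zero_apply]
    change b (a v) = _
    have h : (⟨g (a v), hgV _⟩ : V) = L.symm (finCoord n v) :=
      Subtype.ext ((hV _).1 (L.symm (finCoord n v)).2)
    rw [hb, h, L.apply_symm_apply]
  · exact hga
  · ext1 v
    change a ((frob n (matUnit 0 0) : EllTwoZ →L[ℂ] EllTwoZ) v) = a v
    rw [frob_matUnit_zero_apply, ha, finCoord_finIncl, ha]
  · exact hpb
  · ext1 v
    change b (g v) = b v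
    rw [hb, hb]
    simp only [hgg]

/-- Projections of different finite ranks are not even approximately equivalent. -/
lemma one_le_norm_of_lt {m n : ℕ+} (h : n < m) (a b : KAlg) :
    1 ≤ ‖frob m (matUnit 0 0) * a * frob n (matUnit 0 0) * b * frob m (matUnit 0 0) -
      frob m (matUnit 0 0)‖ := by
  let f : (Fin m → ℂ) →ₗ[ℂ] (Fin n → ℂ) := (finCoord n ∘L b.1 ∘L finIncl m).toLinearMap
  -- A non-zero vector of the `m`-dimensional space is lost on the way through the `n`-dimensional
  -- one. On it the difference acts as `-1`.
  have hker : LinearMap.ker f ≠ ⊥ := f.ker_ne_bot_of_finrank_lt (by simpa using h)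
  obtain ⟨c, hc, hc0⟩ := (Submodule.ne_bot_iff _).1 hker
  have hfc : finCoord n (b.1 (finIncl m c)) = 0 := hc
  set v := finIncl m c with hv
  have hv0 : v ≠ 0 := by
    intro h0
    apply hc0
    rw [← finCoord_finIncl m c, ← hv, h0, map_zero]
  have hmv : (frob m (matUnit 0 0) : EllTwoZ →L[ℂ] EllTwoZ) v = v := by
    rw [frob_matUnit_zero_apply, hv, finCoord_finIncl]
  have key : (frob m (matUnit 0 0) * a * frob n (matUnit 0 0) * b * frob m (matUnit 0 0) -
      frob m (matUnit 0 0) : KAlg).1 v = -v := by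
    change (frob m (matUnit 0 0)).1 (a.1 ((frob n (matUnit 0 0)).1 (b.1
      ((frob m (matUnit 0 0)).1 v)))) - (frob m (matUnit 0 0)).1 v = -v
    rw [hmv, frob_matUnit_zero_apply n, hfc]
    simp
  have h1 := (frob m (matUnit 0 0) * a * frob n (matUnit 0 0) * b * frob m (matUnit 0 0) -
      frob m (matUnit 0 0) : KAlg).1.le_opNorm v
  rw [key, norm_neg] at h1
  have := norm_pos_iff.2 hv0
  exact (le_mul_iff_one_le_left this).1 h1

end FiniteRank

/-! ### Equivalences between multiples of projections -/

section Amplification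

variable {A : Type*} [NonUnitalCStarAlgebra A]

/-- The sum of `k` orthogonal copies of an element. -/
noncomputable def amplify (k : ℕ+) (φ ψ : KAlg →⋆ₙₐ[ℂ] A) (a : A) : A :=
  ∑ r ∈ Finset.range k, φ (matUnit r 0) * a * ψ (matUnit 0 r)

/-- A diagonal sum of `k` copies of an equivalence between the corners at `0` is an equivalence
between the sums of the first `k` diagonal matrix units, that is, between the images of `Fr_k`. -/
lemma amplify_mul_amplify (k : ℕ+) {φ ψ : KAlg →⋆ₙₐ[ℂ] A} {a b : A}
    (h1 : a * ψ (matUnit 0 0) = a) (h2 : a * b = φ (matUnit 0 0)) :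
    amplify k φ ψ a * amplify k ψ φ b = φ (frob k (matUnit 0 0)) := by
  rw [frob_matUnit, map_sum, amplify, amplify, Finset.sum_mul_sum]
  refine Finset.sum_congr rfl fun r hr => ?_
  have e (s : ℕ) : φ (matUnit r 0) * a * ψ (matUnit 0 r) *
      (ψ (matUnit s 0) * b * φ (matUnit 0 s)) =
      φ (matUnit r 0) * a * ψ (matUnit 0 r * matUnit s 0) * b * φ (matUnit 0 s) := by
    rw [map_mul]
    simp only [mul_assoc]
  simp only [e, matUnit_mul]
  rw [Finset.sum_eq_single_of_mem r hr]
  · rw [if_pos rfl, mul_assoc (φ (matUnit r 0)), h1, mul_assoc (φ (matUnit r 0)), h2, ← map_mul,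
      ← map_mul]
    simp [matUnit_mul]
  · intro s _ hs
    have : (r : ℤ) ≠ s := fun h => hs (by exact_mod_cast h.symm)
    rw [if_neg this, map_zero, mul_zero, zero_mul, zero_mul]

lemma frob_mul_amplify (k : ℕ+) (φ ψ : KAlg →⋆ₙₐ[ℂ] A) (a : A) :
    φ (frob k (matUnit 0 0)) * amplify k φ ψ a = amplify k φ ψ a := by
  rw [amplify, Finset.mul_sum]
  refine Finset.sum_congr rfl fun r hr => ?_
  have h : frob k (matUnit 0 0) * matUnit r 0 = matUnit r 0 := by
    rw [frob_matUnit, Finset.sum_mul, Finset.sum_eq_single_of_mem r hr]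
    · simp [matUnit_mul]
    · intro s _ hs
      simp [matUnit_mul, hs]
  rw [← mul_assoc, ← mul_assoc, ← map_mul, h]

lemma amplify_mul_frob (k : ℕ+) (φ ψ : KAlg →⋆ₙₐ[ℂ] A) (a : A) :
    amplify k φ ψ a * ψ (frob k (matUnit 0 0)) = amplify k φ ψ a := by
  rw [amplify, Finset.sum_mul]
  refine Finset.sum_congr rfl fun r hr => ?_
  have h : matUnit 0 r * frob k (matUnit 0 0) = matUnit 0 r := by
    rw [frob_matUnit, Finset.mul_sum, Finset.sum_eq_single_of_mem r hr]
    · simp [matUnit_mul]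
    · intro s _ hs
      simp [matUnit_mul, hs.symm]
  rw [mul_assoc, ← map_mul, h]

end Amplification

/-! ### Recovering the flat action from the algebra -/

section Invariant

namespace FrobSystem

variable {X : Type*} [MulAction ℕ+ X] {Y : Type*} [MulAction ℕ+ Y]
  {A : Type*} [NonUnitalCStarAlgebra A]

/-- An equivalence makes `e * a * f * b * e - e` vanish, and norm less than one is an open
condition. So `a` and `b` can be replaced by elements of a common copy of `𝒦`, where `e` and `f`
have ranks `k * r > l * r`; this contradicts `one_le_norm_of_lt`. -/
lemma not_idemEquiv_of_lt (Φ : FrobSystem X A) (hX : IsFlatAction X) (z : X) {k l : ℕ+}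
    (hlk : l < k) :
    ¬ IdemEquiv (Φ.hom (k • z) (matUnit 0 0)) (Φ.hom (l • z) (matUnit 0 0)) := by
  rintro ⟨a, b, h1, h2, h3, h4, h5, h6⟩
  set e := Φ.hom (k • z) (matUnit 0 0)
  set f := Φ.hom (l • z) (matUnit 0 0)
  have hopen : IsOpen {p : A × A | ‖e * p.1 * f * p.2 * e - e‖ < 1} :=
    isOpen_lt (by fun_prop) continuous_const
  have hmem : (a, b) ∈ {p : A × A | ‖e * p.1 * f * p.2 * e - e‖ < 1} := by
    have : e * a * f * b * e - e = 0 := by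
      rw [h3, h4, mul_assoc, h6, h1, sub_self]
    simp [this]
  obtain ⟨⟨a', b'⟩, hab, ⟨x, S, hS⟩, ⟨y, T, hT⟩⟩ :=
    (Φ.dense.prod Φ.dense).inter_open_nonempty _ hopen ⟨_, hmem⟩
  obtain ⟨w₀, i, j, rfl, rfl⟩ := hX.exists_common x y
  obtain ⟨w, r, s, rfl, rfl⟩ := hX.exists_common z w₀
  simp only at hS hT
  rw [smul_smul, Φ.hom_smul] at hS hT
  have he : e = Φ.hom w (frob (k * r) (matUnit 0 0)) := by
    simp only [e]
    rw [smul_smul, Φ.hom_smul]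
  have hf : f = Φ.hom w (frob (l * r) (matUnit 0 0)) := by
    simp only [f]
    rw [smul_smul, Φ.hom_smul]
  rw [Set.mem_ofPred_eq, ← hS, ← hT] at hab
  simp only [he, hf, ← map_mul, ← map_sub, Φ.norm_hom] at hab
  exact absurd (one_le_norm_of_lt (mul_lt_mul_left hlk r) _ _) (not_le.2 hab)

lemma eq_of_idemEquiv (Φ : FrobSystem X A) (hX : IsFlatAction X) {x x' : X}
    (h : IdemEquiv (Φ.hom x (matUnit 0 0)) (Φ.hom x' (matUnit 0 0))) : x = x' := by
  obtain ⟨z, k, l, rfl, rfl⟩ := hX.exists_common x x'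
  rcases lt_trichotomy k l with hkl | rfl | hkl
  · exact absurd h.symm (Φ.not_idemEquiv_of_lt hX z hkl)
  · rfl
  · exact absurd h (Φ.not_idemEquiv_of_lt hX z hkl)

/-- Approximate `e` by an element of a copy of `𝒦`, symmetrize it, and correct it to a projection
`f` of `𝒦`. Nearby projections are equivalent, and `f` is equivalent to some `Fr_n` of a minimal
projection, which is the minimal projection at `n • y`. -/
lemma exists_idemEquiv (Ψ : FrobSystem Y A) {e : A} (he : e * e = e) (hs : star e = e)
    (h0 : e ≠ 0) : ∃ y, IdemEquiv e (Ψ.hom y (matUnit 0 0)) := by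
  -- An error `d` of norm at most `1 / 32` gives `‖T * T - T‖ ≤ 3 / 32 + 1 / 1024 ≤ 1 / 8`, and then
  -- `‖e - Ψ.hom y f‖ ≤ 1 / 4 + 1 / 32 < 1`.
  obtain ⟨_, ⟨y, S, rfl⟩, hS⟩ := Metric.mem_closure_iff.1 (Ψ.dense e) (1 / 32) (by norm_num)
  rw [dist_comm, dist_eq_norm] at hS
  set T : KAlg := (2⁻¹ : ℂ) • (S + star S) with hT
  have hTs : star T = T := by
    rw [hT, star_smul, star_add, star_star, add_comm]
    congr 1
    simp
  have hTe : ‖Ψ.hom y T - e‖ ≤ 1 / 32 := by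
    have e1 : Ψ.hom y T - e = (2⁻¹ : ℂ) • ((Ψ.hom y S - e) + star (Ψ.hom y S - e)) := by
      rw [hT, map_smul, map_add, map_star, star_sub, hs]
      have : e = (2⁻¹ : ℂ) • (e + e) := by
        rw [← two_smul ℂ e, smul_smul]; norm_num
      nth_rw 1 [this]
      rw [← smul_sub]
      congr 1
      abel
    rw [e1, norm_smul]
    have := norm_add_le (Ψ.hom y S - e) (star (Ψ.hom y S - e))
    rw [norm_star] at this
    have h2 : ‖(2⁻¹ : ℂ)‖ = 2⁻¹ := by norm_num
    rw [h2]
    linarith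
  have hTT : ‖T * T - T‖ ≤ 1 / 8 := by
    rw [← Ψ.norm_hom y, map_sub, map_mul]
    set d := Ψ.hom y T - e with hd
    have e1 : Ψ.hom y T = e + d := by rw [hd]; abel
    have e2 : Ψ.hom y T * Ψ.hom y T - Ψ.hom y T = e * d + d * e + d * d - d := by
      rw [e1]
      calc (e + d) * (e + d) - (e + d) = e * e - e + (e * d + d * e + d * d - d) := by
            noncomm_ring
        _ = _ := by rw [he]; noncomm_ring
    rw [e2]
    have he1 := norm_le_one_of_projection he hs
    have n1 := norm_sub_le (e * d + d * e + d * d) d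
    have n2 := norm_add_le (e * d + d * e) (d * d)
    have n3 := norm_add_le (e * d) (d * e)
    have n4 := norm_mul_le e d
    have n5 := norm_mul_le d e
    have n6 := norm_mul_le d d
    have := norm_nonneg d
    have := norm_nonneg e
    nlinarith
  obtain ⟨f, hff, hfs, hfT⟩ := exists_projection_near hTs hTT
  have hef : ‖e - Ψ.hom y f‖ < 1 := by
    have e1 : e - Ψ.hom y f = -(Ψ.hom y (f - T)) - (Ψ.hom y T - e) := by rw [map_sub]; abel
    rw [e1]
    have := norm_sub_le (-(Ψ.hom y (f - T))) (Ψ.hom y T - e)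
    rw [norm_neg, Ψ.norm_hom] at this
    linarith
  have hf0 : f ≠ 0 := by
    rintro rfl
    rw [map_zero, sub_zero] at hef
    exact absurd (one_le_norm_of_projection he h0) (not_le.2 hef)
  obtain ⟨n, hn⟩ := exists_idemEquiv_frob hff hf0
  refine ⟨n • y, ?_⟩
  rw [Ψ.hom_smul]
  refine (idemEquiv_of_norm_sub_lt_one he ?_ ?_ hef).trans (hn.map (Ψ.hom y))
  · rw [← map_mul, hff]
  · exact (map_star (Ψ.hom y) f).symm.trans (congrArg _ hfs)

lemma idemEquiv_smul (Φ : FrobSystem X A) (Ψ : FrobSystem Y A) (k : ℕ+) {x : X} {y : Y}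
    (h : IdemEquiv (Φ.hom x (matUnit 0 0)) (Ψ.hom y (matUnit 0 0))) :
    IdemEquiv (Φ.hom (k • x) (matUnit 0 0)) (Ψ.hom (k • y) (matUnit 0 0)) := by
  obtain ⟨a, b, h1, h2, h3, h4, h5, h6⟩ := h
  rw [Φ.hom_smul, Ψ.hom_smul]
  exact ⟨amplify k _ _ a, amplify k _ _ b, amplify_mul_amplify k h4 h1,
    amplify_mul_amplify k h6 h2, frob_mul_amplify k _ _ a, amplify_mul_frob k _ _ a,
    frob_mul_amplify k _ _ b, amplify_mul_frob k _ _ b⟩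

lemma exists_idemEquiv_hom (Φ : FrobSystem X A) (Ψ : FrobSystem Y A) (x : X) :
    ∃ y, IdemEquiv (Φ.hom x (matUnit 0 0)) (Ψ.hom y (matUnit 0 0)) := by
  refine Ψ.exists_idemEquiv ?_ ?_ ?_
  · rw [← map_mul, matUnit_mul, if_pos rfl]
  · rw [← map_star, star_matUnit]
  · exact fun h => matUnit_ne_zero 0 0 (Φ.injective x (h.trans (map_zero _).symm))

/-- The flat action is determined by the inductive limit. -/
theorem exists_equiv (Φ : FrobSystem X A) (Ψ : FrobSystem Y A) (hX : IsFlatAction X)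
    (hY : IsFlatAction Y) : ∃ g : X ≃ Y, ∀ (k : ℕ+) (x : X), g (k • x) = k • g x := by
  choose g hg using Φ.exists_idemEquiv_hom Ψ
  choose h hh using Ψ.exists_idemEquiv_hom Φ
  refine ⟨⟨g, h, fun x => ?_, fun y => ?_⟩, fun k x => ?_⟩
  · exact (Φ.eq_of_idemEquiv hX ((hg x).trans (hh (g x)))).symm
  · exact (Ψ.eq_of_idemEquiv hY ((hh y).trans (hg (h y)))).symm
  · exact Ψ.eq_of_idemEquiv hY ((hg (k • x)).symm.trans (Φ.idemEquiv_smul Ψ k (hg x)))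

end FrobSystem

end Invariant

/-! ### Representations, traces and norms of full matrix algebras -/

section MatrixRepresentations

open Matrix

variable {W : Type*} [NormedAddCommGroup W] [InnerProductSpace ℂ W] [FiniteDimensional ℂ W]

lemma star_single_one {I : Type*} [DecidableEq I] (i j : I) :
    star (Matrix.single i j (1 : ℂ)) = Matrix.single j i 1 := by
  ext a b
  simp [Matrix.star_apply, Matrix.single_apply, and_comm]

/-- A faithful representation of a full matrix algebra on a finite dimensional Hilbert space is a
multiple of the canonical one, and the orthonormal basis which witnesses it can be indexed by an
arbitrary set of integers of the right size. -/
lemma exists_orthonormalBasis_dilate {F : Finset ℤ} (hF : F.Nonempty)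
    (h : Matrix F F ℂ →⋆ₙₐ[ℂ] (W →ₗ[ℂ] W)) (hinj : Function.Injective h) :
    ∃ k : ℕ+, k * F.card ≤ Module.finrank ℂ W ∧ ∀ J : Finset ℤ, J.card = Module.finrank ℂ W →
      (∀ p : ℤ, p / k ∈ F → p ∈ J) → ∃ b : OrthonormalBasis J ℂ W,
        ∀ T, LinearMap.toMatrixOrthonormal b (h T) = dilate k J T := by
  obtain ⟨i₀, hi₀⟩ := hF
  let o : F := ⟨i₀, hi₀⟩
  let e : F → F → W →ₗ[ℂ] W := fun i j => h (single i j 1)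
  have emul : ∀ i j l v, e i j (e j l v) = e i l v := by
    intro i j l v
    rw [← Module.End.mul_apply, ← map_mul, single_mul_single_same, mul_one]
  have emul0 : ∀ i j j' l v, j ≠ j' → e i j (e j' l v) = 0 := by
    intro i j j' l v hj
    rw [← Module.End.mul_apply, ← map_mul, single_mul_single_of_ne _ _ _ _ hj, map_zero]
    rfl
  have einner : ∀ i j v w, inner ℂ (e i j v) w = inner ℂ v (e j i w) := by
    intro i j v w
    have : e j i = LinearMap.adjoint (e i j) := by
      rw [← LinearMap.star_eq_adjoint, ← map_star, star_single_one]
    rw [this, LinearMap.adjoint_inner_right]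
  -- The multiplicity is the dimension of the range of a minimal projection. A basis of it, moved
  -- around by the matrix units `e i o`, gives the orthonormal family `f`.
  let V := LinearMap.range (e o o)
  have hV : ∀ v : V, e o o v = v := by
    rintro ⟨_, w, rfl⟩
    exact emul o o o w
  have hpos : 0 < Module.finrank ℂ V := by
    rw [Module.finrank_pos_iff]
    by_contra hn
    rw [not_nontrivial_iff_subsingleton] at hn
    have h0 : e o o = 0 := by
      ext w
      exact congrArg Subtype.val (Subsingleton.elim (⟨_, w, rfl⟩ : V) 0)
    have h1 : single o o (1 : ℂ) = 0 := hinj (h0.trans (map_zero h).symm)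
    have := congrFun (congrFun h1 o) o
    simp at this
  obtain ⟨k, hk⟩ : ∃ k : ℕ+, (k : ℕ) = Module.finrank ℂ V := ⟨⟨_, hpos⟩, rfl⟩
  have hk0 : (0 : ℤ) < k := by exact_mod_cast k.pos
  let v : OrthonormalBasis (Fin k) ℂ V := (stdOrthonormalBasis ℂ V).reindex (finCongr hk.symm)
  let f : F × Fin k → W := fun x => e x.1 o (v x.2)
  have hf : Orthonormal ℂ f := by
    rw [orthonormal_iff_ite]
    rintro ⟨i, r⟩ ⟨j, s⟩
    simp only [f]
    rw [einner]
    by_cases hij : i = j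
    · subst hij
      rw [emul, hV]
      have := (orthonormal_iff_ite.1 v.orthonormal) r s
      rw [Submodule.coe_inner] at this
      rw [this]
      simp
    · rw [emul0 _ _ _ _ _ hij, inner_zero_right]
      simp [hij]
  refine ⟨k, ?_, fun J hJ hcov => ?_⟩
  · have := hf.linearIndependent.fintype_card_le_finrank
    simpa [mul_comm] using this
  let dig : (p : ℤ) → Fin k := fun p => ⟨(p % k).toNat, by
    have := Int.emod_lt_of_pos p hk0
    have := Int.emod_nonneg p hk0.ne'
    omega⟩
  have hdig : ∀ p : ℤ, ((dig p : ℕ) : ℤ) = p % k := fun p =>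
    Int.toNat_of_nonneg (Int.emod_nonneg p hk0.ne')
  let s : Set J := {p | (p : ℤ) / k ∈ F}
  -- The vector `f (i, r)` is placed at the index `k * i + r`. The other indices of `J` receive
  -- arbitrary vectors that complete an orthonormal basis.
  let u : J → W := fun p => if hp : (p : ℤ) / k ∈ F then f (⟨_, hp⟩, dig p) else 0
  have hu : Orthonormal ℂ (s.domRestrict u) := by
    have e1 : s.domRestrict u = f ∘ fun p : s => (⟨_, p.2⟩, dig p.1) := by
      funext p
      exact dif_pos p.2
    rw [e1]
    refine hf.comp _ ?_
    rintro ⟨⟨p, hp⟩, hps⟩ ⟨⟨q, hq⟩, hqs⟩ hpq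
    simp only [Prod.mk.injEq, Subtype.mk.injEq] at hpq
    have h2 : p % (k : ℤ) = q % k := by rw [← hdig, ← hdig, hpq.2]
    have : p = q := by
      rw [← Int.mul_ediv_add_emod p k, ← Int.mul_ediv_add_emod q k, hpq.1, h2]
    subst this
    rfl
  obtain ⟨b, hb⟩ := hu.exists_orthonormalBasis_extension_of_card_eq (by simp [hJ])
  have hdiv : ∀ (i : F) (r : Fin k), ((k * i + (r : ℕ) : ℤ)) / k = i ∧
      ((k * i + (r : ℕ) : ℤ)) % k = (r : ℕ) := by
    intro i r
    have hr : (((r : ℕ) : ℤ)) < k := by exact_mod_cast r.2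
    constructor
    · rw [Int.mul_add_ediv_left _ _ hk0.ne', Int.ediv_eq_zero_of_lt (by positivity) hr, add_zero]
    · rw [Int.mul_add_emod_self_left, Int.emod_eq_of_lt (by positivity) hr]
  have hfb : ∀ i r, f (i, r) = b ⟨k * i + (r : ℕ), hcov _ (by rw [(hdiv i r).1]; exact i.2)⟩ := by
    intro i r
    have hmem : ((k * i + (r : ℕ) : ℤ)) / k ∈ F := by rw [(hdiv i r).1]; exact i.2
    rw [hb _ hmem]
    simp only [u]
    rw [dif_pos hmem]
    congr 2
    · exact Subtype.ext (hdiv i r).1.symm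
    · apply Fin.ext
      have := hdig (k * i + (r : ℕ))
      rw [(hdiv i r).2] at this
      exact_mod_cast this.symm
  have hT : ∀ T : Matrix F F ℂ, h T = ∑ i, ∑ j, T i j • e i j := by
    intro T
    conv_lhs => rw [matrix_eq_sum_single T]
    simp only [map_sum]
    refine Finset.sum_congr rfl fun i _ => Finset.sum_congr rfl fun j _ => ?_
    rw [← map_smul, smul_single, smul_eq_mul, mul_one]
  refine ⟨b, fun T => ?_⟩
  ext p q
  rw [LinearMap.toMatrixOrthonormal_apply_apply]
  by_cases hq : (q : ℤ) / k ∈ F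
  · have hbq : b q = f (⟨_, hq⟩, dig q) := by
      rw [hb q hq]
      exact dif_pos hq
    have e1 : h T (b q) = ∑ i, T i ⟨_, hq⟩ • f (i, dig q) := by
      rw [hbq, hT]
      simp only [LinearMap.sum_apply, LinearMap.smul_apply]
      refine Finset.sum_congr rfl fun i _ => ?_
      rw [Finset.sum_eq_single ⟨_, hq⟩]
      · rw [emul]
      · intro j _ hj
        rw [emul0 _ _ _ _ _ hj, smul_zero]
      · simp
    rw [e1, inner_sum]
    simp only [inner_smul_right, hfb, b.inner_eq_ite, dilate]
    by_cases hpq : (p : ℤ) % k = q % k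
    · rw [if_pos hpq]
      by_cases hp : (p : ℤ) / k ∈ F
      · rw [extendZero, dif_pos ⟨hp, hq⟩, Finset.sum_eq_single ⟨_, hp⟩]
        · rw [if_pos, mul_one]
          apply Subtype.ext
          simp only
          rw [hdig, ← hpq, Int.mul_ediv_add_emod]
        · intro i _ hi
          rw [if_neg, mul_zero]
          intro heq
          apply hi
          apply Subtype.ext
          have := congrArg (fun x : J => (x : ℤ) / k) heq
          simp only [(hdiv _ _).1] at this
          exact this.symm
        · simp
      · rw [extendZero, dif_neg (fun hh => hp hh.1)]
        refine Finset.sum_eq_zero fun i _ => ?_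
        rw [if_neg, mul_zero]
        intro heq
        apply hp
        have := congrArg (fun x : J => (x : ℤ) / k) heq
        simp only [(hdiv _ _).1] at this
        rw [this]
        exact i.2
    · rw [if_neg hpq]
      refine Finset.sum_eq_zero fun i _ => ?_
      rw [if_neg, mul_zero]
      intro heq
      apply hpq
      have := congrArg (fun x : J => (x : ℤ) % k) heq
      simp only [hdig] at this
      simpa using this
  · have hz : ∀ j, e o j (b q) = 0 := by
      intro j
      have hmem : e o j (b q) ∈ V := ⟨e o j (b q), emul o o j _⟩
      have : (⟨_, hmem⟩ : V) = 0 := by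
        apply v.repr.injective
        ext r
        rw [map_zero, v.repr_apply_apply, Submodule.coe_inner, ← einner]
        change inner ℂ (f (j, r)) (b q) = 0
        rw [hfb, b.inner_eq_ite, if_neg]
        intro heq
        apply hq
        have := congrArg (fun x : J => (x : ℤ) / k) heq
        simp only [(hdiv _ _).1] at this
        rw [← this]
        exact j.2
      exact congrArg Subtype.val this
    have e1 : h T (b q) = 0 := by
      rw [hT]
      simp only [LinearMap.sum_apply, LinearMap.smul_apply]
      refine Finset.sum_eq_zero fun i _ => Finset.sum_eq_zero fun j _ => ?_
      rw [← emul i o j, hz, map_zero, smul_zero]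
    rw [e1, inner_zero_right, dilate, extendZero, dif_neg (fun hh => hq hh.2), ite_self]

/-- The trace is, up to a factor, the only tracial functional on a full matrix algebra. -/
lemma tracial_eq_mul_trace {I : Type*} [Fintype I] [DecidableEq I] (o : I)
    (τ : Matrix I I ℂ →ₗ[ℂ] ℂ) (hτ : ∀ S T, τ (S * T) = τ (T * S)) (T : Matrix I I ℂ) :
    τ T = τ (single o o 1) * T.trace := by
  have hd : ∀ i, τ (single i i 1) = τ (single o o 1) := by
    intro i
    have := hτ (single i o 1) (single o i 1)
    simpa using this
  have ho : ∀ i j, i ≠ j → τ (single i j 1) = 0 := by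
    intro i j hij
    have := hτ (single i i 1) (single i j 1)
    rwa [single_mul_single_same, single_mul_single_of_ne _ _ _ _ hij.symm, map_zero, mul_one]
      at this
  have hs : ∀ i j, single i j (T i j) = T i j • single i j 1 := fun i j => by simp
  conv_lhs => rw [matrix_eq_sum_single T]
  simp only [map_sum, hs, map_smul, smul_eq_mul]
  rw [Matrix.trace, Finset.mul_sum]
  refine Finset.sum_congr rfl fun i _ => ?_
  rw [Finset.sum_eq_single i, hd i, mul_comm]
  · rfl
  · intro j _ hj
    rw [ho i j hj.symm, mul_zero]
  · simp

/-- The trace of an idempotent is its rank. -/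
lemma exists_trace_eq_natCast {J : Type*} [Fintype J] [DecidableEq J] {E : Matrix J J ℂ}
    (hE : E * E = E) (h0 : E ≠ 0) : ∃ k : ℕ, 0 < k ∧ E.trace = k := by
  have hid : IsIdempotentElem (Matrix.toLin' E) := by
    rw [IsIdempotentElem, ← LinearMap.toMatrix'.injective.eq_iff]
    simp [LinearMap.toMatrix'_mul, hE]
  have htr := (LinearMap.IsIdempotentElem.isProj_range _ hid).trace
  rw [Matrix.trace_toLin'_eq] at htr
  refine ⟨_, ?_, htr⟩
  rw [Module.finrank_pos_iff, Submodule.nontrivial_iff_ne_bot, Ne, LinearMap.range_eq_bot]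
  exact fun h => h0 (Matrix.toLin'.injective (h.trans (map_zero _).symm))

/-- The pulled back trace is tracial, hence a multiple of the trace; the factor is the rank of the
image of a minimal projection. -/
lemma exists_trace_comp_eq {I J : Type*} [Fintype I] [DecidableEq I] [Fintype J] [DecidableEq J]
    [Nonempty I] (h : Matrix I I ℂ →⋆ₙₐ[ℂ] Matrix J J ℂ) (hinj : Function.Injective h) :
    ∃ k : ℕ, 0 < k ∧ ∀ T, (h T).trace = k * T.trace := by
  obtain ⟨o⟩ := ‹Nonempty I›
  have h0 : h (single o o 1) ≠ 0 := by
    intro hh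
    have h1 : single o o (1 : ℂ) = 0 := hinj (hh.trans (map_zero h).symm)
    have := congrFun (congrFun h1 o) o
    simp at this
  obtain ⟨k, hk, hkt⟩ := exists_trace_eq_natCast (E := h (single o o 1))
    (by rw [← map_mul, single_mul_single_same, mul_one]) h0
  refine ⟨k, hk, fun T => ?_⟩
  rw [← hkt]
  exact tracial_eq_mul_trace o ((Matrix.traceLinearMap J ℂ ℂ) ∘ₗ (h : _ →ₗ[ℂ] Matrix J J ℂ))
    (fun S T => by
      change (h (S * T)).trace = (h (T * S)).trace
      rw [map_mul, map_mul, Matrix.trace_mul_comm]) T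

/-- Any two embeddings of a full matrix algebra in C*-algebras induce the same norm. -/
lemma norm_eq_norm_of_injective {I : Type*} [Fintype I] [DecidableEq I]
    {A : Type*} [NonUnitalCStarAlgebra A]
    (φ : Matrix I I ℂ →⋆ₙₐ[ℂ] A) (hφ : Function.Injective φ) (T : Matrix I I ℂ) :
    ‖φ T‖ = ‖Matrix.toEuclideanCLM (𝕜 := ℂ) T‖ := by
  let ψ : (EuclideanSpace ℂ I →L[ℂ] EuclideanSpace ℂ I) →⋆ₙₐ[ℂ] A :=
    φ.comp ((Matrix.toEuclideanCLM (n := I) (𝕜 := ℂ)).symm :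
      (EuclideanSpace ℂ I →L[ℂ] EuclideanSpace ℂ I) →⋆ₙₐ[ℂ] Matrix I I ℂ)
  have hψ : Function.Injective ψ :=
    hφ.comp (Matrix.toEuclideanCLM (n := I) (𝕜 := ℂ)).symm.injective
  have h := NonUnitalStarAlgHom.norm_map ψ hψ (Matrix.toEuclideanCLM (𝕜 := ℂ) T)
  rw [← h]
  congr 1
  exact congrArg φ ((Matrix.toEuclideanCLM (n := I) (𝕜 := ℂ)).symm_apply_apply T).symm

lemma norm_trace_le {I : Type*} [Fintype I] [DecidableEq I]
    {A : Type*} [NonUnitalCStarAlgebra A]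
    (φ : Matrix I I ℂ →⋆ₙₐ[ℂ] A) (hφ : Function.Injective φ) (T : Matrix I I ℂ) :
    ‖T.trace‖ ≤ Fintype.card I * ‖φ T‖ := by
  rw [norm_eq_norm_of_injective φ hφ, Matrix.trace]
  refine (norm_sum_le _ _).trans ?_
  rw [← nsmul_eq_mul, ← Finset.card_univ, ← Finset.sum_const]
  refine Finset.sum_le_sum fun i _ => ?_
  have h1 : T.diag i = inner ℂ (EuclideanSpace.basisFun I ℂ i)
      (Matrix.toEuclideanCLM (𝕜 := ℂ) T (EuclideanSpace.basisFun I ℂ i)) := by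
    simp [EuclideanSpace.inner_single_left]
  rw [h1]
  refine (norm_inner_le_norm _ _).trans ?_
  have h2 := (Matrix.toEuclideanCLM (𝕜 := ℂ) T).le_opNorm (EuclideanSpace.basisFun I ℂ i)
  rw [(EuclideanSpace.basisFun I ℂ).norm_eq_one] at h2 ⊢
  linarith

end MatrixRepresentations

/-! ### Extending an isometric correspondence to completions -/

section Closure

/-- Two C*-algebras with a norm preserving correspondence between dense *-subalgebras are
isomorphic. -/
lemma nonempty_starAlgEquiv_of_correspondence {A B : Type*} [NonUnitalCStarAlgebra A]
    [NonUnitalCStarAlgebra B] (R : NonUnitalStarSubalgebra ℂ (A × B))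
    (hR : ∀ p ∈ R, ‖p.1‖ = ‖p.2‖) (h1 : Dense (Prod.fst '' (R : Set (A × B))))
    (h2 : Dense (Prod.snd '' (R : Set (A × B)))) : Nonempty (A ≃⋆ₐ[ℂ] B) := by
  -- The closure of the graph is complete, and both projections from it are isometric with dense,
  -- hence full, image.
  let Q := R.topologicalClosure
  have hQc : IsClosed (Q : Set (A × B)) := R.isClosed_topologicalClosure
  have hRQ : R ≤ Q := R.le_topologicalClosure
  have hQ : ∀ p ∈ Q, ‖p.1‖ = ‖p.2‖ := by
    have hcl : IsClosed {p : A × B | ‖p.1‖ = ‖p.2‖} := isClosed_eq (by fun_prop) (by fun_prop)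
    intro p hp
    exact (hcl.closure_subset_iff.2 hR) hp
  have hcomplete : CompleteSpace Q := hQc.completeSpace_coe
  let f : Q →⋆ₙₐ[ℂ] A := (NonUnitalStarAlgHom.fst ℂ A B).comp
    (NonUnitalStarSubalgebraClass.subtype Q)
  let g : Q →⋆ₙₐ[ℂ] B := (NonUnitalStarAlgHom.snd ℂ A B).comp
    (NonUnitalStarSubalgebraClass.subtype Q)
  have hfi : Isometry f := by
    refine AddMonoidHomClass.isometry_of_norm f fun p => ?_
    change ‖p.1.1‖ = max ‖p.1.1‖ ‖p.1.2‖
    rw [← hQ p.1 p.2, max_self]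
  have hgi : Isometry g := by
    refine AddMonoidHomClass.isometry_of_norm g fun p => ?_
    change ‖p.1.2‖ = max ‖p.1.1‖ ‖p.1.2‖
    rw [hQ p.1 p.2, max_self]
  have hfs : Function.Surjective f := by
    rw [← Set.range_eq_univ, ← hfi.isClosedEmbedding.isClosed_range.closure_eq]
    refine (h1.mono ?_).closure_eq
    rintro _ ⟨p, hp, rfl⟩
    exact ⟨⟨p, hRQ hp⟩, rfl⟩
  have hgs : Function.Surjective g := by
    rw [← Set.range_eq_univ, ← hgi.isClosedEmbedding.isClosed_range.closure_eq]
    refine (h2.mono ?_).closure_eq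
    rintro _ ⟨p, hp, rfl⟩
    exact ⟨⟨p, hRQ hp⟩, rfl⟩
  exact ⟨(StarAlgEquiv.ofBijective f ⟨hfi.injective, hfs⟩).symm.trans
    (StarAlgEquiv.ofBijective g ⟨hgi.injective, hgs⟩)⟩

end Closure

/-! ### Traces and ranks in matroid algebras -/

section MatroidTraces

open Matrix Filter Topology

variable {A : Type*} [NonUnitalCStarAlgebra A]

lemma exists_trace_restrict_eq {M N : NonUnitalStarSubalgebra ℂ A} (h : M ≤ N)
    {I J : Type*} [Fintype I] [DecidableEq I] [Fintype J] [DecidableEq J] [Nonempty I]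
    (α : M ≃⋆ₐ[ℂ] Matrix I I ℂ) (β : N ≃⋆ₐ[ℂ] Matrix J J ℂ) :
    ∃ k : ℕ, 0 < k ∧ ∀ x (hx : x ∈ M), (β ⟨x, h hx⟩).trace = k * (α ⟨x, hx⟩).trace := by
  let f : Matrix I I ℂ →⋆ₙₐ[ℂ] Matrix J J ℂ := ((β : N →⋆ₙₐ[ℂ] Matrix J J ℂ).comp
    (NonUnitalStarSubalgebra.inclusion h)).comp (α.symm : Matrix I I ℂ →⋆ₙₐ[ℂ] M)
  have hf : Function.Injective f := (β.injective.comp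
    (NonUnitalStarSubalgebra.inclusion_injective h)).comp α.symm.injective
  obtain ⟨k, hk, hkt⟩ := exists_trace_comp_eq f hf
  refine ⟨k, hk, fun x hx => ?_⟩
  rw [← hkt (α ⟨x, hx⟩)]
  change _ = (β (NonUnitalStarSubalgebra.inclusion h (α.symm (α ⟨x, hx⟩)))).trace
  rw [α.symm_apply_apply]
  rfl

/-- Each trace is a positive integer multiple of the other, so both factors are `1`. -/
lemma trace_apply_eq {M : NonUnitalStarSubalgebra ℂ A}
    {I J : Type*} [Fintype I] [DecidableEq I] [Fintype J] [DecidableEq J] [Nonempty I] [Nonempty J]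
    (α : M ≃⋆ₐ[ℂ] Matrix I I ℂ) (β : M ≃⋆ₐ[ℂ] Matrix J J ℂ) (x : M) :
    (β x).trace = (α x).trace := by
  obtain ⟨k, hk, h1⟩ := exists_trace_restrict_eq le_rfl α β
  obtain ⟨l, hl, h2⟩ := exists_trace_restrict_eq le_rfl β α
  obtain ⟨o⟩ := ‹Nonempty I›
  have e1 := h1 (α.symm (single o o 1)) (α.symm (single o o 1)).2
  have e2 := h2 (α.symm (single o o 1)) (α.symm (single o o 1)).2
  rw [Subtype.coe_eta, α.apply_symm_apply, trace_single_eq_same] at e1 e2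
  rw [e1, mul_one] at e2
  have e3 : l * k = 1 := by exact_mod_cast e2.symm
  have := h1 x x.2
  rwa [Nat.eq_one_of_mul_eq_one_left e3, Nat.cast_one, one_mul] at this

lemma trace_dilate (k : ℕ+) {F J : Finset ℤ} (hJ : ∀ p : ℤ, p / k ∈ F → p ∈ J)
    (T : Matrix F F ℂ) : (dilate k J T).trace = k * T.trace := by
  have hk : (0 : ℤ) < k := by exact_mod_cast k.pos
  have hdiv : ∀ (p : ℤ) (j : ℕ), j < k → (k * p + j : ℤ) / k = p ∧ (k * p + j : ℤ) % k = j := by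
    intro p j hj
    have hj' : (j : ℤ) < k := by exact_mod_cast hj
    constructor
    · rw [Int.mul_add_ediv_left _ _ hk.ne', Int.ediv_eq_zero_of_lt (by positivity) hj', add_zero]
    · rw [Int.mul_add_emod_self_left, Int.emod_eq_of_lt (by positivity) hj']
  have e1 : (dilate k J T).trace =
      ∑ p ∈ J with p / (k : ℤ) ∈ F, extendZero T (p / k) (p / k) := by
    rw [Matrix.trace, Finset.sum_filter, ← Finset.sum_coe_sort J]
    refine Finset.sum_congr rfl fun p _ => ?_
    rw [Matrix.diag_apply, dilate, if_pos rfl]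
    split_ifs with hp
    · rfl
    · rw [extendZero, dif_neg (fun h => hp h.1)]
  have e2 : (k : ℂ) * T.trace = ∑ x ∈ F ×ˢ Finset.range k, extendZero T x.1 x.1 := by
    rw [Finset.sum_product, Matrix.trace, ← Finset.sum_coe_sort F, Finset.mul_sum]
    refine Finset.sum_congr rfl fun p _ => ?_
    simp only [Finset.sum_const, Finset.card_range, nsmul_eq_mul, extendZero_coe, diag_apply]
  rw [e1, e2]
  symm
  refine Finset.sum_bij' (fun x _ => k * x.1 + x.2)
    (fun x _ => (x / (k : ℤ), (x % (k : ℤ)).toNat)) ?_ ?_ ?_ ?_ ?_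
  · rintro ⟨p, j⟩ hx
    simp only [Finset.mem_product, Finset.mem_range] at hx
    obtain ⟨a1, a2⟩ := hdiv p j hx.2
    rw [Finset.mem_filter, a1]
    exact ⟨hJ _ (by rw [a1]; exact hx.1), hx.1⟩
  · rintro p hx
    simp only [Finset.mem_filter] at hx
    simp only [Finset.mem_product, Finset.mem_range]
    refine ⟨hx.2, ?_⟩
    have := Int.emod_lt_of_pos p hk
    have := Int.emod_nonneg p hk.ne'
    omega
  · rintro ⟨p, j⟩ hx
    simp only [Finset.mem_product, Finset.mem_range] at hx
    obtain ⟨a1, a2⟩ := hdiv p j hx.2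
    simp [a1, a2]
  · rintro p hx
    have h0 := Int.emod_nonneg p hk.ne'
    simp only [Int.toNat_of_nonneg h0, Int.mul_ediv_add_emod]
  · rintro ⟨p, j⟩ hx
    simp only [Finset.mem_product, Finset.mem_range] at hx
    obtain ⟨a1, a2⟩ := hdiv p j hx.2
    simp [a1]

lemma norm_trace_apply_le {M : NonUnitalStarSubalgebra ℂ A} {I : Type*} [Fintype I] [DecidableEq I]
    (α : M ≃⋆ₐ[ℂ] Matrix I I ℂ) (x : M) : ‖(α x).trace‖ ≤ Fintype.card I * ‖(x : A)‖ := by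
  have h := norm_trace_le ((NonUnitalStarSubalgebraClass.subtype M).comp
    (α.symm : Matrix I I ℂ →⋆ₙₐ[ℂ] M)) (Subtype.val_injective.comp α.symm.injective) (α x)
  have e : ((NonUnitalStarSubalgebraClass.subtype M).comp
      (α.symm : Matrix I I ℂ →⋆ₙₐ[ℂ] M)) (α x) = x :=
    congrArg Subtype.val (α.symm_apply_apply x)
  rwa [e] at h

open scoped ComplexOrder in
/-- In a matroid C*-algebra without bounded trace, the ratio between the rank of the unit of a
large matrix algebra and the rank of a given projection is unbounded. -/
lemma exists_rank_mul_le (hA : HasNoBoundedTrace A) {𝓜 : Set (NonUnitalStarSubalgebra ℂ A)}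
    (hdir : DirectedOn (· ≤ ·) 𝓜)
    (hmat : ∀ M ∈ 𝓜, ∃ n : ℕ, 0 < n ∧ Nonempty (M ≃⋆ₐ[ℂ] Matrix (Fin n) (Fin n) ℂ))
    (hdense : Dense {a : A | ∃ M ∈ 𝓜, a ∈ M}) {M₁ : NonUnitalStarSubalgebra ℂ A} (hM₁ : M₁ ∈ 𝓜)
    {e : A} (heM : e ∈ M₁) (he : e * e = e) (he0 : e ≠ 0) (C : ℕ) :
    ∃ N ∈ 𝓜, ∃ h : M₁ ≤ N, ∃ n : ℕ, ∃ β : N ≃⋆ₐ[ℂ] Matrix (Fin n) (Fin n) ℂ, ∃ K : ℕ+,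
      0 < n ∧ (β ⟨e, h heM⟩).trace = K ∧ C * K ≤ n := by
  by_contra hcon
  push Not at hcon
  have hdata : ∀ N : {N // N ∈ 𝓜 ∧ M₁ ≤ N}, ∃ n : ℕ, ∃ β : N.1 ≃⋆ₐ[ℂ] Matrix (Fin n) (Fin n) ℂ,
      ∃ K : ℕ+, 0 < n ∧ (β ⟨e, N.2.2 heM⟩).trace = K := by
    rintro ⟨N, hN, hMN⟩
    obtain ⟨n, hn, ⟨β⟩⟩ := hmat N hN
    obtain ⟨K, hK, hKt⟩ := exists_trace_eq_natCast (E := β ⟨e, hMN heM⟩)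
      (by rw [← map_mul]; exact congrArg β (Subtype.ext he))
      (fun h => he0 (congrArg Subtype.val (β.injective (h.trans (map_zero β).symm))))
    exact ⟨n, β, ⟨K, hK⟩, hn, hKt⟩
  choose n β K hn hK using hdata
  have hn' : ∀ N, Nonempty (Fin (n N)) := fun N => ⟨⟨0, hn N⟩⟩
  -- Dividing by the rank of `e` cancels the multiplicities of the inclusions, so these traces are
  -- compatible. Each takes the value `1` at `e`.
  let t : ∀ (N : {N // N ∈ 𝓜 ∧ M₁ ≤ N}) (x : A), x ∈ N.1 → ℂ :=
    fun N x hx => (β N ⟨x, hx⟩).trace / K N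
  have hK0 : ∀ N, (K N : ℂ) ≠ 0 := fun N => by exact_mod_cast (K N).ne_zero
  have hle : ∀ (N N' : {N // N ∈ 𝓜 ∧ M₁ ≤ N}) (h : N.1 ≤ N'.1) (x : A) (hx : x ∈ N.1),
      t N' x (h hx) = t N x hx := by
    intro N N' h x hx
    obtain ⟨k, hk, hkt⟩ := exists_trace_restrict_eq h (β N) (β N')
    have h1 := hkt e (N.2.2 heM)
    rw [hK, hK] at h1
    have hk0 : (k : ℂ) ≠ 0 := by exact_mod_cast hk.ne'
    simp only [t]
    rw [hkt x hx, h1]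
    have := hK0 N
    field_simp
  have hub : ∀ N N' : {N // N ∈ 𝓜 ∧ M₁ ≤ N}, ∃ L : {N // N ∈ 𝓜 ∧ M₁ ≤ N},
      N.1 ≤ L.1 ∧ N'.1 ≤ L.1 := by
    rintro ⟨N, hN, hMN⟩ ⟨N', hN', hMN'⟩
    obtain ⟨L, hL, h1, h2⟩ := hdir N hN N' hN'
    exact ⟨⟨L, hL, hMN.trans h1⟩, h1, h2⟩
  have heq : ∀ N N' x hx hx', t N x hx = t N' x hx' := by
    intro N N' x hx hx'
    obtain ⟨L, h1, h2⟩ := hub N N'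
    rw [← hle N L h1, ← hle N' L h2]
  let D : Submodule ℂ A :=
    { carrier := {x | ∃ N : {N // N ∈ 𝓜 ∧ M₁ ≤ N}, x ∈ N.1}
      add_mem' := by
        rintro x y ⟨N, hx⟩ ⟨N', hy⟩
        obtain ⟨L, h1, h2⟩ := hub N N'
        exact ⟨L, add_mem (h1 hx) (h2 hy)⟩
      zero_mem' := ⟨⟨M₁, hM₁, le_rfl⟩, zero_mem _⟩
      smul_mem' := by
        rintro c x ⟨N, hx⟩
        exact ⟨N, SMulMemClass.smul_mem c hx⟩ }
  have hDdense : Dense (D : Set A) := by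
    refine hdense.mono ?_
    rintro x ⟨N, hN, hx⟩
    obtain ⟨L, hL, h1, h2⟩ := hdir N hN M₁ hM₁
    exact ⟨⟨L, hL, h2⟩, h1 hx⟩
  let T : D →ₗ[ℂ] ℂ :=
    { toFun := fun x => t x.2.choose x x.2.choose_spec
      map_add' := by
        intro x y
        obtain ⟨L, h1, h2⟩ := hub x.2.choose y.2.choose
        have hx := h1 x.2.choose_spec
        have hy := h2 y.2.choose_spec
        refine (heq _ L _ _ (show ((x + y : D) : A) ∈ L.1 from add_mem hx hy)).trans ?_
        rw [heq _ L x.1 _ hx, heq _ L y.1 _ hy]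
        simp only [t]
        rw [← add_div, ← Matrix.trace_add, ← map_add]
        rfl
      map_smul' := by
        intro c x
        have hx := x.2.choose_spec
        refine (heq _ x.2.choose _ _
          (show ((c • x : D) : A) ∈ x.2.choose.1 from SMulMemClass.smul_mem c hx)).trans ?_
        simp only [t]
        rw [RingHom.id_apply, smul_eq_mul, ← mul_div_assoc, ← smul_eq_mul, ← Matrix.trace_smul,
          ← map_smul]
        rfl }
  have hT : ∀ N x (hx : x ∈ N.1), T ⟨x, N, hx⟩ = t N x hx := fun N x hx => heq _ _ _ _ hx
  -- The trace on `n × n` matrices has norm at most `n`, and the negated conclusion says `n < C *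
  -- K`.
  have hbound : ∀ x : D, ‖T x‖ ≤ C * ‖D.subtype x‖ := by
    rintro ⟨x, N, hx⟩
    rw [hT N x hx]
    simp only [t]
    have hKpos : (0 : ℝ) < (K N : ℕ) := by exact_mod_cast (K N).pos
    have h1 := norm_trace_apply_le (β N) ⟨x, hx⟩
    have h2 := (hcon N.1 N.2.1 N.2.2 (n N) (β N) (K N) (hn N) (hK N)).le
    have h3 : (n N : ℝ) ≤ C * (K N : ℕ) := by exact_mod_cast h2
    rw [norm_div, Complex.norm_natCast, div_le_iff₀ hKpos]
    rw [Fintype.card_fin] at h1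
    calc _ ≤ (n N : ℝ) * ‖x‖ := h1
      _ ≤ C * (K N : ℕ) * ‖x‖ := by gcongr
      _ = C * ‖x‖ * (K N : ℕ) := by ring
  have hdr : DenseRange D.subtype := by
    rw [DenseRange, Submodule.coe_subtype, Subtype.range_coe]
    exact hDdense
  let τ : A →L[ℂ] ℂ := T.extendOfNorm D.subtype
  have hτ : ∀ N x (hx : x ∈ N.1), τ x = t N x hx := by
    intro N x hx
    rw [← hT]
    exact LinearMap.extendOfNorm_eq hdr ⟨C, hbound⟩ ⟨x, N, hx⟩
  have hτ0 : τ = 0 := by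
    refine hA τ ?_ ?_
    · have hcl : IsClosed {a : A | 0 ≤ τ (star a * a)} :=
        isClosed_le continuous_const (by fun_prop)
      refine fun a => (hcl.closure_subset_iff.2 ?_) (hDdense a)
      rintro x ⟨N, hx⟩
      rw [Set.mem_ofPred_eq, hτ N _ (mul_mem (star_mem hx) hx)]
      simp only [t]
      have h1 : β N ⟨star x * x, mul_mem (star_mem hx) hx⟩ =
          (β N ⟨x, hx⟩)ᴴ * β N ⟨x, hx⟩ := by
        rw [← Matrix.star_eq_conjTranspose, ← map_star, ← map_mul]
        rfl
      rw [h1]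
      refine div_nonneg (Matrix.posSemidef_conjTranspose_mul_self _).trace_nonneg ?_
      exact_mod_cast Nat.zero_le _
    · have hcl : IsClosed {p : A × A | τ (p.1 * p.2) = τ (p.2 * p.1)} :=
        isClosed_eq (by fun_prop) (by fun_prop)
      have hsub : (D : Set A) ×ˢ (D : Set A) ⊆ {p : A × A | τ (p.1 * p.2) = τ (p.2 * p.1)} := by
        rintro ⟨x, y⟩ ⟨⟨N, hx⟩, ⟨N', hy⟩⟩
        obtain ⟨L, h1, h2⟩ := hub N N'
        replace hx := h1 hx
        replace hy := h2 hy
        simp only [Set.mem_ofPred_eq]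
        rw [hτ L _ (mul_mem hx hy), hτ L _ (mul_mem hy hx)]
        simp only [t]
        have e1 : β L ⟨x * y, mul_mem hx hy⟩ = β L ⟨x, hx⟩ * β L ⟨y, hy⟩ := by
          rw [← map_mul]; rfl
        have e2 : β L ⟨y * x, mul_mem hy hx⟩ = β L ⟨y, hy⟩ * β L ⟨x, hx⟩ := by
          rw [← map_mul]; rfl
        rw [e1, e2, Matrix.trace_mul_comm]
      exact fun a b => (hcl.closure_subset_iff.2 hsub) ((hDdense.prod hDdense) (a, b))
  have h1 := hτ ⟨M₁, hM₁, le_rfl⟩ e heM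
  simp only [t] at h1
  rw [hτ0, hK, div_self (hK0 _)] at h1
  exact zero_ne_one h1

end MatroidTraces

/-! ### Towers of matrix algebras indexed by growing sets of integers -/

section MatrixTowers

open Matrix Filter Topology

variable {A : Type*} [NonUnitalCStarAlgebra A]

/-- An embedding of full matrix algebras can be brought to the form `dilate k`, by a choice of
the matrix units of the larger one. -/
lemma exists_starAlgEquiv_dilate {M N : NonUnitalStarSubalgebra ℂ A} (h : M ≤ N) {F : Finset ℤ}
    (hF : F.Nonempty) (α : M ≃⋆ₐ[ℂ] Matrix F F ℂ) {n : ℕ}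
    (β : N ≃⋆ₐ[ℂ] Matrix (Fin n) (Fin n) ℂ) :
    ∃ k : ℕ+, k * F.card ≤ n ∧ ∀ J : Finset ℤ, J.card = n → (∀ p : ℤ, p / k ∈ F → p ∈ J) →
      ∃ γ : N ≃⋆ₐ[ℂ] Matrix J J ℂ, ∀ x (hx : x ∈ M),
        γ ⟨x, h hx⟩ = dilate k J (α ⟨x, hx⟩) := by
  let b₀ := LinearMap.toMatrixOrthonormal (EuclideanSpace.basisFun (Fin n) ℂ)
  let f : Matrix F F ℂ →⋆ₙₐ[ℂ] (EuclideanSpace ℂ (Fin n) →ₗ[ℂ] EuclideanSpace ℂ (Fin n)) :=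
    ((β.trans b₀.symm : N →⋆ₙₐ[ℂ] (EuclideanSpace ℂ (Fin n) →ₗ[ℂ] EuclideanSpace ℂ (Fin n))).comp
      (NonUnitalStarSubalgebra.inclusion h)).comp (α.symm : Matrix F F ℂ →⋆ₙₐ[ℂ] M)
  have hf : Function.Injective f := ((β.trans b₀.symm).injective.comp
    (NonUnitalStarSubalgebra.inclusion_injective h)).comp α.symm.injective
  obtain ⟨k, hk, H⟩ := exists_orthonormalBasis_dilate hF f hf
  rw [finrank_euclideanSpace_fin] at hk H
  refine ⟨k, hk, fun J hJ hJF => ?_⟩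
  obtain ⟨b, hb⟩ := H J hJ hJF
  refine ⟨(β.trans b₀.symm).trans (LinearMap.toMatrixOrthonormal b), fun x hx => ?_⟩
  rw [← hb]
  change _ = LinearMap.toMatrixOrthonormal b ((β.trans b₀.symm)
    (NonUnitalStarSubalgebra.inclusion h (α.symm (α ⟨x, hx⟩))))
  rw [α.symm_apply_apply]
  rfl

variable (𝓜 : Set (NonUnitalStarSubalgebra ℂ A)) (e : A)

/-- A member of a family of full matrix algebras with a choice of matrix units, indexed by a set
of integers, and the rank of the projection `e`. -/
structure MatrixStage where
  alg : NonUnitalStarSubalgebra ℂ A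
  alg_mem : alg ∈ 𝓜
  mem : e ∈ alg
  supp : Finset ℤ
  equiv : alg ≃⋆ₐ[ℂ] Matrix supp supp ℂ
  rank : ℕ+
  trace_eq : (equiv ⟨e, mem⟩).trace = (rank : ℕ)

variable {𝓜 e}

/-- The stage `τ` is an extension of `σ` of multiplicity `k`, by the endomorphism `dilate k`. -/
structure MatrixStage.Extends (σ τ : MatrixStage 𝓜 e) (k : ℕ+) : Prop where
  le : σ.alg ≤ τ.alg
  equiv_eq : ∀ x (hx : x ∈ σ.alg), τ.equiv ⟨x, le hx⟩ = dilate k τ.supp (σ.equiv ⟨x, hx⟩)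
  supp : ∀ p : ℤ, p / k ∈ σ.supp → p ∈ τ.supp
  rank_eq : τ.rank = k * σ.rank

lemma MatrixStage.supp_nonempty (σ : MatrixStage 𝓜 e) : σ.supp.Nonempty := by
  by_contra h
  have : IsEmpty σ.supp := by
    rw [Finset.isEmpty_coe_sort]
    exact Finset.not_nonempty_iff_eq_empty.1 h
  have h1 := σ.trace_eq
  rw [Matrix.trace, Finset.univ_eq_empty, Finset.sum_empty] at h1
  exact σ.rank.ne_zero (by exact_mod_cast h1.symm)

lemma exists_finset_ediv_mem (k : ℕ+) (F : Finset ℤ) :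
    ∃ P : Finset ℤ, P.card ≤ k * F.card ∧ ∀ p : ℤ, p / k ∈ F → p ∈ P := by
  have hk : (0 : ℤ) < k := by exact_mod_cast k.pos
  refine ⟨(Finset.range k ×ˢ F).image fun x => (k : ℤ) * x.2 + x.1, ?_, fun p hp => ?_⟩
  · refine Finset.card_image_le.trans ?_
    rw [Finset.card_product, Finset.card_range]
  · have h0 := Int.emod_nonneg p hk.ne'
    have h1 := Int.emod_lt_of_pos p hk
    refine Finset.mem_image.2 ⟨((p % (k : ℤ)).toNat, p / k), ?_, ?_⟩
    · rw [Finset.mem_product, Finset.mem_range]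
      exact ⟨by omega, hp⟩
    · simp only [Int.toNat_of_nonneg h0, Int.mul_ediv_add_emod]

/-- The absence of a bounded trace leaves so many free indices in a large matrix algebra that its
index set can be made to contain a prescribed interval as well as the amplified support of `σ`. -/
lemma MatrixStage.exists_extends (hA : HasNoBoundedTrace A) (hdir : DirectedOn (· ≤ ·) 𝓜)
    (hmat : ∀ M ∈ 𝓜, ∃ n : ℕ, 0 < n ∧ Nonempty (M ≃⋆ₐ[ℂ] Matrix (Fin n) (Fin n) ℂ))
    (hdense : Dense {a : A | ∃ M ∈ 𝓜, a ∈ M}) (he : e * e = e) (he0 : e ≠ 0)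
    (σ : MatrixStage 𝓜 e) (i : ℕ) {U : Set A} (hU : IsOpen U) (hU' : U.Nonempty) :
    ∃ τ : MatrixStage 𝓜 e, (∃ k, σ.Extends τ k) ∧
      Finset.Ico (-(i * τ.rank : ℤ)) (i * τ.rank) ⊆ τ.supp ∧ ∃ a ∈ τ.alg, a ∈ U := by
  obtain ⟨a, haU, M, hM, haM⟩ := hdense.inter_open_nonempty U hU hU'
  obtain ⟨M₁, hM₁, h1, h2⟩ := hdir σ.alg σ.alg_mem M hM
  -- The amplified support needs at most `k * σ.supp.card ≤ σ.supp.card * K` indices and the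
  -- interval `2 * i * K`; this explains the constant.
  obtain ⟨N, hN, hMN, n, β, K, hn, htr, hle⟩ := exists_rank_mul_le hA hdir hmat hdense hM₁
    (h1 σ.mem) he he0 (σ.supp.card + 2 * i)
  have hσN : σ.alg ≤ N := h1.trans hMN
  obtain ⟨k, hk, H⟩ := exists_starAlgEquiv_dilate hσN σ.supp_nonempty σ.equiv β
  obtain ⟨P, hP, hPmem⟩ := exists_finset_ediv_mem k σ.supp
  have hFin : Nonempty (Fin n) := ⟨⟨0, hn⟩⟩
  have htrace : ∀ J : Finset ℤ, J.card = n → (∀ p : ℤ, p / k ∈ σ.supp → p ∈ J) →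
      ∀ γ : N ≃⋆ₐ[ℂ] Matrix J J ℂ, (∀ x (hx : x ∈ σ.alg),
        γ ⟨x, hσN hx⟩ = dilate k J (σ.equiv ⟨x, hx⟩)) → K = k * σ.rank := by
    intro J hJ hJF γ hγ
    have hJ' : Nonempty J := by
      rw [Finset.nonempty_coe_sort, ← Finset.card_pos, hJ]
      exact hn
    have e1 := hγ e σ.mem
    have e2 := congrArg Matrix.trace e1
    rw [trace_dilate k hJF, σ.trace_eq, trace_apply_eq β γ, htr] at e2
    exact PNat.coe_injective (by rw [PNat.mul_coe]; exact_mod_cast e2)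
  -- The multiplicity has to be compared with `K` before the final `J` can be chosen; a provisional
  -- index set suffices for that.
  have hKk : K = k * σ.rank := by
    obtain ⟨J, hPJ, hJ⟩ := Infinite.exists_superset_card_eq P n (hP.trans hk)
    obtain ⟨γ, hγ⟩ := H J hJ fun p hp => hPJ (hPmem p hp)
    exact htrace J hJ (fun p hp => hPJ (hPmem p hp)) γ hγ
  obtain ⟨J, hPJ, hJ⟩ := Infinite.exists_superset_card_eq
    (P ∪ Finset.Ico (-(i * K : ℤ)) (i * K)) n (by
      refine (Finset.card_union_le _ _).trans (le_trans ?_ hle)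
      have hc : (Finset.Ico (-(i * K : ℤ)) (i * K)).card = 2 * i * K := by
        rw [Int.card_Ico]
        have : ((i * K : ℤ) - -(i * K : ℤ)) = ((2 * i * K : ℕ) : ℤ) := by push_cast; ring
        rw [this, Int.toNat_natCast]
      rw [hc, add_mul]
      refine Nat.add_le_add_right (hP.trans ?_) _
      rw [mul_comm]
      refine Nat.mul_le_mul_left _ ?_
      rw [hKk, PNat.mul_coe]
      exact Nat.le_mul_of_pos_right _ σ.rank.pos)
  have hJF : ∀ p : ℤ, p / k ∈ σ.supp → p ∈ J := fun p hp =>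
    hPJ (Finset.mem_union_left _ (hPmem p hp))
  obtain ⟨γ, hγ⟩ := H J hJ hJF
  have hJ' : Nonempty J := by
    rw [Finset.nonempty_coe_sort, ← Finset.card_pos, hJ]
    exact hn
  exact ⟨⟨N, hN, hσN σ.mem, J, γ, K, by rw [trace_apply_eq β γ, htr]⟩, ⟨k, hσN, hγ, hJF, hKk⟩,
    Finset.subset_union_right.trans hPJ, a, hMN (h2 haM), haU⟩

lemma exists_matrixStage_seq (hA : IsInfiniteSeparableMatroid A) :
    ∃ (𝓜 : Set (NonUnitalStarSubalgebra ℂ A)) (e : A) (σ : ℕ → MatrixStage 𝓜 e) (k : ℕ → ℕ+),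
      (∀ i, (σ i).Extends (σ (i + 1)) (k i)) ∧
      (∀ i : ℕ, Finset.Ico (-(i * (σ (i + 1)).rank : ℤ)) (i * (σ (i + 1)).rank) ⊆
        (σ (i + 1)).supp) ∧
      Dense {a | ∃ i, a ∈ (σ i).alg} := by
  obtain ⟨⟨𝓜, hdir, hmat, hdense⟩, hsep, htr⟩ := hA
  obtain ⟨_, M₀, hM₀, -⟩ := hdense.nonempty
  obtain ⟨n, hn, ⟨β⟩⟩ := hmat M₀ hM₀
  let F : Finset ℤ := Finset.Ico 0 n
  have hF : F.card = n := by simp [F]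
  let ι : Fin n ≃ F := (Finset.equivFinOfCardEq hF).symm
  let α : M₀ ≃⋆ₐ[ℂ] Matrix F F ℂ := β.trans
    (StarAlgEquiv.ofAlgEquiv (Matrix.reindexAlgEquiv ℂ ℂ ι) (fun _ => rfl))
  let o : F := ι ⟨0, hn⟩
  let e := α.symm (single o o 1)
  have hee : e * e = e := by
    rw [← map_mul, single_mul_single_same, mul_one]
  have he0 : e ≠ 0 := by
    intro h
    have h1 := congrArg α h
    rw [α.apply_symm_apply, map_zero] at h1
    have h2 := congrFun (congrFun h1 o) o
    rw [single_apply_same] at h2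
    exact one_ne_zero h2
  let σ₀ : MatrixStage 𝓜 (e : A) := ⟨M₀, hM₀, e.2, F, α, 1, by
    rw [Subtype.coe_eta, α.apply_symm_apply, trace_single_eq_same]; simp⟩
  -- The unpairing runs over all centres in a dense sequence and all radii `1 / (m + 1)`. Stage `i +
  -- 1` meets the ball `U i`, which makes the union dense.
  let U : ℕ → Set A := fun i =>
    Metric.ball (TopologicalSpace.denseSeq A i.unpair.1) (1 / (i.unpair.2 + 1))
  have hstep := fun (i : ℕ) (σ : MatrixStage 𝓜 (e : A)) =>
    σ.exists_extends htr hdir hmat hdense (congrArg Subtype.val hee)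
      (fun h => he0 (Subtype.ext h)) i (U := U i) Metric.isOpen_ball
      ⟨_, Metric.mem_ball_self (by positivity)⟩
  choose next hnext using hstep
  let σ : ℕ → MatrixStage 𝓜 (e : A) := fun n => Nat.rec σ₀ next n
  have hσ : ∀ i, σ (i + 1) = next i (σ i) := fun i => rfl
  choose k hk using fun i => (hnext i (σ i)).1
  refine ⟨𝓜, e, σ, k, hk, fun i => (hnext i (σ i)).2.1, fun b => ?_⟩
  rw [Metric.mem_closure_iff]
  intro ε hε
  obtain ⟨_, ⟨j, rfl⟩, hj⟩ := Metric.mem_closure_iff.1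
    (TopologicalSpace.denseRange_denseSeq A b) (ε / 2) (by positivity)
  obtain ⟨m, hm⟩ := exists_nat_one_div_lt (show 0 < ε / 2 by positivity)
  obtain ⟨a, ha, haU⟩ := (hnext (Nat.pair j m) (σ (Nat.pair j m))).2.2
  refine ⟨a, ⟨Nat.pair j m + 1, ha⟩, ?_⟩
  simp only [U, Nat.unpair_pair, Metric.mem_ball] at haU
  calc dist b a ≤ dist b (TopologicalSpace.denseSeq A j) + dist (TopologicalSpace.denseSeq A j) a :=
        dist_triangle _ _ _
    _ < ε / 2 + ε / 2 := add_lt_add hj (by rw [dist_comm]; exact haU.trans hm)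
    _ = ε := add_halves ε

end MatrixTowers

/-! ### The flat action on positive fractions with given denominators -/

section Fractions

/-- The set of positive rational numbers with a denominator in the sequence `K`. -/
def PosFraction (K : ℕ → ℕ+) : Type :=
  {q : ℚ // ∃ (n : ℕ) (m : ℕ+), q = (m : ℕ) / (K n : ℕ)}

variable {K : ℕ → ℕ+}

instance : MulAction ℕ+ (PosFraction K) where
  smul k q := ⟨(k : ℕ) * q.1, by
    obtain ⟨n, m, h⟩ := q.2
    exact ⟨n, k * m, by rw [h, PNat.mul_coe]; push_cast; ring⟩⟩
  one_smul q := Subtype.ext (by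
    change ((1 : ℕ+) : ℕ) * q.1 = q.1
    simp)
  mul_smul k l q := Subtype.ext (by
    change ((k * l : ℕ+) : ℕ) * q.1 = (k : ℕ) * ((l : ℕ) * q.1)
    rw [PNat.mul_coe]; push_cast; ring)

/-- The fraction `1 / K n`. -/
def PosFraction.unit (K : ℕ → ℕ+) (n : ℕ) : PosFraction K := ⟨1 / (K n : ℕ), n, 1, by simp⟩

lemma PosFraction.coe_smul (k : ℕ+) (q : PosFraction K) : (k • q).1 = (k : ℕ) * q.1 := rfl

lemma PosFraction.exists_eq_smul_unit (q : PosFraction K) :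
    ∃ (n : ℕ) (m : ℕ+), q = m • PosFraction.unit K n := by
  obtain ⟨q, n, m, rfl⟩ := q
  exact ⟨n, m, Subtype.ext (by rw [coe_smul, unit]; ring)⟩

lemma PosFraction.smul_unit {n l : ℕ} {k : ℕ+} (h : K l = k * K n) :
    k • unit K l = unit K n := by
  refine Subtype.ext ?_
  change ((k : ℕ) * (1 / (K l : ℕ)) : ℚ) = 1 / (K n : ℕ)
  rw [h, PNat.mul_coe]
  have h1 : ((k : ℕ) : ℚ) ≠ 0 := by exact_mod_cast k.ne_zero
  have h2 : ((K n : ℕ) : ℚ) ≠ 0 := by exact_mod_cast (K n).ne_zero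
  push_cast
  field_simp

lemma exists_eq_mul_of_le {k : ℕ → ℕ+} (hK : ∀ n, K (n + 1) = k n * K n) {n l : ℕ} (h : n ≤ l) :
    ∃ j, K l = j * K n := by
  induction l, h using Nat.le_induction with
  | base => exact ⟨1, (one_mul _).symm⟩
  | succ l _ ih =>
    obtain ⟨j, hj⟩ := ih
    exact ⟨k l * j, by rw [hK, hj, mul_assoc]⟩

/-- The denominators form a divisibility chain, so two fractions are multiples of a common unit
fraction. -/
lemma PosFraction.isFlatAction {k : ℕ → ℕ+} (hK : ∀ n, K (n + 1) = k n * K n) :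
    IsFlatAction (PosFraction K) where
  nonempty := ⟨unit K 0⟩
  exists_common x y := by
    obtain ⟨n, m, rfl⟩ := PosFraction.exists_eq_smul_unit x
    obtain ⟨n', m', rfl⟩ := PosFraction.exists_eq_smul_unit y
    obtain ⟨j, hj⟩ := exists_eq_mul_of_le hK (le_max_left n n')
    obtain ⟨j', hj'⟩ := exists_eq_mul_of_le hK (le_max_right n n')
    exact ⟨unit K (max n n'), m * j, m' * j', by rw [mul_smul, smul_unit hj],
      by rw [mul_smul, smul_unit hj']⟩
  free x k l h := by
    have h1 := congrArg Subtype.val h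
    rw [coe_smul, coe_smul] at h1
    obtain ⟨q, n, m, rfl⟩ := x
    have hne : ((m : ℕ) / (K n : ℕ) : ℚ) ≠ 0 :=
      div_ne_zero (by exact_mod_cast m.ne_zero) (by exact_mod_cast (K n).ne_zero)
    exact PNat.coe_injective (by exact_mod_cast mul_right_cancel₀ hne h1)

end Fractions

/-! ### Every infinite separable matroid algebra comes from a flat action -/

section Existence

open Matrix

variable {A : Type*} [NonUnitalCStarAlgebra A]

/-- The embedding of the full matrix algebra of a stage. -/
noncomputable def MatrixStage.embed {𝓜 : Set (NonUnitalStarSubalgebra ℂ A)} {e : A}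
    (σ : MatrixStage 𝓜 e) : Matrix σ.supp σ.supp ℂ →⋆ₙₐ[ℂ] A :=
  (NonUnitalStarSubalgebraClass.subtype σ.alg).comp
    (σ.equiv.symm : Matrix σ.supp σ.supp ℂ →⋆ₙₐ[ℂ] σ.alg)

lemma MatrixStage.embed_injective {𝓜 : Set (NonUnitalStarSubalgebra ℂ A)} {e : A}
    (σ : MatrixStage 𝓜 e) : Function.Injective σ.embed :=
  Subtype.val_injective.comp σ.equiv.symm.injective

lemma MatrixStage.Extends.embed_dilate {𝓜 : Set (NonUnitalStarSubalgebra ℂ A)} {e : A}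
    {σ τ : MatrixStage 𝓜 e} {k : ℕ+} (h : σ.Extends τ k) (T : Matrix σ.supp σ.supp ℂ) :
    τ.embed (dilate k τ.supp T) = σ.embed T := by
  have h1 := h.equiv_eq _ (σ.equiv.symm T).2
  rw [Subtype.coe_eta, σ.equiv.apply_symm_apply] at h1
  rw [← h1]
  exact congrArg Subtype.val (τ.equiv.symm_apply_apply _)

/-- Every infinite separable matroid C*-algebra is the inductive limit of the compact operators
along a flat action. -/
theorem IsInfiniteSeparableMatroid.exists_flat (hA : IsInfiniteSeparableMatroid A) :
    ∃ (X : Type) (_ : MulAction ℕ+ X), IsFlatAction X ∧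
      ∀ (B : Type) [NonUnitalCStarAlgebra B], FrobSystem X B → Nonempty (A ≃⋆ₐ[ℂ] B) := by
  obtain ⟨𝓜, e, σ, k, hσ, hIco, hdense⟩ := exists_matrixStage_seq hA
  let K : ℕ → ℕ+ := fun n => (σ n).rank
  have hK : ∀ n, K (n + 1) = k n * K n := fun n => (hσ n).rank_eq
  refine ⟨PosFraction K, inferInstance, PosFraction.isFlatAction hK, fun B _ Φ => ?_⟩
  -- The same matrix is placed in `A`, as an element of the `n`-th stage, and in `B`, in the copy of
  -- `𝒦` at `1 / K n`. Both inclusions from `n` to `n + 1` are `dilate (k n)`, so the ranges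
  -- increase.
  let f : ∀ n, Matrix (σ n).supp (σ n).supp ℂ →⋆ₙₐ[ℂ] A × B := fun n =>
    (σ n).embed.prod (Φ.block (PosFraction.unit K n) (σ n).supp)
  let R : ℕ → NonUnitalStarSubalgebra ℂ (A × B) := fun n => NonUnitalStarAlgHom.range (f n)
  have hR : Monotone R := by
    refine monotone_nat_of_le_succ fun n => ?_
    rintro _ ⟨T, rfl⟩
    refine ⟨dilate (k n) (σ (n + 1)).supp T, Prod.ext ((hσ n).embed_dilate T) ?_⟩
    change Φ.block _ _ _ = Φ.block _ _ _
    rw [← Φ.block_smul _ _ (hσ n).supp, PosFraction.smul_unit (hK n)]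
  have hcoe := NonUnitalStarSubalgebra.coe_iSup_of_directed hR.directed_le
  have hmem : ∀ p, p ∈ (⨆ n, R n) ↔ ∃ n T, f n T = p := by
    intro p
    rw [← SetLike.mem_coe, hcoe, Set.mem_iUnion]
    rfl
  refine nonempty_starAlgEquiv_of_correspondence (⨆ n, R n) ?_ ?_ ?_
  · intro p hp
    obtain ⟨n, T, rfl⟩ := (hmem p).1 hp
    change ‖(σ n).embed T‖ = ‖Φ.block _ _ T‖
    rw [norm_eq_norm_of_injective _ (σ n).embed_injective,
      norm_eq_norm_of_injective _ (Φ.block_injective _ _)]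
  · refine hdense.mono ?_
    rintro a ⟨n, ha⟩
    refine ⟨f n ((σ n).equiv ⟨a, ha⟩), (hmem _).2 ⟨n, _, rfl⟩, ?_⟩
    exact congrArg Subtype.val ((σ n).equiv.symm_apply_apply _)
  · intro b
    rw [Metric.mem_closure_iff]
    intro ε hε
    obtain ⟨x, n, hn, T, hT⟩ := Φ.exists_block_near b hε
    obtain ⟨N, m, rfl⟩ := PosFraction.exists_eq_smul_unit x
    -- Seen from `1 / K l`, the given corner occupies `[-m * j * n, m * j * n)`, where `K l = j * K
    -- N`. As `j ≤ K l` and `m * n ≤ l'`, this lies in the interval of radius `l' * K l` contained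
    -- in the support of the stage `l = l' + 1`.
    let l := max N (m * n + 1)
    obtain ⟨l', hl'⟩ : ∃ l', l = l' + 1 := ⟨l - 1, by omega⟩
    have hl : m * n ≤ l' := by omega
    obtain ⟨j, hj⟩ := exists_eq_mul_of_le hK (le_max_left N (m * n + 1))
    have hjle : (j : ℕ) ≤ K l := by
      change (j : ℕ) ≤ K (max N (m * n + 1))
      rw [hj, PNat.mul_coe]
      exact Nat.le_mul_of_pos_right _ (K N).pos
    have hsub : ∀ p : ℤ, p / ((m * j : ℕ+) : ℕ) ∈ Finset.Ico (-n : ℤ) n → p ∈ (σ l).supp := by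
      intro p hp
      have h1 := mem_Ico_of_ediv_mem (m * j) (N := l' * K l) (by
        rw [PNat.mul_coe]
        calc (m : ℕ) * j * n = m * n * j := by ring
          _ ≤ l' * K l := Nat.mul_le_mul hl hjle) p hp
      have h2 := hIco l'
      rw [← hl'] at h2
      exact h2 (by exact_mod_cast h1)
    refine ⟨_, ⟨f l (dilate (m * j) (σ l).supp T), (hmem _).2 ⟨l, _, rfl⟩, rfl⟩, ?_⟩
    change dist b (Φ.block _ _ _) < ε
    rw [← Φ.block_smul _ _ hsub, mul_smul, PosFraction.smul_unit hj, dist_comm, dist_eq_norm]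
    exact hT

end Existence

/-! ### The involutive algebra structure of the object of compact operators -/

section OperatorAlgebraObj

open CategoryTheory MonoidalCategory CartesianMonoidalCategory

/-- A section of the object `𝒦`, as an element of the algebra of compact operators. -/
noncomputable def sectionOp {c : (SingleObj ℕ+)ᵒᵖ} (x : compactPresheaf.obj c) : KAlg :=
  ⟨opOf x, Subtype.prop (p := fun T => T ∈ CompactOps) x⟩

/-- A compact operator, as a section of the object `𝒦`. -/
noncomputable def opSection (c : (SingleObj ℕ+)ᵒᵖ) (x : KAlg) : compactPresheaf.obj c :=
  show CompactOps from ⟨x.1, x.2⟩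

/-- The operation on `𝒦` which is given by a map on the compact operators. -/
noncomputable def unaryOp (m : KAlg → KAlg) (hm : ∀ k x, frob k (m x) = m (frob k x)) :
    compactPresheaf ⟶ compactPresheaf where
  app c := TypeCat.ofHom fun x => opSection c (m (sectionOp x))
  naturality _ _ k := by
    ext x
    exact congrArg (opSection _) (hm k.unop (sectionOp x)).symm

/-- The operation on `𝒦` which is given by a binary operation on the compact operators. -/
noncomputable def binaryOp (m : KAlg → KAlg → KAlg)
    (hm : ∀ k x y, frob k (m x y) = m (frob k x) (frob k y)) :
    compactPresheaf ⊗ compactPresheaf ⟶ compactPresheaf where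
  app c := TypeCat.ofHom fun x => opSection c (m (sectionOp x.1) (sectionOp x.2))
  naturality _ _ k := by
    ext x
    exact congrArg (opSection _) (hm k.unop (sectionOp x.1) (sectionOp x.2)).symm

/-- The zero section of `𝒦`. -/
noncomputable def zeroOp : 𝟙_ ((SingleObj ℕ+)ᵒᵖ ⥤ Type) ⟶ compactPresheaf where
  app c := TypeCat.ofHom fun _ => opSection c 0
  naturality _ _ k := by
    ext x
    exact congrArg (opSection _) (map_zero (frob k.unop)).symm

/-- The compact operators, with their usual operations, as an involutive algebra in the topos. -/
noncomputable def operatorAlgebraObj : InvolutiveAlgebraObj compactPresheaf where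
  zero := zeroOp
  add := binaryOp (· + ·) fun k x y => map_add (frob k) x y
  neg := unaryOp (- ·) fun k x => map_neg (frob k) x
  smul z := unaryOp (z • ·) fun k x => map_smul (frob k) z x
  mul := binaryOp (· * ·) fun k x y => map_mul (frob k) x y
  star := unaryOp star fun k x => map_star (frob k) x
  add_assoc f g h := by
    ext c x
    exact congrArg (opSection c) (_root_.add_assoc (sectionOp (f.app c x)) (sectionOp (g.app c x))
      (sectionOp (h.app c x)))
  add_comm f g := by
    ext c x
    exact congrArg (opSection c)
      (_root_.add_comm (sectionOp (f.app c x)) (sectionOp (g.app c x)))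
  zero_add f := by
    ext c x
    exact congrArg (opSection c) (_root_.zero_add (sectionOp (f.app c x)))
  neg_add_cancel f := by
    ext c x
    exact congrArg (opSection c) (_root_.neg_add_cancel (sectionOp (f.app c x)))
  one_smul := by
    ext c x
    exact congrArg (opSection c) (_root_.one_smul ℂ (sectionOp x))
  mul_smul a b := by
    ext c x
    exact congrArg (opSection c) (SemigroupAction.mul_smul a b (sectionOp x))
  smul_add a _ f g := by
    ext c x
    exact congrArg (opSection c)
      (_root_.smul_add a (sectionOp (f.app c x)) (sectionOp (g.app c x)))
  add_smul a b _ f := by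
    ext c x
    exact congrArg (opSection c) (_root_.add_smul a b (sectionOp (f.app c x)))
  mul_assoc f g h := by
    ext c x
    exact congrArg (opSection c) (_root_.mul_assoc (sectionOp (f.app c x)) (sectionOp (g.app c x))
      (sectionOp (h.app c x)))
  left_distrib f g h := by
    ext c x
    exact congrArg (opSection c) (mul_add (sectionOp (f.app c x)) (sectionOp (g.app c x))
      (sectionOp (h.app c x)))
  right_distrib f g h := by
    ext c x
    exact congrArg (opSection c) (add_mul (sectionOp (f.app c x)) (sectionOp (g.app c x))
      (sectionOp (h.app c x)))
  smul_mul a _ f g := by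
    ext c x
    exact congrArg (opSection c)
      (smul_mul_assoc a (sectionOp (f.app c x)) (sectionOp (g.app c x)))
  mul_smul_comm a _ f g := by
    ext c x
    exact congrArg (opSection c)
      (_root_.mul_smul_comm a (sectionOp (f.app c x)) (sectionOp (g.app c x)))
  star_star := by
    ext c x
    exact congrArg (opSection c) (_root_.star_star (sectionOp x))
  star_add f g := by
    ext c x
    exact congrArg (opSection c)
      (StarAddMonoid.star_add (sectionOp (f.app c x)) (sectionOp (g.app c x)))
  star_mul f g := by
    ext c x
    exact congrArg (opSection c)
      (StarMul.star_mul (sectionOp (f.app c x)) (sectionOp (g.app c x)))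
  star_smul a := by
    ext c x
    exact congrArg (opSection c) (StarModule.star_smul a (sectionOp x))

lemma isOperatorAlgebraObj_operatorAlgebraObj : IsOperatorAlgebraObj operatorAlgebraObj where
  add _ _ := rfl
  smul _ _ := rfl
  mul _ _ := rfl
  star _ := rfl

end OperatorAlgebraObj

/-! ### Points of the topos and flat actions -/

section Points

open CategoryTheory MonoidalCategory CartesianMonoidalCategory Opposite

/-- The set with an action of `ℕ^×` which corresponds to a point. -/
def NTimesPoint.Carrier (p : NTimesPoint) : Type := p.fiber.obj (SingleObj.star ℕ+)

instance (p : NTimesPoint) : MulAction ℕ+ p.Carrier where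
  smul k x := p.fiber.map (X := SingleObj.star ℕ+) (Y := SingleObj.star ℕ+) k x
  one_smul x := congrArg (fun f => f x) (p.fiber.map_id (SingleObj.star ℕ+))
  mul_smul k l x := congrArg (fun f => f x) (p.fiber.map_comp (X := SingleObj.star ℕ+)
    (Y := SingleObj.star ℕ+) (Z := SingleObj.star ℕ+) l k)

lemma NTimesPoint.isFlatAction (p : NTimesPoint) : IsFlatAction p.Carrier where
  nonempty := by
    obtain ⟨⟨⟨⟩, x⟩⟩ := IsCofiltered.nonempty (C := p.fiber.Elements)
    exact ⟨x⟩
  exists_common x y := by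
    let x' : p.fiber.Elements := ⟨SingleObj.star ℕ+, x⟩
    let y' : p.fiber.Elements := ⟨SingleObj.star ℕ+, y⟩
    exact ⟨(IsCofiltered.min x' y').2, (IsCofiltered.minToLeft x' y').1,
      (IsCofiltered.minToRight x' y').1, (IsCofiltered.minToLeft x' y').2,
      (IsCofiltered.minToRight x' y').2⟩
  free x k l h := by
    let x' : p.fiber.Elements := ⟨SingleObj.star ℕ+, x⟩
    let y' : p.fiber.Elements := ⟨SingleObj.star ℕ+, k • x⟩
    let f : x' ⟶ y' := ⟨k, rfl⟩
    let g : x' ⟶ y' := ⟨l, h.symm⟩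
    -- If `k • x = l • x`, then `k` and `l` are parallel arrows of the category of elements. An
    -- arrow equalizing them is a positive integer, which can be cancelled.
    have h1 := congrArg (fun u => (u.1 : ℕ+)) (IsCofiltered.eq_condition f g)
    exact mul_right_cancel (b := (show ℕ+ from (IsCofiltered.eqHom f g).1)) h1

/-- Morphisms of points are natural transformations of fibers in the opposite direction, whence the
order of `q` and `p`. -/
lemma nonempty_iso_of_equiv {p q : NTimesPoint} (g : p.Carrier ≃ q.Carrier)
    (hg : ∀ (k : ℕ+) (x : p.Carrier), g (k • x) = k • g x) : Nonempty (Iso q p) := by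
  have hg' : ∀ (k : ℕ+) (x : q.Carrier), g.symm (k • x) = k • g.symm x := fun k x => by
    rw [Equiv.symm_apply_eq, hg, g.apply_symm_apply]
  refine ⟨⟨⟨⟨fun _ => TypeCat.ofHom g, fun _ _ k => ?_⟩⟩,
    ⟨⟨fun _ => TypeCat.ofHom g.symm, fun _ _ k => ?_⟩⟩, ?_, ?_⟩⟩
  · ext x
    exact hg k x
  · ext x
    exact hg' k x
  · ext c x
    exact g.apply_symm_apply x
  · ext c x
    exact g.symm_apply_apply x

/-- The point which corresponds to a flat action. -/
lemma IsFlatAction.exists_point {X : Type} [MulAction ℕ+ X] (hX : IsFlatAction X) :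
    ∃ (p : NTimesPoint) (g : X ≃ p.Carrier), ∀ (k : ℕ+) (x : X), g (k • x) = k • g x := by
  let F : SingleObj ℕ+ ⥤ Type :=
    { obj := fun _ => X
      map := fun k => TypeCat.ofHom fun x => (show ℕ+ from k) • x
      map_id := fun _ => by
        ext x
        exact one_smul ℕ+ x
      map_comp := fun k l => by
        ext x
        exact mul_smul (show ℕ+ from l) (show ℕ+ from k) x }
  have h1 : IsCofiltered F.Elements :=
    { nonempty := by
        obtain ⟨x⟩ := hX.nonempty
        exact ⟨⟨SingleObj.star ℕ+, x⟩⟩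
      cone_objs := by
        rintro ⟨⟨⟩, x⟩ ⟨⟨⟩, y⟩
        obtain ⟨z, k, l, hk, hl⟩ := hX.exists_common x y
        exact ⟨⟨SingleObj.star ℕ+, z⟩, ⟨k, hk⟩, ⟨l, hl⟩, trivial⟩
      cone_maps := by
        rintro ⟨⟨⟩, x⟩ ⟨⟨⟩, y⟩ ⟨k, hk⟩ ⟨l, hl⟩
        obtain rfl : k = l := hX.free x k l (hk.trans hl.symm)
        exact ⟨⟨SingleObj.star ℕ+, x⟩, 𝟙 _, rfl⟩ }
  refine ⟨{ fiber := F
            isCofiltered := h1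
            initiallySmall := initiallySmall_of_essentiallySmall _
            jointly_surjective := ?_ }, Equiv.refl X, fun _ _ => rfl⟩
  intro c R hR x
  -- For the trivial topology only the maximal sieve covers, so the covering condition is witnessed
  -- by the identity.
  obtain rfl : R = ⊤ := by simpa using hR
  exact ⟨c, 𝟙 _, trivial, x, by rw [F.map_id]; rfl⟩

end Points

/-! ### Germs: the stalk as a union of copies of the compact operators -/

section Stalks

open CategoryTheory MonoidalCategory CartesianMonoidalCategory Opposite InvolutiveAlgebraObj

variable (p : NTimesPoint)

lemma el_toPresheafFiber {P T : (SingleObj ℕ+)ᵒᵖ ⥤ Type} (S : InvolutiveAlgebraObj P) (f : T ⟶ P)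
    (x : p.fiber.obj (SingleObj.star ℕ+)) (t : T.obj (op (SingleObj.star ℕ+))) :
    S.el p.presheafFiber f (p.toPresheafFiber _ x T t) =
      p.toPresheafFiber _ x P (f.app _ t) :=
  p.toPresheafFiber_naturality_apply f _ x t

/-- The germ of a compact operator at an element of the flat action given by a point. -/
noncomputable def germFun (x : p.Carrier) (T : KAlg) : operatorAlgebraObj.Stalk p :=
  p.toPresheafFiber (SingleObj.star ℕ+) x compactPresheaf (opSection _ T)

lemma el_germFun (x : p.Carrier) (f : compactPresheaf ⟶ compactPresheaf) (T : KAlg) :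
    operatorAlgebraObj.el p.presheafFiber f (germFun p x T) =
      germFun p x (sectionOp (f.app (op (SingleObj.star ℕ+)) (opSection _ T))) :=
  el_toPresheafFiber p _ f x _

/-- The germ of a pair is the pair of germs at the same `x`, so binary operations of the stalk are
computed there on representatives. -/
lemma germFun_binary (x : p.Carrier) (T T' : KAlg) :
    ∃ e, operatorAlgebraObj.el p.presheafFiber (fst compactPresheaf compactPresheaf) e =
        germFun p x T ∧
      operatorAlgebraObj.el p.presheafFiber (snd compactPresheaf compactPresheaf) e =
        germFun p x T' ∧
      ∀ m : compactPresheaf ⊗ compactPresheaf ⟶ compactPresheaf,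
        operatorAlgebraObj.el p.presheafFiber (lift (fst _ _) (snd _ _) ≫ m) e =
          germFun p x
            (sectionOp (m.app (op (SingleObj.star ℕ+)) (opSection _ T, opSection _ T'))) := by
  let t : (compactPresheaf ⊗ compactPresheaf).obj (op (SingleObj.star ℕ+)) :=
    (opSection _ T, opSection _ T')
  exact ⟨p.toPresheafFiber _ x (compactPresheaf ⊗ compactPresheaf) t,
    el_toPresheafFiber p _ _ x t, el_toPresheafFiber p _ _ x t,
    fun m => el_toPresheafFiber p _ _ x t⟩

/-- The homomorphism from the compact operators to the stalk which is given by an element of the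
flat action. -/
noncomputable def germ (x : p.Carrier) : KAlg →⋆ₙₐ[ℂ] operatorAlgebraObj.Stalk p where
  toFun := germFun p x
  map_smul' z T := by
    have h := operatorAlgebraObj.fiber_smul p.presheafFiber z (𝟙 _) (germFun p x T)
    rw [el_germFun, el_germFun] at h
    exact h.symm
  map_zero' := by
    have h := operatorAlgebraObj.fiber_zero p.presheafFiber (germFun p x 0)
    rw [el_germFun] at h
    exact h.symm
  map_add' T T' := by
    obtain ⟨e, h1, h2, h3⟩ := germFun_binary p x T T'
    have h := operatorAlgebraObj.fiber_add p.presheafFiber (fst _ _) (snd _ _) e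
    rw [h1, h2, h3] at h
    exact h.symm
  map_mul' T T' := by
    obtain ⟨e, h1, h2, h3⟩ := germFun_binary p x T T'
    have h := operatorAlgebraObj.fiber_mul p.presheafFiber (fst _ _) (snd _ _) e
    rw [h1, h2, h3] at h
    exact h.symm
  map_star' T := by
    have h := operatorAlgebraObj.fiber_star p.presheafFiber (𝟙 _) (germFun p x T)
    rw [el_germFun, el_germFun] at h
    exact h.symm

lemma germ_smul (k : ℕ+) (x : p.Carrier) (T : KAlg) : germ p (k • x) T = germ p x (frob k T) :=
  (p.toPresheafFiber_w_apply (X := SingleObj.star ℕ+) (Y := SingleObj.star ℕ+) k x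
    compactPresheaf (opSection _ T)).symm

/-- Two elements with the same germ at `x` become equal under some `Fr_k`, which is injective. -/
lemma germ_injective (x : p.Carrier) : Function.Injective (germ p x) := by
  intro T T' h
  obtain ⟨⟨⟩, k, y, -, hk⟩ := (p.toPresheafFiber_eq_iff' (P := compactPresheaf)
    (SingleObj.star ℕ+) x (opSection _ T) (opSection _ T')).1 h
  exact frob_injective k hk

lemma exists_germ_eq (s : operatorAlgebraObj.Stalk p) : ∃ x T, germ p x T = s := by
  obtain ⟨⟨⟩, x, T, h⟩ := p.toPresheafFiber_jointly_surjective (P := compactPresheaf) s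
  exact ⟨x, sectionOp T, h⟩

end Stalks

/-! ### The completion of an algebra with a C*-norm -/

section CStarCompletion

open UniformSpace UniformSpace.Completion

lemma isometry_star_of_cstarRing {S : Type*} [NonUnitalNormedRing S] [StarRing S] [CStarRing S] :
    Isometry (star : S → S) :=
  AddMonoidHomClass.isometry_of_norm (starAddEquiv : S ≃+ S) fun x => norm_star (E := S) x

lemma map_star_coe {S : Type*} [NonUnitalNormedRing S] [StarRing S] [CStarRing S] (a : S) :
    Completion.map star (a : Completion S) = ((star a : S) : Completion S) :=
  Completion.map_coe isometry_star_of_cstarRing.uniformContinuous a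

variable (S : Type v) [NonUnitalNormedRing S] [NormedSpace ℂ S]
  [IsScalarTower ℂ S S] [SMulCommClass ℂ S S]

/-- The multiplication of the completion of an algebra, as a bilinear map. -/
noncomputable def completionMul : Completion S →L[ℂ] Completion S →L[ℂ] Completion S :=
  -- The product is extended by continuity in the right factor first, then in the left one; the
  -- flips bring the factor in question to the front.
  ((((ContinuousLinearMap.compL ℂ S S (Completion S) toComplL).comp
    (ContinuousLinearMap.mul ℂ S)).flip.extend toComplL).flip).extend toComplL

variable {S}

lemma completionMul_coe (a b : S) : completionMul S a b = ((a * b : S) : Completion S) := by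
  have hd : DenseRange (toComplL : S →L[ℂ] Completion S) := denseRange_coe
  have hu : IsUniformInducing (toComplL : S →L[ℂ] Completion S) := isUniformInducing_coe S
  have h1 : completionMul S a = _ := ContinuousLinearMap.extend_eq _ hd hu a
  rw [h1, ContinuousLinearMap.flip_apply]
  have h2 := ContinuousLinearMap.extend_eq ((ContinuousLinearMap.compL ℂ S S (Completion S)
    toComplL).comp (ContinuousLinearMap.mul ℂ S)).flip hd hu b
  exact congrArg (fun f => f a) h2

/-- The completion of a normed algebra is a normed ring. -/
noncomputable abbrev completionNonUnitalNormedRing : NonUnitalNormedRing (Completion S) where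
  __ := (inferInstance : NormedAddCommGroup (Completion S))
  mul x y := completionMul S x y
  left_distrib x y z := map_add (completionMul S x) y z
  right_distrib x y z := by
    change completionMul S (x + y) z = completionMul S x z + completionMul S y z
    rw [map_add, add_apply]
  zero_mul x := by
    change completionMul S 0 x = 0
    rw [map_zero, zero_apply]
  mul_zero x := map_zero (completionMul S x)
  mul_assoc x y z := by
    change completionMul S (completionMul S x y) z = completionMul S x (completionMul S y z)
    induction x, y, z using Completion.induction_on₃ with
    | hp => exact isClosed_eq (by fun_prop) (by fun_prop)
    | ih a b c => simp only [completionMul_coe, mul_assoc]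
  norm_mul_le x y := by
    change ‖completionMul S x y‖ ≤ ‖x‖ * ‖y‖
    induction x, y using Completion.induction_on₂ with
    | hp => exact isClosed_le (by fun_prop) (by fun_prop)
    | ih a b =>
      rw [completionMul_coe, norm_coe, norm_coe, norm_coe]
      exact norm_mul_le a b

attribute [local instance] completionNonUnitalNormedRing

lemma completion_mul_def (x y : Completion S) : x * y = completionMul S x y := rfl

lemma completion_isScalarTower : IsScalarTower ℂ (Completion S) (Completion S) where
  smul_assoc c x y := by
    simp only [smul_eq_mul, completion_mul_def]
    rw [map_smul, smul_apply]

lemma completion_smulCommClass : SMulCommClass ℂ (Completion S) (Completion S) where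
  smul_comm c x y := (map_smul (completionMul S x) c y).symm

variable [StarRing S] [CStarRing S]

/-- The involution of the completion of an algebra with a C*-norm. -/
noncomputable abbrev completionStarRing : StarRing (Completion S) where
  star := Completion.map star
  star_involutive x := by
    induction x using Completion.induction_on with
    | hp => exact isClosed_eq (continuous_map.comp continuous_map) continuous_id
    | ih a => rw [map_star_coe, map_star_coe, star_star]
  star_mul x y := by
    have hc : Continuous (Completion.map (star : S → S)) := continuous_map
    simp only [completion_mul_def]
    induction x, y using Completion.induction_on₂ with
    | hp => exact isClosed_eq (by fun_prop) (by fun_prop)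
    | ih a b => simp only [completionMul_coe, map_star_coe, star_mul]
  star_add x y := by
    have hc : Continuous (Completion.map (star : S → S)) := continuous_map
    induction x, y using Completion.induction_on₂ with
    | hp => exact isClosed_eq (by fun_prop) (by fun_prop)
    | ih a b => simp only [← Completion.coe_add, map_star_coe, star_add]

attribute [local instance] completionStarRing

lemma completion_star_coe (a : S) : star (a : Completion S) = ((star a : S) : Completion S) :=
  map_star_coe a

lemma continuous_completion_star : Continuous (star : Completion S → Completion S) :=
  continuous_map

lemma completion_cstarRing : CStarRing (Completion S) where
  norm_mul_self_le x := by
    have hc := continuous_completion_star (S := S)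
    rw [completion_mul_def]
    induction x using Completion.induction_on with
    | hp => exact isClosed_le (by fun_prop) (by fun_prop)
    | ih a =>
      rw [completion_star_coe, completionMul_coe, norm_coe, norm_coe]
      exact CStarRing.norm_mul_self_le a

lemma completion_starModule [StarModule ℂ S] : StarModule ℂ (Completion S) where
  star_smul c x := by
    have hc := continuous_completion_star (S := S)
    induction x using Completion.induction_on with
    | hp => exact isClosed_eq (hc.comp (continuous_const_smul c)) (hc.const_smul (star c))
    | ih a =>
      rw [← Completion.coe_smul, completion_star_coe, completion_star_coe, star_smul,
        Completion.coe_smul]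

/-- The completion of an algebra with a C*-norm is a C*-algebra. -/
noncomputable abbrev completionCStarAlgebra [StarModule ℂ S] :
    NonUnitalCStarAlgebra (Completion S) :=
  { completionNonUnitalNormedRing, completionStarRing, completion_cstarRing,
    completion_isScalarTower, completion_smulCommClass, completion_starModule,
    (inferInstance : NormedSpace ℂ (Completion S)),
    (inferInstance : CompleteSpace (Completion S)) with }

end CStarCompletion

/-! ### From a C*-norm given as a function to a C*-algebra -/

section UnbundledNorm

open UniformSpace

variable {S : Type v} [NonUnitalRing S] [StarRing S] [Module ℂ S] [IsScalarTower ℂ S S]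
  [SMulCommClass ℂ S S] [StarModule ℂ S]

/-- An involutive algebra with a C*-norm is a dense subalgebra of a C*-algebra. -/
theorem exists_cstarAlgebra_of_norm (N : S → ℝ) (hadd : ∀ x y, N (x + y) ≤ N x + N y)
    (hsmul : ∀ (c : ℂ) x, N (c • x) = ‖c‖ * N x) (hzero : ∀ x, N x = 0 → x = 0)
    (hmul : ∀ x y, N (x * y) ≤ N x * N y) (hstar : ∀ x, N (star x * x) = N x * N x) :
    ∃ (B : Type v) (_ : NonUnitalCStarAlgebra B) (φ : S →⋆ₙₐ[ℂ] B),
      (∀ x, ‖φ x‖ = N x) ∧ DenseRange φ := by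
  let g : AddGroupNorm S :=
    { toFun := N
      map_zero' := by simpa using hsmul 0 0
      add_le' := hadd
      neg' := fun x => by simpa using hsmul (-1) x
      eq_zero_of_map_eq_zero' := hzero }
  let i1 : NonUnitalNormedRing S :=
    { g.toNormedAddCommGroup, ‹NonUnitalRing S› with
      norm_mul_le := hmul }
  let i2 : NormedSpace ℂ S := { norm_smul_le := fun c x => (hsmul c x).le }
  have i3 : CStarRing S := ⟨fun x => (hstar x).ge⟩
  let i4 : NonUnitalCStarAlgebra (Completion S) := completionCStarAlgebra
  refine ⟨Completion S, i4,
    { toFun := fun x => (x : Completion S)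
      map_smul' := fun c x => Completion.coe_smul c x
      map_zero' := Completion.coe_zero
      map_add' := fun x y => Completion.coe_add x y
      map_mul' := fun x y => (completionMul_coe x y).symm
      map_star' := fun x => (map_star_coe x).symm }, fun x => Completion.norm_coe x,
    Completion.denseRange_coe⟩

end UnbundledNorm

/-! ### The C*-norm of a stalk -/

section StalkCompletion

open CategoryTheory

variable (p : NTimesPoint)

lemma exists_germ_eq₂ (s t : operatorAlgebraObj.Stalk p) :
    ∃ x T T', germ p x T = s ∧ germ p x T' = t := by
  obtain ⟨x, T, rfl⟩ := exists_germ_eq p s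
  obtain ⟨y, T', rfl⟩ := exists_germ_eq p t
  obtain ⟨z, k, l, rfl, rfl⟩ := p.isFlatAction.exists_common x y
  exact ⟨z, frob k T, frob l T', (germ_smul p k z T).symm, (germ_smul p l z T').symm⟩

lemma norm_frob (k : ℕ+) (T : KAlg) : ‖frob k T‖ = ‖T‖ :=
  NonUnitalStarAlgHom.norm_map (frob k) (frob_injective k) T

/-- Over a common `z` the two representatives have equal images under `Fr_k` and `Fr_l`, which are
isometric. So the norm of any representative defines a norm on the stalk. -/
lemma norm_eq_of_germ_eq {x y : p.Carrier} {T T' : KAlg} (h : germ p x T = germ p y T') :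
    ‖T‖ = ‖T'‖ := by
  obtain ⟨z, k, l, rfl, rfl⟩ := p.isFlatAction.exists_common x y
  rw [germ_smul, germ_smul] at h
  rw [← norm_frob k, germ_injective p z h, norm_frob]

lemma exists_stalk_completion : ∃ (B : Type) (_ : NonUnitalCStarAlgebra B)
    (φ : operatorAlgebraObj.Stalk p →⋆ₙₐ[ℂ] B),
    (∀ x T, ‖φ (germ p x T)‖ = ‖T‖) ∧ DenseRange φ := by
  choose x T hT using exists_germ_eq p
  have hN : ∀ y T', ‖T (germ p y T')‖ = ‖T'‖ := fun y T' => norm_eq_of_germ_eq p (hT _)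
  have H := exists_cstarAlgebra_of_norm (fun s => ‖T s‖) ?_ ?_ ?_ ?_ ?_
  · obtain ⟨B, i, φ, h1, h2⟩ := H
    exact ⟨B, i, φ, fun y T' => (h1 _).trans (hN y T'), h2⟩
  · intro s t
    obtain ⟨y, U, V, rfl, rfl⟩ := exists_germ_eq₂ p s t
    simp only [← map_add, hN]
    exact norm_add_le U V
  · intro c s
    obtain ⟨y, U, rfl⟩ := exists_germ_eq p s
    simp only [← map_smul, hN]
    exact norm_smul c U
  · intro s hs
    rw [← hT s, norm_eq_zero.1 hs, map_zero]
  · intro s t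
    obtain ⟨y, U, V, rfl, rfl⟩ := exists_germ_eq₂ p s t
    simp only [← map_mul, hN]
    exact norm_mul_le U V
  · intro s
    obtain ⟨y, U, rfl⟩ := exists_germ_eq p s
    have h : star (germ p y U) * germ p y U = germ p y (star U * U) := by
      rw [map_mul, map_star]
    rw [h, hN, hN]
    exact CStarRing.norm_star_mul_self (x := U)

end StalkCompletion

/-! ### The C*-norm in terms of spectra -/

section SpectralNorm

/-- The homomorphism extends to a unital one between the unitizations, which preserves
invertibility. -/
lemma spectrum_unitization_map_subset {A B : Type*} [NonUnitalRing A] [StarRing A] [Module ℂ A]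
    [IsScalarTower ℂ A A] [SMulCommClass ℂ A A] [StarModule ℂ A]
    [NonUnitalRing B] [StarRing B] [Module ℂ B]
    [IsScalarTower ℂ B B] [SMulCommClass ℂ B B] [StarModule ℂ B] (φ : A →⋆ₙₐ[ℂ] B) (a : A) :
    spectrum ℂ ((φ a : B) : Unitization ℂ B) ⊆ spectrum ℂ (a : Unitization ℂ A) := by
  have h := AlgHom.spectrum_apply_subset (Unitization.starMap φ) (a : Unitization ℂ A)
  rwa [Unitization.starMap_inr] at h

variable {A : Type*} [NonUnitalCStarAlgebra A]

lemma norm_le_of_mem_spectrum_star_mul_self {a : A} {z : ℂ}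
    (hz : z ∈ spectrum ℂ ((star a * a : A) : Unitization ℂ A)) : √‖z‖ ≤ ‖a‖ := by
  have h := spectrum.norm_le_norm_of_mem hz
  rw [Unitization.norm_inr, CStarRing.norm_star_mul_self] at h
  exact Real.sqrt_le_iff.2 ⟨norm_nonneg a, by rwa [sq]⟩

lemma exists_mem_spectrum_star_mul_self (a : A) :
    ∃ z ∈ spectrum ℂ ((star a * a : A) : Unitization ℂ A), √‖z‖ = ‖a‖ := by
  obtain ⟨z, hz, h⟩ := spectrum.exists_nnnorm_eq_spectralRadius
    ((star a * a : A) : Unitization ℂ A)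
  have hs : IsSelfAdjoint ((star a * a : A) : Unitization ℂ A) :=
    (IsSelfAdjoint.star_mul_self a).inr ℂ
  rw [hs.spectralRadius_eq_nnnorm] at h
  have h1 : ‖z‖ = ‖((star a * a : A) : Unitization ℂ A)‖ :=
    congrArg NNReal.toReal (ENNReal.coe_injective h)
  rw [Unitization.norm_inr, CStarRing.norm_star_mul_self] at h1
  exact ⟨z, hz, by rw [h1, Real.sqrt_mul_self (norm_nonneg a)]⟩

variable {S : Type*} [NonUnitalRing S] [StarRing S] [Module ℂ S]
  [IsScalarTower ℂ S S] [SMulCommClass ℂ S S]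

lemma IsCStarCompletion.trans_starAlgEquiv {B : Type*} [NonUnitalCStarAlgebra B]
    {φ : S →⋆ₙₐ[ℂ] B} (h : IsCStarCompletion φ) (g : B ≃⋆ₐ[ℂ] A) :
    IsCStarCompletion ((g : B →⋆ₙₐ[ℂ] A).comp φ) where
  injective := g.injective.comp h.injective
  denseRange := by
    have hg : Continuous g :=
      (NonUnitalStarAlgHom.isometry (g : B →⋆ₙₐ[ℂ] A) g.injective).continuous
    exact g.surjective.denseRange.comp h.denseRange hg
  isLUB_norm x := by
    have e : ‖((g : B →⋆ₙₐ[ℂ] A).comp φ) x‖ = ‖φ x‖ :=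
      NonUnitalStarAlgHom.norm_map (g : B →⋆ₙₐ[ℂ] A) g.injective (φ x)
    rw [e]
    exact h.isLUB_norm x

end SpectralNorm

/-! ### Completed stalks as inductive limits, and the conclusion -/

section Final

variable (p : NTimesPoint)

/-- The spectrum of `star s * s` in the stalk contains the one in `B`, where the norm is attained,
and is contained in the one in `𝒦`, where it is bounded by the same norm. Hence the spectral formula
holds in the stalk although the stalk need not be complete. -/
lemma exists_isCStarCompletion : ∃ (B : Type) (_ : NonUnitalCStarAlgebra B)
    (φ : operatorAlgebraObj.Stalk p →⋆ₙₐ[ℂ] B), IsCStarCompletion φ := by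
  obtain ⟨B, i, φ, hnorm, hdense⟩ := exists_stalk_completion p
  refine ⟨B, i, φ, ?_, hdense, fun s => ?_⟩
  · rw [injective_iff_map_eq_zero]
    intro s hs
    obtain ⟨x, T, rfl⟩ := exists_germ_eq p s
    have h := hnorm x T
    rw [hs, norm_zero] at h
    rw [norm_eq_zero.1 h.symm, map_zero]
  · obtain ⟨x, T, rfl⟩ := exists_germ_eq p s
    refine IsGreatest.isLUB ⟨?_, ?_⟩
    · obtain ⟨z, hz, h⟩ := exists_mem_spectrum_star_mul_self (φ (germ p x T))
      refine ⟨z, spectrum_unitization_map_subset φ _ ?_, h⟩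
      rwa [map_mul, map_star φ]
    · rintro _ ⟨z, hz, rfl⟩
      rw [hnorm]
      refine norm_le_of_mem_spectrum_star_mul_self
        (spectrum_unitization_map_subset (germ p x) _ ?_)
      rwa [map_mul, map_star (germ p x)]

variable {p}

/-- The completion of the stalk at a point is the inductive limit of the compact operators along
the flat action given by the point. -/
noncomputable def IsCStarCompletion.frobSystem {B : Type*} [NonUnitalCStarAlgebra B]
    {φ : operatorAlgebraObj.Stalk p →⋆ₙₐ[ℂ] B} (h : IsCStarCompletion φ) :
    FrobSystem p.Carrier B where
  hom x := φ.comp (germ p x)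
  injective x := h.injective.comp (germ_injective p x)
  hom_smul k x T := congrArg φ (germ_smul p k x T)
  dense := by
    refine h.denseRange.mono ?_
    rintro _ ⟨s, rfl⟩
    obtain ⟨x, T, rfl⟩ := exists_germ_eq p s
    exact ⟨x, T, rfl⟩

/-- Transport of a system along an isomorphism of actions. -/
def FrobSystem.comapEquiv {X Y B : Type*} [MulAction ℕ+ X] [MulAction ℕ+ Y]
    [NonUnitalCStarAlgebra B] (Φ : FrobSystem Y B) (g : X ≃ Y)
    (hg : ∀ (k : ℕ+) (x : X), g (k • x) = k • g x) : FrobSystem X B where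
  hom x := Φ.hom (g x)
  injective x := Φ.injective (g x)
  hom_smul k x T := by rw [hg, Φ.hom_smul]
  dense := by
    refine Φ.dense.mono ?_
    rintro _ ⟨y, T, rfl⟩
    exact ⟨g.symm y, T, by rw [g.apply_symm_apply]⟩

end Final

theorem proposition7p3 :
    ∃ S : InvolutiveAlgebraObj compactPresheaf, IsOperatorAlgebraObj S ∧
      (∀ p : NTimesPoint, IsPreCStarAlgebra (S.Stalk p) ∧
        ∀ (B : Type) [NonUnitalCStarAlgebra B], IsCompletedBy (S.Stalk p) B →
          IsInfiniteSeparableMatroid B) ∧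
      (∀ (A : Type u) [NonUnitalCStarAlgebra A], IsInfiniteSeparableMatroid A →
        ∃ p : NTimesPoint, IsCompletedBy (S.Stalk p) A ∧
          ∀ q : NTimesPoint, IsCompletedBy (S.Stalk q) A →
            Nonempty (CategoryTheory.Iso q p)) := by
  refine ⟨operatorAlgebraObj, isOperatorAlgebraObj_operatorAlgebraObj, fun p =>
    ⟨exists_isCStarCompletion p, fun B _ ⟨φ, hφ⟩ =>
      hφ.frobSystem.isInfiniteSeparableMatroid p.isFlatAction⟩, fun A _ hA => ?_⟩
  obtain ⟨X, i, hX, H⟩ := hA.exists_flat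
  obtain ⟨p, g, hg⟩ := hX.exists_point
  obtain ⟨B, j, φ, hφ⟩ := exists_isCStarCompletion p
  -- The completed stalk and `A` are limits along the same action, hence isomorphic, and the
  -- completion can be transported to `A`.
  obtain ⟨e⟩ := H B (hφ.frobSystem.comapEquiv g hg)
  have hp := hφ.trans_starAlgEquiv e.symm
  refine ⟨p, ⟨_, hp⟩, fun q ⟨ψ, hψ⟩ => ?_⟩
  obtain ⟨f, hf⟩ := hp.frobSystem.exists_equiv hψ.frobSystem p.isFlatAction q.isFlatAction
  exact nonempty_iso_of_equiv f hf
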